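/- **Setting.** Let $A$ be a von Neumann algebra, i.e. a $C^*$-algebra with a fixed $*$-isomorphism onto a von Neumann algebra acting on a Hilbert space, and let $\tau\colon A\to\mathbb C$ be a positive ($\tau(a^*a)\ge 0$), faithful ($\tau(a^*a)=0$ only for $a=0$), normalized ($\tau(1)=1$) and normal (ultraweakly continuous) trace. *Hilbert $A$-modules.* A Hilbert $A$-module is a right $A$-module $V$ with an $A$-valued inner product $\langle\cdot,\cdot\rangle$ (right $A$-linear in the second variable, $\langle v,w\rangle^*=\langle w,v\rangle$, positive definite), complete for the norm $\|\langle v,v\rangle\|^{1/2}$; morphisms are the adjointable $A$-linear maps. It is *finitely generated projective* if it is an orthogonal direct summand of some $A^n$. For a Hilbert space $H$ with orthonormal basis indexed by $I$, let $H\otimes A$ be the (von Neumann algebraic) Hilbert $A$-module of all families $(a_i)_{i\in I}$ in $A$ whose finite partial sums $\sum_{i\in F}a_i^*a_i$ are bounded, with $\langle a,b\rangle=\sum_i a_i^*b_i$ (ultraweakly convergent). A Hilbert $A$-module is *projective* if it is an orthogonal direct summand of some $H\otimes A$. Let $l^2(V)$ be the Hilbert space completion of $V$ for the scalar product $\tau(\langle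 v,w\rangle)$, with the induced right action of $A$; a morphism $f\colon V\to W$ extends to a bounded $A$-linear operator $l^2(f)\colon l^2(V)\to l^2(W)$. *$A$-Hilbert spaces.* A Hilbert space $X$ with a right action of $A$ is a *finitely generated projective $A$-Hilbert space* if it embeds isometrically and $A$-linearly into $l^2(A)^n$ for some $n$, such that the orthogonal projection $p$ onto it is left multiplication by an element of $M_n(A)$. It is an *$A$-Hilbert space* if it embeds isometrically and $A$-linearly into $H\otimes l^2(A)$ for some Hilbert space $H$, such that the orthogonal projection $p$ onto it belongs to the von Neumann algebra $\mathcal B(H)\otimes A$ ($A$ acting by left multiplication). Morphisms are the bounded $A$-linear operators. Put $A(X)=p(A^n)\subset X$, respectively $A(X)=p(H\otimes A)\subset X$, with the $A$-valued inner product of $A^n$, respectively $H\otimes A$. *Bundles.* A bundle of Hilbert $A$-modules or of $A$-Hilbert spaces is a locally trivial bundle whose transition functions are isometric isomorphisms depending continuously (smoothly, for smooth bundles) on the base point, as maps into the Banach spaces of morphisms; morphisms of bundles are the continuous (smooth) families of morphisms of the fibers. A connection on a smooth bundle $E\to M$ is an additive map $\nabla\colon\Gamma(E)\to\Gamma(T^*M\otimes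 E)$ with $\nabla(sf)=s\,df+\nabla(s)f$ for all smooth $f\colon M\to A$. Morphisms of bundles with connection are the parallel ones, $\nabla'(fs)=f(\nabla s)$. If $W$ is a Hilbert $A$-module bundle, $l^2(W)$ is obtained by applying $l^2$ to the fibers and transition functions. **Theorem.** 1. If $V$ is a finitely generated projective (respectively projective) Hilbert $A$-module, then $l^2(V)$ is a finitely generated projective $A$-Hilbert space (respectively an $A$-Hilbert space). The Hilbert $A$-module $A(X)$ does not depend on the presentation of $X$, and $A(X)=X\cap A^n$ (respectively $X\cap (H\otimes A)$). The functor $V\mapsto l^2(V)$ is an equivalence from the category of finitely generated projective Hilbert $A$-modules to the category of finitely generated projective $A$-Hilbert spaces, and from the category of projective Hilbert $A$-modules to the category of $A$-Hilbert spaces; in both cases a quasi-inverse is given by $X\mapsto A(X)$, the natural isomorphism $l^2(A(X))\to X$ being the extension of the inclusion $A(X)\subset X$. 2. Applying $l^2$ and $A(\cdot)$ fiberwise gives quasi-inverse equivalences between finitely generated projective Hilbert $A$-module bundles and finitely generated projective $A$-Hilbert space bundles over every locally compact Hausdorff space, and between the smooth ones over every smooth manifold. 3. Let $M$ be a smooth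 manifold and $W$ a smooth finitely generated projective Hilbert $A$-module bundle on $M$. Every connection on $W$ extends uniquely to a connection on $l^2(W)$, every connection on $l^2(W)$ restricts to a unique connection on $W$, and if $f\colon W\to W'$ is parallel, then so is $l^2(f)$ for the extended connections. The functor $l^2$ and, fiberwise, $A(\cdot)$ give quasi-inverse equivalences between smooth finitely generated projective Hilbert $A$-module bundles with connection and smooth finitely generated projective $A$-Hilbert space bundles with connection, on $M$. -/

import Mathlib

open CategoryTheory
open scoped ComplexOrder ContDiff Manifold

universe u w

set_option linter.unusedSectionVars false

namespace AHilb

noncomputable section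

/-! ### Hilbert `A`-modules -/

/-- A (right) Hilbert `A`-module: a right `A`-module (that is, an `Aᵐᵒᵖ`-module) with an `A`-valued
inner product, complete for the norm `‖v‖ = ‖⟨v, v⟩‖ ^ (1/2)`. -/
structure HilbMod (A : Type u) [CStarAlgebra A] [PartialOrder A] where
  carrier : Type u
  [normedAddCommGroup : NormedAddCommGroup carrier]
  [normedSpace : NormedSpace ℂ carrier]
  [completeSpace : CompleteSpace carrier]
  [module : Module Aᵐᵒᵖ carrier]
  [isScalarTower : IsScalarTower ℂ Aᵐᵒᵖ carrier]
  inn : carrier → carrier → A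
  inn_smul_right : ∀ v w a, inn v (MulOpposite.op a • w) = inn v w * a
  inn_add_left : ∀ v₁ v₂ w, inn (v₁ + v₂) w = inn v₁ w + inn v₂ w
  star_inn : ∀ v w, star (inn v w) = inn w v
  inn_self_nonneg : ∀ v, 0 ≤ inn v v
  inn_self_eq_zero : ∀ v, inn v v = 0 ↔ v = 0
  norm_eq : ∀ v, ‖v‖ = √‖inn v v‖

namespace HilbMod

variable {A : Type u} [CStarAlgebra A] [PartialOrder A]

instance : CoeSort (HilbMod A) (Type u) := ⟨HilbMod.carrier⟩

attribute [instance] HilbMod.normedAddCommGroup HilbMod.normedSpace HilbMod.completeSpace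
  HilbMod.module HilbMod.isScalarTower

theorem inn_add_right (V : HilbMod A) (v w₁ w₂ : V) :
    V.inn v (w₁ + w₂) = V.inn v w₁ + V.inn v w₂ := by
  rw [← V.star_inn, V.inn_add_left, star_add, V.star_inn, V.star_inn]

theorem smul_eq (V : HilbMod A) (z : ℂ) (v : V) : z • v = MulOpposite.op (z • (1 : A)) • v := by
  rw [MulOpposite.op_smul, smul_assoc, MulOpposite.op_one, one_smul]

theorem inn_csmul_right (V : HilbMod A) (z : ℂ) (v w : V) : V.inn v (z • w) = z • V.inn v w := by
  rw [V.smul_eq, V.inn_smul_right, mul_smul_comm, mul_one]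

theorem inn_csmul_left (V : HilbMod A) (z : ℂ) (v w : V) :
    V.inn (z • v) w = star z • V.inn v w := by
  rw [← V.star_inn, V.inn_csmul_right, star_smul, V.star_inn]

theorem inn_smul_left (V : HilbMod A) (a : A) (v w : V) :
    V.inn (MulOpposite.op a • v) w = star a * V.inn v w := by
  rw [← V.star_inn, V.inn_smul_right, star_mul, V.star_inn]

theorem inn_zero_left (V : HilbMod A) (w : V) : V.inn 0 w = 0 := by
  have := V.inn_csmul_left 0 0 w
  simpa using this

theorem inn_zero_right (V : HilbMod A) (w : V) : V.inn w 0 = 0 := by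
  have := V.inn_csmul_right 0 w 0
  simpa using this

theorem inn_sub_right (V : HilbMod A) (v w₁ w₂ : V) :
    V.inn v (w₁ - w₂) = V.inn v w₁ - V.inn v w₂ := by
  rw [eq_sub_iff_add_eq, ← V.inn_add_right, sub_add_cancel]

theorem ext_inn (V : HilbMod A) {w₁ w₂ : V} (h : ∀ v, V.inn v w₁ = V.inn v w₂) : w₁ = w₂ := by
  rw [← sub_eq_zero, ← V.inn_self_eq_zero, V.inn_sub_right, h, sub_self]

theorem norm_sq (V : HilbMod A) (v : V) : ‖v‖ ^ 2 = ‖V.inn v v‖ := by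
  rw [V.norm_eq, Real.sq_sqrt (norm_nonneg _)]

/-- `Hom_A(V, W)`: the continuous right `A`-linear maps that have an adjoint, as a subspace of the
bounded operators (so that it carries the operator norm). -/
def adjointable (V W : HilbMod A) : Submodule ℂ (V →L[ℂ] W) where
  carrier := {f | (∀ (a : A) (v : V), f (MulOpposite.op a • v) = MulOpposite.op a • f v) ∧
    ∃ g : W → V, ∀ v w, W.inn (f v) w = V.inn v (g w)}
  add_mem' := by
    rintro f f' ⟨hf, g, hg⟩ ⟨hf', g', hg'⟩
    refine ⟨fun a v => by simp [hf, hf'], fun w => g w + g' w, fun v w => ?_⟩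
    simp [W.inn_add_left, V.inn_add_right, hg, hg']
  zero_mem' := ⟨fun a v => by simp, fun _ => 0, fun v w => by
    simp [W.inn_zero_left, V.inn_zero_right]⟩
  smul_mem' := by
    rintro z f ⟨hf, g, hg⟩
    refine ⟨fun a v => ?_, fun w => star z • g w, fun v w => ?_⟩
    · rw [smul_apply, hf, smul_apply, W.smul_eq,
        W.smul_eq, smul_smul, smul_smul, ← MulOpposite.op_mul, ← MulOpposite.op_mul]
      simp
    · rw [smul_apply, W.inn_csmul_left, V.inn_csmul_right, hg]

instance : Category.{u} (HilbMod A) where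
  Hom V W := adjointable V W
  id V := ⟨ContinuousLinearMap.id ℂ V, fun _ _ => rfl, id, fun _ _ => rfl⟩
  comp {U V W} f g := ⟨g.1.comp f.1, fun a v => by
      rw [ContinuousLinearMap.comp_apply, f.2.1, g.2.1, ContinuousLinearMap.comp_apply], by
      obtain ⟨f', hf'⟩ := f.2.2
      obtain ⟨g', hg'⟩ := g.2.2
      exact ⟨fun w => f' (g' w), fun v w => by
        rw [ContinuousLinearMap.comp_apply, hg', hf']⟩⟩

/-- The operator underlying a morphism of Hilbert `A`-modules. -/
def Hom.op {V W : HilbMod A} (f : V ⟶ W) : V →L[ℂ] W := Subtype.val f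

theorem hom_ext {V W : HilbMod A} {f g : V ⟶ W} (h : ∀ v, Hom.op f v = Hom.op g v) : f = g :=
  Subtype.ext (ContinuousLinearMap.ext h)

instance (V W : HilbMod A) : NormedAddCommGroup (V ⟶ W) :=
  inferInstanceAs (NormedAddCommGroup (adjointable V W))

instance (V W : HilbMod A) : NormedSpace ℂ (V ⟶ W) :=
  inferInstanceAs (NormedSpace ℂ (adjointable V W))

@[simp] theorem op_id (V : HilbMod A) (v : V) : Hom.op (𝟙 V) v = v := rfl

@[simp] theorem op_comp {U V W : HilbMod A} (f : U ⟶ V) (g : V ⟶ W) (v : U) :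
    Hom.op (f ≫ g) v = Hom.op g (Hom.op f v) := rfl

theorem norm_def {V W : HilbMod A} (f : V ⟶ W) : ‖f‖ = ‖Hom.op f‖ := rfl

/-- `g` is the adjoint of `f`. -/
def IsAdjoint {V W : HilbMod A} (f : V ⟶ W) (g : W ⟶ V) : Prop :=
  ∀ v w, W.inn (Hom.op f v) w = V.inn v (Hom.op g w)

/-- `V` is (isomorphic to) an orthogonal direct summand of `F`: there is a morphism `i : V ⟶ F`
with `i* i = 1`. Then `i` preserves the inner products, `i i*` is a projection with range `i V`, and
`F` is the orthogonal sum of `i V` and the kernel of `i i*`. -/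
def IsSummand (V F : HilbMod A) : Prop :=
  ∃ (i : V ⟶ F) (p : F ⟶ V), IsAdjoint i p ∧ i ≫ p = 𝟙 V

/-- The Hilbert `A`-module `A`, with `⟨a, b⟩ = a* b`. -/
def self (A : Type u) [CStarAlgebra A] [PartialOrder A] [StarOrderedRing A] : HilbMod A where
  carrier := A
  inn a b := star a * b
  inn_smul_right v w a := by simp [mul_assoc]
  inn_add_left v₁ v₂ w := by simp [add_mul]
  star_inn v w := by simp
  inn_self_nonneg v := star_mul_self_nonneg v
  inn_self_eq_zero v := CStarRing.star_mul_self_eq_zero_iff v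
  norm_eq v := by rw [CStarRing.norm_star_mul_self, Real.sqrt_mul_self (norm_nonneg _)]

end HilbMod


/-- The underlying type of `A^n`. -/
def Free (A : Type u) (n : ℕ) : Type u := Fin n → A

namespace Free

variable (A : Type u) [CStarAlgebra A] [PartialOrder A] [StarOrderedRing A] (n : ℕ)

instance : AddCommGroup (Free A n) := inferInstanceAs (AddCommGroup (Fin n → A))
instance : Module ℂ (Free A n) := inferInstanceAs (Module ℂ (Fin n → A))
instance : Module Aᵐᵒᵖ (Free A n) := inferInstanceAs (Module Aᵐᵒᵖ (Fin n → A))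
instance : IsScalarTower ℂ Aᵐᵒᵖ (Free A n) :=
  inferInstanceAs (IsScalarTower ℂ Aᵐᵒᵖ (Fin n → A))

/-- Entrywise adjoint, as a map to Mathlib's left module of `n`-tuples; only used to obtain
the norm `‖∑ aᵢ* aᵢ‖ ^ (1/2)`. -/
def starMap : Free A n →+ (WithCStarModule A (Fin n → A)) where
  toFun a := (WithCStarModule.equiv A (Fin n → A)).symm (fun i => star (a i))
  map_zero' := by
    refine congrArg (WithCStarModule.equiv A (Fin n → A)).symm (funext fun i => ?_)
    exact star_zero A
  map_add' a b := by
    refine congrArg (WithCStarModule.equiv A (Fin n → A)).symm (funext fun i => ?_)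
    exact star_add (a i) (b i)

theorem starMap_injective : Function.Injective (starMap A n) := by
  intro a b h
  funext i
  exact star_injective (congrFun h i)

theorem starMap_surjective : Function.Surjective (starMap A n) := fun b =>
  ⟨fun i => star (b i), funext fun i => star_star (b i)⟩

instance : NormedAddCommGroup (Free A n) :=
  NormedAddCommGroup.induced (Free A n) (WithCStarModule A (Fin n → A)) (starMap A n) (starMap_injective A n)

theorem norm_eq (a : Free A n) : ‖a‖ = √‖∑ i, star (a i) * a i‖ := by
  change ‖starMap A n a‖ = _
  rw [WithCStarModule.pi_norm]
  congr 2
  refine Finset.sum_congr rfl fun i _ => ?_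
  change star (a i) * star (star (a i)) = _
  rw [star_star]

instance : NormedSpace ℂ (Free A n) where
  norm_smul_le z a := by
    refine le_of_eq ?_
    have : ∑ i, star ((z • a) i) * (z • a) i = (star z * z) • ∑ i, star (a i) * a i := by
      rw [Finset.smul_sum]
      refine Finset.sum_congr rfl fun i _ => ?_
      change star (z • a i) * (z • a i) = _
      rw [star_smul, smul_mul_smul_comm]
    rw [norm_eq, norm_eq, this, norm_smul, Real.sqrt_mul (norm_nonneg _), norm_mul, norm_star,
      Real.sqrt_mul_self (norm_nonneg _)]

instance : CompleteSpace (Free A n) := by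
  have h : Isometry (starMap A n) := AddMonoidHomClass.isometry_of_norm _ fun _ => rfl
  have : CompleteSpace (WithCStarModule A (Fin n → A)) := inferInstance
  exact (h.isUniformInducing.completeSpace_congr (starMap_surjective A n)).2 this

end Free

namespace HilbMod

variable {A : Type u} [CStarAlgebra A] [PartialOrder A] [StarOrderedRing A]

/-- The Hilbert `A`-module `A^n`, with `⟨a, b⟩ = ∑ aᵢ* bᵢ`. -/
def free (A : Type u) [CStarAlgebra A] [PartialOrder A] [StarOrderedRing A] (n : ℕ) :
    HilbMod A where
  carrier := Free A n
  inn a b := ∑ i, star (a i) * b i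
  inn_smul_right v w a := by
    rw [Finset.sum_mul]
    exact Finset.sum_congr rfl fun i _ => (mul_assoc _ _ _).symm
  inn_add_left v₁ v₂ w := by
    rw [← Finset.sum_add_distrib]
    refine Finset.sum_congr rfl fun i _ => ?_
    change star (v₁ i + v₂ i) * w i = _
    rw [star_add, add_mul]
  star_inn v w := by simp
  inn_self_nonneg v := Finset.sum_nonneg fun i _ => star_mul_self_nonneg (v i)
  inn_self_eq_zero v := by
    rw [← norm_eq_zero (a := v), Free.norm_eq, Real.sqrt_eq_zero (norm_nonneg _), norm_eq_zero]
  norm_eq v := Free.norm_eq A n v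

/-- Left multiplication by `a` on the right Hilbert `A`-module `A`. -/
def leftMul (a : A) : self A ⟶ self A :=
  ⟨ContinuousLinearMap.mul ℂ A a, fun (b v : A) => (mul_assoc a v b).symm,
    fun (w : A) => star a * w, fun (v w : A) => by
      change star (a * v) * w = star v * (star a * w)
      rw [star_mul, mul_assoc]⟩

/-- Finitely generated projective Hilbert `A`-modules: orthogonal direct summands of `A^n`. -/
def IsFGProjective : ObjectProperty (HilbMod A) := fun V => ∃ n : ℕ, IsSummand V (free A n)

end HilbMod

/-! ### `A`-Hilbert spaces -/

/-- A Hilbert space with a right action of `A` by bounded operators, compatible with adjoints. -/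
structure HilbSp (A : Type u) [CStarAlgebra A] where
  carrier : Type u
  [normedAddCommGroup : NormedAddCommGroup carrier]
  [innerProductSpace : InnerProductSpace ℂ carrier]
  [completeSpace : CompleteSpace carrier]
  act : Aᵐᵒᵖ →⋆ₐ[ℂ] (carrier →L[ℂ] carrier)

namespace HilbSp

variable {A : Type u} [CStarAlgebra A]

instance : CoeSort (HilbSp A) (Type u) := ⟨HilbSp.carrier⟩

attribute [instance] HilbSp.normedAddCommGroup HilbSp.innerProductSpace HilbSp.completeSpace

/-- The bounded `A`-linear operators. -/
def intertwiners (X Y : HilbSp A) : Submodule ℂ (X →L[ℂ] Y) where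
  carrier := {f | ∀ a x, f (X.act a x) = Y.act a (f x)}
  add_mem' {f g} hf hg a x := by simp [hf a x, hg a x]
  zero_mem' a x := by simp
  smul_mem' z f hf a x := by simp [hf a x]

instance : Category.{u} (HilbSp A) where
  Hom X Y := intertwiners X Y
  id X := ⟨ContinuousLinearMap.id ℂ X, fun _ _ => rfl⟩
  comp {X Y Z} f g := ⟨g.1.comp f.1, fun a x => by
    rw [ContinuousLinearMap.comp_apply, f.2, g.2, ContinuousLinearMap.comp_apply]⟩

/-- The operator underlying a morphism. -/
def Hom.op {X Y : HilbSp A} (f : X ⟶ Y) : X →L[ℂ] Y := Subtype.val f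

theorem hom_ext {X Y : HilbSp A} {f g : X ⟶ Y} (h : Hom.op f = Hom.op g) : f = g :=
  Subtype.ext h

instance (X Y : HilbSp A) : NormedAddCommGroup (X ⟶ Y) :=
  inferInstanceAs (NormedAddCommGroup (intertwiners X Y))

instance (X Y : HilbSp A) : NormedSpace ℂ (X ⟶ Y) :=
  inferInstanceAs (NormedSpace ℂ (intertwiners X Y))

@[simp] theorem op_id (X : HilbSp A) (x : X) : Hom.op (𝟙 X) x = x := rfl

@[simp] theorem op_comp {X Y Z : HilbSp A} (f : X ⟶ Y) (g : Y ⟶ Z) (x : X) :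
    Hom.op (f ≫ g) x = Hom.op g (Hom.op f x) := rfl

end HilbSp

/-! ### Traces and the functor `l²` -/

/-- A positive faithful normalized trace on `A`. -/
structure FTrace (A : Type u) [CStarAlgebra A] where
  toFun : A →ₗ[ℂ] ℂ
  map_mul_comm : ∀ a b, toFun (a * b) = toFun (b * a)
  pos : ∀ a, 0 ≤ toFun (star a * a)
  faithful : ∀ a, toFun (star a * a) = 0 → a = 0
  map_one : toFun 1 = 1

namespace FTrace

variable {A : Type u} [CStarAlgebra A] (τ : FTrace A)

instance : CoeFun (FTrace A) (fun _ => A → ℂ) := ⟨fun τ => τ.toFun⟩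

theorem map_add (a b : A) : τ (a + b) = τ a + τ b := LinearMap.map_add _ _ _
theorem map_sub (a b : A) : τ (a - b) = τ a - τ b := LinearMap.map_sub _ _ _
theorem map_smul (z : ℂ) (a : A) : τ (z • a) = z * τ a := LinearMap.map_smul _ _ _

theorem map_star (a : A) : τ (star a) = star (τ a) := by
  have h1 : (τ (star (1 + a) * (1 + a))).im = 0 := (Complex.nonneg_iff.1 (τ.pos (1 + a))).2.symm
  have h2 : (τ (star (1 + Complex.I • a) * (1 + Complex.I • a))).im = 0 :=
    (Complex.nonneg_iff.1 (τ.pos _)).2.symm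
  have h3 : (τ (star a * a)).im = 0 := (Complex.nonneg_iff.1 (τ.pos a)).2.symm
  have e1 : star (1 + a) * (1 + a) = 1 + a + (star a + star a * a) := by
    simp [add_mul, mul_add]
    abel
  have e2 : star (1 + Complex.I • a) * (1 + Complex.I • a)
      = 1 + Complex.I • a + ((-Complex.I) • star a + star a * a) := by
    simp [add_mul, mul_add, smul_smul]
    abel
  rw [e1] at h1
  rw [e2] at h2
  simp only [map_add, map_smul, τ.map_one, Complex.add_im, Complex.mul_im, Complex.one_im,
    Complex.I_re, Complex.I_im, Complex.neg_re, Complex.neg_im, h3] at h1 h2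
  apply Complex.ext
  · simp
    linarith
  · simp
    linarith

section order

variable [PartialOrder A] [StarOrderedRing A]

theorem nonneg {a : A} (ha : 0 ≤ a) : 0 ≤ τ a := by
  obtain ⟨b, rfl⟩ := CStarAlgebra.nonneg_iff_eq_star_mul_self.1 ha
  exact τ.pos b

theorem mono {a b : A} (h : a ≤ b) : τ a ≤ τ b := by
  have := τ.nonneg (sub_nonneg.2 h)
  rwa [map_sub, sub_nonneg] at this

theorem re_mono {a b : A} (h : a ≤ b) : (τ a).re ≤ (τ b).re := (Complex.le_def.1 (τ.mono h)).1

theorem eq_zero {a : A} (ha : 0 ≤ a) (h : τ a = 0) : a = 0 := by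
  obtain ⟨b, rfl⟩ := CStarAlgebra.nonneg_iff_eq_star_mul_self.1 ha
  rw [τ.faithful b h, mul_zero]

theorem re_le_norm {a : A} (ha : 0 ≤ a) : (τ a).re ≤ ‖a‖ := by
  have h := τ.re_mono (IsSelfAdjoint.le_algebraMap_norm_self (a := a) (IsSelfAdjoint.of_nonneg ha))
  have e : (algebraMap ℝ A ‖a‖) = (‖a‖ : ℂ) • (1 : A) := by
    rw [Algebra.algebraMap_eq_smul_one, Complex.coe_smul]
  rwa [e, map_smul, τ.map_one, mul_one, Complex.ofReal_re] at h

theorem conj_le {x : A} (hx : 0 ≤ x) (a : A) :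
    (τ (star a * x * a)).re ≤ ‖a‖ ^ 2 * (τ x).re := by
  obtain ⟨c, rfl⟩ := CStarAlgebra.nonneg_iff_eq_star_mul_self.1 hx
  have e1 : τ (star a * (star c * c) * a) = τ (c * (a * star a) * star c) := by
    rw [show star a * (star c * c) * a = (star a * star c) * (c * a) by simp [mul_assoc],
      τ.map_mul_comm]
    simp [mul_assoc]
  have h : c * (a * star a) * star c ≤ ‖a * star a‖ • (c * star c) :=
    CStarAlgebra.star_right_conjugate_le_norm_smul
  have h' := τ.re_mono h
  rw [e1, τ.map_mul_comm (star c) c]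
  rw [CStarRing.norm_self_mul_star, ← Complex.coe_smul, map_smul, Complex.re_ofReal_mul] at h'
  rwa [pow_two]

end order

end FTrace

section L2

variable {A : Type u} [CStarAlgebra A] [PartialOrder A] [StarOrderedRing A]

/-- `V` with the scalar product `⟨v, w⟩₂ = τ ⟨v, w⟩`. -/
def PreL2 (_τ : FTrace A) (V : HilbMod A) : Type u := V.carrier

namespace PreL2

variable (τ : FTrace A) (V : HilbMod A)

instance : AddCommGroup (PreL2 τ V) := inferInstanceAs (AddCommGroup V.carrier)
instance : Module ℂ (PreL2 τ V) := inferInstanceAs (Module ℂ V.carrier)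

/-- The identity map. -/
def toMod : PreL2 τ V ≃ₗ[ℂ] V := LinearEquiv.refl ℂ V.carrier

/-- The scalar product `τ ⟨v, w⟩`. -/
@[reducible]
def core : InnerProductSpace.Core ℂ (PreL2 τ V) where
  inner v w := τ (V.inn (toMod τ V v) (toMod τ V w))
  conj_inner_symm v w := by
    change star (τ (V.inn (toMod τ V w) (toMod τ V v))) = _
    rw [← τ.map_star, V.star_inn]
  re_inner_nonneg v := (Complex.nonneg_iff.1 (τ.nonneg (V.inn_self_nonneg _))).1
  add_left u v w := by
    rw [map_add (toMod τ V), V.inn_add_left, τ.map_add]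
  smul_left v w z := by
    rw [map_smul (toMod τ V), V.inn_csmul_left, τ.map_smul]
    rfl
  definite v h := (V.inn_self_eq_zero _).1 (τ.eq_zero (V.inn_self_nonneg _) h)

instance : NormedAddCommGroup (PreL2 τ V) := (core τ V).toNormedAddCommGroup
instance : InnerProductSpace ℂ (PreL2 τ V) := InnerProductSpace.ofCore (core τ V).toCore

theorem inner_def (v w : PreL2 τ V) :
    inner ℂ v w = τ (V.inn (toMod τ V v) (toMod τ V w)) := rfl

theorem norm_sq (v : PreL2 τ V) : ‖v‖ ^ 2 = (τ (V.inn (toMod τ V v) (toMod τ V v))).re := by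
  rw [← inner_self_eq_norm_sq (𝕜 := ℂ) v]
  rfl

/-- Right multiplication by `a`. -/
def act (a : A) : PreL2 τ V →L[ℂ] PreL2 τ V :=
  LinearMap.mkContinuous
    { toFun := fun v => (toMod τ V).symm (MulOpposite.op a • toMod τ V v)
      map_add' := fun v w => by simp
      map_smul' := fun z v => by simp [smul_comm (MulOpposite.op a) z] }
    ‖a‖ (fun v => by
      refine (sq_le_sq₀ (norm_nonneg _) (by positivity)).1 ?_
      rw [mul_pow, norm_sq, norm_sq]
      change (τ (V.inn (MulOpposite.op a • toMod τ V v) (MulOpposite.op a • toMod τ V v))).re ≤ _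
      rw [V.inn_smul_left, V.inn_smul_right, ← mul_assoc]
      exact τ.conj_le (V.inn_self_nonneg _) a)

theorem toMod_act (a : A) (v : PreL2 τ V) :
    toMod τ V (act τ V a v) = MulOpposite.op a • toMod τ V v := rfl

end PreL2

/-- If `q k = ⟨v, S^(2^k) v⟩₂` satisfies the Cauchy–Schwarz inequality and grows at most
geometrically, then its first term is controlled. -/
theorem le_of_pow_growth {q : ℕ → ℝ} {c K : ℝ} (hc : 0 ≤ c) {q0 : ℝ}
    (hq0 : 0 ≤ q0) (hstep : ∀ k, q k ^ 2 ≤ q0 * q (k + 1)) (hK : ∀ k, q k ≤ c ^ (2 ^ k) * K) :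
    q 0 ≤ c * q0 := by
  by_contra! hlt
  have hpos : 0 < q 0 := lt_of_le_of_lt (mul_nonneg hc hq0) hlt
  have hq0pos : 0 < q0 := by
    rcases hq0.eq_or_lt with h | h
    · have := hstep 0
      rw [← h, zero_mul] at this
      nlinarith
    · exact h
  have hKnn : 0 < K := by
    have := hK 0
    rw [pow_zero, pow_one] at this
    by_contra! hn
    nlinarith
  have hind : ∀ k, q 0 ^ (2 ^ k) * q0 ≤ q0 ^ (2 ^ k) * q k := by
    intro k
    induction k with
    | zero => simp [mul_comm]
    | succ k ih =>
      have h1 : (q 0 ^ (2 ^ k) * q0) ^ 2 ≤ (q0 ^ (2 ^ k) * q k) ^ 2 :=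
        pow_le_pow_left₀ (by positivity) ih 2
      have h2 : (q0 ^ (2 ^ k) * q k) ^ 2 ≤ (q0 ^ (2 ^ k)) ^ 2 * (q0 * q (k + 1)) := by
        rw [mul_pow]
        exact mul_le_mul_of_nonneg_left (hstep k) (by positivity)
      have h3 := h1.trans h2
      rw [pow_succ, pow_mul, pow_mul]
      have h4 : ((q 0 ^ 2 ^ k) ^ 2 * q0) * q0 ≤ ((q0 ^ 2 ^ k) ^ 2 * q (k + 1)) * q0 := by
        nlinarith
      exact le_of_mul_le_mul_right h4 hq0pos
  rcases hc.eq_or_lt with hc0 | hc0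
  · have := hK 0
    rw [← hc0] at this
    simp at this
    linarith
  have hr : 1 < q 0 / (c * q0) := by
    rw [one_lt_div (by positivity)]
    exact hlt
  obtain ⟨n, hn⟩ := pow_unbounded_of_one_lt (K / q0) hr
  have hn' : K / q0 < (q 0 / (c * q0)) ^ (2 ^ n) :=
    hn.trans_le (pow_le_pow_right₀ hr.le Nat.lt_two_pow_self.le)
  have h5 := (hind n).trans (mul_le_mul_of_nonneg_left (hK n) (by positivity))
  rw [div_pow, mul_pow, div_lt_div_iff₀ hq0pos (by positivity)] at hn'
  nlinarith

theorem norm_inn_le {V : HilbMod A} (v w : V) : ‖V.inn v w‖ ≤ ‖v‖ * ‖w‖ := by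
  rcases eq_or_ne v 0 with rfl | hv
  · simp [V.inn_zero_left]
  have ht : 0 < ‖v‖ ^ 2 := by positivity
  set t : ℝ := ‖v‖ ^ 2 with htdef
  set b := V.inn v w with hb
  have hbs : V.inn w v = star b := (V.star_inn v w).symm
  have h0 := V.inn_self_nonneg (MulOpposite.op b • v - (t : ℂ) • w)
  have e : V.inn (MulOpposite.op b • v - (t : ℂ) • w) (MulOpposite.op b • v - (t : ℂ) • w)
      = star b * V.inn v v * b - t • (star b * b) - t • (star b * b) + t • t • V.inn w w := by
    have hl : ∀ x y z : V, V.inn (x - y) z = V.inn x z - V.inn y z := fun x y z => by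
      rw [eq_sub_iff_add_eq, ← V.inn_add_left, sub_add_cancel]
    rw [hl, V.inn_sub_right, V.inn_sub_right, V.inn_smul_left, V.inn_smul_left, V.inn_smul_right,
      V.inn_csmul_left, V.inn_csmul_right, V.inn_csmul_left, V.inn_csmul_right, V.inn_smul_right,
      ← hb, hbs]
    simp only [Complex.star_def, Complex.conj_ofReal, Complex.coe_smul, mul_smul_comm, mul_assoc]
    abel
  have h1 : star b * V.inn v v * b ≤ t • (star b * b) := by
    have := CStarAlgebra.star_left_conjugate_le_norm_smul (a := b) (b := V.inn v v)
      (IsSelfAdjoint.of_nonneg (V.inn_self_nonneg v))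
    rwa [← V.norm_sq] at this
  have h2 : t • (star b * b) ≤ t • t • V.inn w w := by
    rw [e] at h0
    have h3 : star b * V.inn v v * b - t • (star b * b) - t • (star b * b) + t • t • V.inn w w
        ≤ t • t • V.inn w w - t • (star b * b) := by
      have := sub_nonpos.2 h1
      calc _ = (star b * V.inn v v * b - t • (star b * b)) +
            (t • t • V.inn w w - t • (star b * b)) := by abel
        _ ≤ 0 + (t • t • V.inn w w - t • (star b * b)) := by gcongr
        _ = _ := zero_add _
    exact sub_nonneg.1 (h0.trans h3)
  have h4 : ‖t • (star b * b)‖ ≤ ‖t • t • V.inn w w‖ :=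
    CStarAlgebra.norm_le_norm_of_nonneg_of_le (smul_nonneg ht.le (star_mul_self_nonneg b)) h2
  rw [norm_smul, norm_smul, norm_smul, Real.norm_of_nonneg ht.le, CStarRing.norm_star_mul_self,
    ← V.norm_sq] at h4
  have h5 := le_of_mul_le_mul_left h4 ht
  refine (sq_le_sq₀ (norm_nonneg _) (by positivity)).1 ?_
  rw [mul_pow, pow_two ‖b‖]
  exact h5

section map

variable (τ : FTrace A)

theorem tau_adj_bound {V W : HilbMod A} (f : V ⟶ W) (v : V) :
    (τ (W.inn (HilbMod.Hom.op f v) (HilbMod.Hom.op f v))).re ≤ ‖f‖ ^ 2 * (τ (V.inn v v)).re := by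
  obtain ⟨g, hg⟩ := f.2.2
  have hg' : ∀ v w, W.inn w (HilbMod.Hom.op f v) = V.inn (g w) v := fun v w => by
    rw [← W.star_inn, ← V.star_inn]
    exact congrArg star (hg v w)
  let T : V → V := fun v => g (HilbMod.Hom.op f v)
  have hTs : ∀ v w, V.inn (T v) w = V.inn v (T w) := fun v w => by
    rw [← hg' w (HilbMod.Hom.op f v)]
    exact hg v _
  have hTn : ∀ v, ‖T v‖ ≤ ‖f‖ ^ 2 * ‖v‖ := fun v => by
    have h1 : ‖T v‖ ^ 2 ≤ ‖f‖ * ‖T v‖ * (‖f‖ * ‖v‖) := by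
      rw [V.norm_sq, ← hg' (T v) (HilbMod.Hom.op f v)]
      refine (norm_inn_le _ _).trans ?_
      rw [mul_comm]
      exact mul_le_mul ((HilbMod.Hom.op f).le_opNorm _) ((HilbMod.Hom.op f).le_opNorm _)
        (norm_nonneg _) (mul_nonneg (norm_nonneg f) (norm_nonneg _))
    rcases (norm_nonneg (T v)).eq_or_lt with h | h
    · rw [← h]
      positivity
    · nlinarith
  have hiter : ∀ n v w, V.inn (T^[n] v) w = V.inn v (T^[n] w) := by
    intro n
    induction n with
    | zero => intro v w; rfl
    | succ n ih =>
      intro v w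
      rw [Function.iterate_succ_apply, ih, hTs, ← Function.iterate_succ_apply' T n w]
  have hnorm : ∀ n v, ‖T^[n] v‖ ≤ (‖f‖ ^ 2) ^ n * ‖v‖ := by
    intro n
    induction n with
    | zero => intro v; simp
    | succ n ih =>
      intro v
      rw [Function.iterate_succ_apply', pow_succ]
      refine (hTn _).trans ?_
      have := mul_le_mul_of_nonneg_left (ih v) (sq_nonneg ‖f‖)
      nlinarith
  let q : ℕ → ℝ := fun k => (τ (V.inn v (T^[2 ^ k] v))).re
  have key : q 0 ≤ ‖f‖ ^ 2 * (τ (V.inn v v)).re := by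
    refine le_of_pow_growth (K := ‖v‖ ^ 2) (sq_nonneg _)
      (Complex.nonneg_iff.1 (τ.nonneg (V.inn_self_nonneg v))).1 (fun k => ?_) (fun k => ?_)
    · let v' : PreL2 τ V := (PreL2.toMod τ V).symm v
      let w' : PreL2 τ V := (PreL2.toMod τ V).symm (T^[2 ^ k] v)
      have h1 : q k ≤ ‖v'‖ * ‖w'‖ := re_inner_le_norm (𝕜 := ℂ) v' w'
      have h1' : -q k ≤ ‖v'‖ * ‖w'‖ := by
        have := re_inner_le_norm (𝕜 := ℂ) (-v') w'
        rwa [inner_neg_left, norm_neg, map_neg] at this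
      have h2 : q k ^ 2 ≤ ‖v'‖ ^ 2 * ‖w'‖ ^ 2 := by
        rw [← mul_pow]
        exact sq_le_sq' (by linarith) h1
      have h3 : q (k + 1) = ‖w'‖ ^ 2 := by
        rw [PreL2.norm_sq]
        change _ = (τ (V.inn (T^[2 ^ k] v) (T^[2 ^ k] v))).re
        rw [hiter, ← Function.iterate_add_apply, ← two_mul, ← pow_succ']
      rw [h3]
      rwa [PreL2.norm_sq τ V v'] at h2
    · have h1 : q k ≤ ‖V.inn v (T^[2 ^ k] v)‖ := by
        rcases k with _ | k
        · change (τ (V.inn v (T^[1] v))).re ≤ ‖V.inn v (T^[1] v)‖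
          refine τ.re_le_norm ?_
          change 0 ≤ V.inn v (g (HilbMod.Hom.op f v))
          have := W.inn_self_nonneg (HilbMod.Hom.op f v)
          rwa [show W.inn (HilbMod.Hom.op f v) (HilbMod.Hom.op f v) = _ from hg v _] at this
        · refine τ.re_le_norm ?_
          rw [pow_succ', two_mul, Function.iterate_add_apply, ← hiter]
          exact V.inn_self_nonneg _
      refine h1.trans ((norm_inn_le _ _).trans ?_)
      have := mul_le_mul_of_nonneg_left (hnorm (2 ^ k) v) (norm_nonneg v)
      nlinarith
  have e : q 0 = (τ (W.inn (HilbMod.Hom.op f v) (HilbMod.Hom.op f v))).re :=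
    congrArg (fun a => (τ a).re) (hg v _).symm
  rwa [e] at key

/-- A morphism of Hilbert `A`-modules as a bounded operator for the norms `‖·‖₂`. -/
def preMap {V W : HilbMod A} (f : V ⟶ W) : PreL2 τ V →L[ℂ] PreL2 τ W :=
  LinearMap.mkContinuous
    ((PreL2.toMod τ W).symm.toLinearMap ∘ₗ (HilbMod.Hom.op f).toLinearMap ∘ₗ
      (PreL2.toMod τ V).toLinearMap) ‖f‖ (fun v => by
      refine (sq_le_sq₀ (norm_nonneg _) (by positivity)).1 ?_
      rw [mul_pow, PreL2.norm_sq, PreL2.norm_sq]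
      exact tau_adj_bound τ f _)

theorem norm_preMap_le {V W : HilbMod A} (f : V ⟶ W) : ‖preMap τ f‖ ≤ ‖f‖ :=
  LinearMap.mkContinuous_norm_le _ (norm_nonneg _) _

theorem norm_completion_le {E F : Type u} [NormedAddCommGroup E] [NormedSpace ℂ E]
    [NormedAddCommGroup F] [NormedSpace ℂ F] (T : E →L[ℂ] F) : ‖T.completion‖ ≤ ‖T‖ := by
  refine ContinuousLinearMap.opNorm_le_bound _ (norm_nonneg _) fun x => ?_
  induction x using UniformSpace.Completion.induction_on with
  | hp => exact isClosed_le (by fun_prop) (by fun_prop)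
  | ih x => simpa using T.le_opNorm x

theorem completion_ext {E F : Type u} [NormedAddCommGroup E] [NormedSpace ℂ E]
    [NormedAddCommGroup F] [NormedSpace ℂ F] {S T : UniformSpace.Completion E →L[ℂ] F}
    (h : ∀ x : E, S x = T x) : S = T := by
  ext x
  induction x using UniformSpace.Completion.induction_on with
  | hp => exact isClosed_eq (by fun_prop) (by fun_prop)
  | ih x => exact h x

/-- The action of `A` on `l²(V)` by right multiplication. -/
def l2Act (V : HilbMod A) : Aᵐᵒᵖ →⋆ₐ[ℂ] (UniformSpace.Completion (PreL2 τ V) →L[ℂ]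
    UniformSpace.Completion (PreL2 τ V)) where
  toFun a := (PreL2.act τ V a.unop).completion
  map_one' := completion_ext fun v => by
    rw [ContinuousLinearMap.completion_apply_coe]
    exact congrArg _ (one_smul Aᵐᵒᵖ (PreL2.toMod τ V v))
  map_mul' a b := completion_ext fun v => by
    rw [ContinuousLinearMap.completion_apply_coe, mul_apply_eq_comp,
      ContinuousLinearMap.completion_apply_coe, ContinuousLinearMap.completion_apply_coe]
    exact congrArg _ (mul_smul a b (PreL2.toMod τ V v))
  map_zero' := completion_ext fun v => by
    rw [ContinuousLinearMap.completion_apply_coe]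
    exact congrArg _ (zero_smul Aᵐᵒᵖ (PreL2.toMod τ V v))
  map_add' a b := completion_ext fun v => by
    rw [ContinuousLinearMap.completion_apply_coe, add_apply,
      ContinuousLinearMap.completion_apply_coe, ContinuousLinearMap.completion_apply_coe,
      ← UniformSpace.Completion.coe_add]
    exact congrArg _ (add_smul a b (PreL2.toMod τ V v))
  commutes' z := completion_ext fun v => by
    rw [ContinuousLinearMap.completion_apply_coe, Algebra.algebraMap_eq_smul_one,
      Algebra.algebraMap_eq_smul_one, smul_apply, one_apply_eq_self,
      ← UniformSpace.Completion.coe_smul]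
    refine congrArg _ ?_
    exact (smul_assoc z (1 : Aᵐᵒᵖ) (PreL2.toMod τ V v)).trans
      (congrArg (z • ·) (one_smul Aᵐᵒᵖ (PreL2.toMod τ V v)))
  map_star' a := by
    rw [ContinuousLinearMap.star_eq_adjoint, ContinuousLinearMap.eq_adjoint_iff]
    intro x y
    induction x, y using UniformSpace.Completion.induction_on₂ with
    | hp => exact isClosed_eq (by fun_prop) (by fun_prop)
    | ih v w =>
      rw [ContinuousLinearMap.completion_apply_coe, ContinuousLinearMap.completion_apply_coe,
        UniformSpace.Completion.inner_coe, UniformSpace.Completion.inner_coe, PreL2.inner_def,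
        PreL2.inner_def, PreL2.toMod_act, PreL2.toMod_act, V.inn_smul_left, V.inn_smul_right,
        τ.map_mul_comm, MulOpposite.unop_star, star_star]

/-- The `A`-Hilbert space `l²(V)`: the completion of `V` for the scalar product `τ ⟨v, w⟩`. -/
def l2Obj (V : HilbMod A) : HilbSp A where
  carrier := UniformSpace.Completion (PreL2 τ V)
  act := l2Act τ V

/-- The canonical map `V → l²(V)`. -/
def toL2 (V : HilbMod A) : V →ₗ[ℂ] l2Obj τ V :=
  (UniformSpace.Completion.toComplL (𝕜 := ℂ) (E := PreL2 τ V)).toLinearMap ∘ₗ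
    (PreL2.toMod τ V).symm.toLinearMap

/-- The extension `l²(V) → l²(W)` of an adjointable map `V → W`. -/
def l2Map {V W : HilbMod A} (f : V ⟶ W) : l2Obj τ V ⟶ l2Obj τ W :=
  ⟨(preMap τ f).completion, fun a x => by
    change (preMap τ f).completion ((PreL2.act τ V a.unop).completion x) =
      (PreL2.act τ W a.unop).completion ((preMap τ f).completion x)
    induction x using UniformSpace.Completion.induction_on with
    | hp => exact isClosed_eq (by fun_prop) (by fun_prop)
    | ih v =>
      simp only [ContinuousLinearMap.completion_apply_coe]
      exact congrArg _ (f.2.1 a.unop (PreL2.toMod τ V v))⟩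

theorem l2Map_toL2 {V W : HilbMod A} (f : V ⟶ W) (v : V) :
    HilbSp.Hom.op (l2Map τ f) (toL2 τ V v) = toL2 τ W (HilbMod.Hom.op f v) :=
  ContinuousLinearMap.completion_apply_coe _ _

theorem l2_hom_ext {V : HilbMod A} {Y : HilbSp A} {f g : l2Obj τ V ⟶ Y}
    (h : ∀ v, HilbSp.Hom.op f (toL2 τ V v) = HilbSp.Hom.op g (toL2 τ V v)) : f = g :=
  HilbSp.hom_ext (completion_ext h)

/-- The functor `l²` from Hilbert `A`-modules to Hilbert spaces with a right action of `A`. -/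
def l2 : HilbMod A ⥤ HilbSp A where
  obj V := l2Obj τ V
  map f := l2Map τ f
  map_id V := l2_hom_ext τ fun v => by
    rw [l2Map_toL2]
    rfl
  map_comp f g := l2_hom_ext τ fun v => by
    rw [l2Map_toL2, HilbSp.op_comp, l2Map_toL2, l2Map_toL2]
    rfl

/-- `f ↦ l²(f)` as a bounded linear map. -/
def l2MapL (V W : HilbMod A) : (V ⟶ W) →L[ℂ] (l2Obj τ V ⟶ l2Obj τ W) :=
  LinearMap.mkContinuous
    { toFun := fun f => l2Map τ f
      map_add' := fun f g => l2_hom_ext τ fun v => by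
        rw [l2Map_toL2]
        change _ = HilbSp.Hom.op (l2Map τ f) (toL2 τ V v) + HilbSp.Hom.op (l2Map τ g) (toL2 τ V v)
        rw [l2Map_toL2, l2Map_toL2, ← map_add (toL2 τ W)]
        rfl
      map_smul' := fun z f => l2_hom_ext τ fun v => by
        rw [l2Map_toL2]
        change _ = z • HilbSp.Hom.op (l2Map τ f) (toL2 τ V v)
        rw [l2Map_toL2, ← map_smul (toL2 τ W)]
        rfl } 1 (fun f => by
      rw [one_mul]
      exact (norm_completion_le _).trans (norm_preMap_le τ f))

theorem norm_toL2_sq (V : HilbMod A) (v : V) : ‖toL2 τ V v‖ ^ 2 = (τ (V.inn v v)).re := by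
  refine Eq.trans ?_ (PreL2.norm_sq τ V ((PreL2.toMod τ V).symm v))
  exact congrArg (· ^ 2) (UniformSpace.Completion.norm_coe _)

theorem norm_l2Map_of_isometric {V W : HilbMod A} (f : V ⟶ W)
    (hf : ∀ v w, W.inn (HilbMod.Hom.op f v) (HilbMod.Hom.op f w) = V.inn v w) (x : l2Obj τ V) :
    ‖HilbSp.Hom.op (l2Map τ f) x‖ = ‖x‖ := by
  change ‖(preMap τ f).completion x‖ = ‖x‖
  change UniformSpace.Completion (PreL2 τ V) at x
  induction x using UniformSpace.Completion.induction_on with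
  | hp => exact isClosed_eq (by fun_prop) (by fun_prop)
  | ih v =>
    refine (sq_eq_sq₀ (norm_nonneg _) (norm_nonneg _)).1 ?_
    rw [ContinuousLinearMap.completion_apply_coe]
    refine Eq.trans (norm_toL2_sq τ W (HilbMod.Hom.op f (PreL2.toMod τ V v))) ?_
    rw [hf]
    exact (norm_toL2_sq τ V (PreL2.toMod τ V v)).symm

end map

end L2

/-! ### Hilbert sums -/

/-- The Hilbert space `ℓ²(I; K)`, that is, `H ⊗ K` for the Hilbert space `H = ℓ²(I)`. -/
def Ell2 (I : Type*) (K : Type*) [NormedAddCommGroup K] [InnerProductSpace ℂ K] : Type _ :=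
  lp (fun _ : I => K) 2

namespace Ell2

variable {I : Type*} {K : Type*} [NormedAddCommGroup K] [InnerProductSpace ℂ K]

instance : NormedAddCommGroup (Ell2 I K) := inferInstanceAs (NormedAddCommGroup (lp _ 2))
instance : InnerProductSpace ℂ (Ell2 I K) :=
  inferInstanceAs (InnerProductSpace ℂ (lp (fun _ : I => K) 2))
instance [CompleteSpace K] : CompleteSpace (Ell2 I K) :=
  inferInstanceAs (CompleteSpace (lp (fun _ : I => K) 2))

/-- The `i`-th component. -/
def comp (i : I) : Ell2 I K →L[ℂ] K := lp.evalCLM ℂ (fun _ : I => K) 2 i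

theorem inner_eq_tsum (x y : Ell2 I K) : inner ℂ x y = ∑' i, inner ℂ (comp i x) (comp i y) :=
  lp.inner_eq_tsum x y

end Ell2

/-! ### The Hilbert `A`-module `H ⊗ A` over a von Neumann algebra -/

section vN

variable {A : Type u} [CStarAlgebra A] {𝓗 : Type u} [NormedAddCommGroup 𝓗]
  [InnerProductSpace ℂ 𝓗] [CompleteSpace 𝓗] (N : VonNeumannAlgebra 𝓗)
  (e : A ≃⋆ₐ[ℂ] N.toStarSubalgebra)

/-- The representation of `A` on `𝓗`. -/
def rep (a : A) : 𝓗 →L[ℂ] 𝓗 := ((e a : N.toStarSubalgebra) : 𝓗 →L[ℂ] 𝓗)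

/-- Ultraweak continuity: `τ(a) = ∑ ⟨xₙ, a yₙ⟩` with `∑ ‖xₙ‖² < ∞` and `∑ ‖yₙ‖² < ∞`. -/
def FTrace.IsNormal (τ : FTrace A) : Prop :=
  ∃ x y : ℕ → 𝓗, Summable (fun n => ‖x n‖ ^ 2) ∧ Summable (fun n => ‖y n‖ ^ 2) ∧
    ∀ a, HasSum (fun n => inner ℂ (x n) (rep N e a (y n))) (τ a)

theorem rep_injective : Function.Injective (rep N e) :=
  Subtype.val_injective.comp e.injective

theorem rep_mul (a b : A) : rep N e (a * b) = rep N e a * rep N e b := by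
  simp [rep]

/-- `rep` as a morphism. -/
def repHom : A →⋆ₐ[ℂ] (𝓗 →L[ℂ] 𝓗) := N.toStarSubalgebra.subtype.comp (e : A →⋆ₐ[ℂ] _)

theorem repHom_apply (a : A) : repHom N e a = rep N e a := rfl

theorem rep_star (a : A) : rep N e (star a) = star (rep N e a) := map_star (repHom N e) a
theorem rep_add (a b : A) : rep N e (a + b) = rep N e a + rep N e b := map_add (repHom N e) a b
theorem rep_smul (z : ℂ) (a : A) : rep N e (z • a) = z • rep N e a := map_smul (repHom N e) z a

theorem norm_rep (a : A) : ‖rep N e a‖ = ‖a‖ :=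
  NonUnitalStarAlgHom.norm_map (repHom N e) (rep_injective N e) a

theorem range_rep : Set.range (rep N e) = N := by
  ext T
  constructor
  · rintro ⟨a, rfl⟩
    exact (e a).2
  · intro hT
    obtain ⟨a, ha⟩ := e.surjective ⟨T, hT⟩
    exact ⟨a, congrArg Subtype.val ha⟩

theorem mem_range_rep {T : 𝓗 →L[ℂ] 𝓗} (h : ∀ c ∈ Set.centralizer (N : Set (𝓗 →L[ℂ] 𝓗)),
    c * T = T * c) : T ∈ Set.range (rep N e) := by
  rw [range_rep, ← N.centralizer_centralizer]
  exact fun c hc => h c hc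

theorem star_mem_centralizer {c : 𝓗 →L[ℂ] 𝓗}
    (hc : c ∈ Set.centralizer (N : Set (𝓗 →L[ℂ] 𝓗))) :
    star c ∈ Set.centralizer (N : Set (𝓗 →L[ℂ] 𝓗)) := by
  intro T hT
  have h := hc (star T) (star_mem (s := N) hT)
  have := congrArg star h
  simpa using this.symm

variable (I : Type u)

/-- The bounded operators `T : 𝓗 → ⊕_{i ∈ I} 𝓗` all of whose components belong to `A`, that is,
the families `(aᵢ)` in `A` such that the sums `∑_{i ∈ F} aᵢ* aᵢ`, `F ⊆ I` finite, are bounded. -/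
def columns : Submodule ℂ (𝓗 →L[ℂ] Ell2 I 𝓗) where
  carrier := {T | ∀ i, ∃ a, ∀ x, Ell2.comp i (T x) = rep N e a x}
  add_mem' {S T} hS hT i := by
    obtain ⟨a, ha⟩ := hS i
    obtain ⟨b, hb⟩ := hT i
    exact ⟨a + b, fun x => by
      rw [add_apply, map_add, ha, hb, rep_add, add_apply]⟩
  zero_mem' i := ⟨0, fun x => by rw [← repHom_apply, map_zero, zero_apply, map_zero, zero_apply]⟩
  smul_mem' z T hT i := by
    obtain ⟨a, ha⟩ := hT i
    exact ⟨z • a, fun x => by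
      rw [smul_apply, _root_.map_smul, ha, rep_smul, smul_apply]⟩

variable {I}

/-- The `i`-th component of a column. -/
def coord (T : columns N e I) (i : I) : A := (T.2 i).choose

theorem coord_spec (T : columns N e I) (i : I) (x : 𝓗) :
    Ell2.comp i (T.1 x) = rep N e (coord N e T i) x := (T.2 i).choose_spec x

theorem columns_comm (T : columns N e I) {c : 𝓗 →L[ℂ] 𝓗}
    (hc : c ∈ Set.centralizer (N : Set (𝓗 →L[ℂ] 𝓗))) (x : 𝓗) (i : I) :
    Ell2.comp i (T.1 (c x)) = c (Ell2.comp i (T.1 x)) := by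
  rw [coord_spec, coord_spec]
  have h : rep N e (coord N e T i) * c = c * rep N e (coord N e T i) :=
    hc _ (e (coord N e T i)).2
  exact congrArg (fun S : 𝓗 →L[ℂ] 𝓗 => S x) h

theorem adjoint_comp_mem (S T : columns N e I) :
    ContinuousLinearMap.adjoint S.1 ∘L T.1 ∈ Set.range (rep N e) := by
  refine mem_range_rep N e fun c hc => ?_
  ext x
  refine ext_inner_left ℂ fun y => ?_
  change inner ℂ y (c (ContinuousLinearMap.adjoint S.1 (T.1 x))) =
    inner ℂ y (ContinuousLinearMap.adjoint S.1 (T.1 (c x)))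
  rw [ContinuousLinearMap.adjoint_inner_right, ← ContinuousLinearMap.adjoint_inner_left,
    ContinuousLinearMap.adjoint_inner_right, Ell2.inner_eq_tsum, Ell2.inner_eq_tsum]
  refine tsum_congr fun i => ?_
  rw [columns_comm N e T hc, ← ContinuousLinearMap.star_eq_adjoint,
    columns_comm N e S (star_mem_centralizer N hc), ContinuousLinearMap.star_eq_adjoint,
    ContinuousLinearMap.adjoint_inner_left]

/-- The `A`-valued inner product `⟨S, T⟩ = S* T` (the ultraweakly convergent sum `∑ aᵢ* bᵢ`). -/
def columnInn (S T : columns N e I) : A := (adjoint_comp_mem N e S T).choose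

theorem rep_columnInn (S T : columns N e I) :
    rep N e (columnInn N e S T) = ContinuousLinearMap.adjoint S.1 ∘L T.1 :=
  (adjoint_comp_mem N e S T).choose_spec

instance : SMul Aᵐᵒᵖ (columns N e I) where
  smul a T := ⟨T.1 ∘L rep N e a.unop, fun i => ⟨coord N e T i * a.unop, fun x => by
    rw [ContinuousLinearMap.comp_apply, coord_spec, rep_mul]; rfl⟩⟩

theorem columns_smul (a : Aᵐᵒᵖ) (T : columns N e I) : (a • T).1 = T.1 ∘L rep N e a.unop := rfl

instance : Module Aᵐᵒᵖ (columns N e I) where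
  one_smul T := Subtype.ext <| by
    rw [columns_smul, ← repHom_apply, MulOpposite.unop_one, map_one]; rfl
  mul_smul a b T := Subtype.ext <| by
    rw [columns_smul, MulOpposite.unop_mul, rep_mul]; rfl
  smul_zero a := Subtype.ext <| by rw [columns_smul]; exact ContinuousLinearMap.zero_comp _
  smul_add a S T := Subtype.ext <| ContinuousLinearMap.add_comp _ _ _
  add_smul a b T := Subtype.ext <| by
    rw [columns_smul, MulOpposite.unop_add, ← repHom_apply, map_add]
    exact ContinuousLinearMap.comp_add _ _ _
  zero_smul T := Subtype.ext <| by
    rw [columns_smul, ← repHom_apply, MulOpposite.unop_zero, map_zero]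
    exact ContinuousLinearMap.comp_zero _

instance : IsScalarTower ℂ Aᵐᵒᵖ (columns N e I) where
  smul_assoc z a T := Subtype.ext <| by
    rw [columns_smul, MulOpposite.unop_smul, ← repHom_apply, map_smul]
    exact ContinuousLinearMap.comp_smul _ _ _

theorem isClosed_columns : IsClosed (columns N e I : Set (𝓗 →L[ℂ] Ell2 I 𝓗)) := by
  have : (columns N e I : Set (𝓗 →L[ℂ] Ell2 I 𝓗)) =
      ⋂ i, (fun T => (Ell2.comp i) ∘L T) ⁻¹' (N : Set (𝓗 →L[ℂ] 𝓗)) := by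
    ext T
    simp only [Set.mem_iInter, Set.mem_preimage, ← range_rep N e]
    refine forall_congr' fun i => exists_congr fun a => ?_
    rw [eq_comm, ContinuousLinearMap.ext_iff]
    rfl
  rw [this]
  refine isClosed_iInter fun i => IsClosed.preimage (by fun_prop) ?_
  rw [← N.centralizer_centralizer]
  exact Set.isClosed_centralizer _

instance : NormedSpace ℂ (columns N e I) := Submodule.normedSpace _

instance : CompleteSpace (columns N e I) := (isClosed_columns N e).completeSpace_coe

variable (I) in
/-- The Hilbert `A`-module `H ⊗ A` for `H = ℓ²(I)`, completed in the sense of von Neumann algebras: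
the columns `(aᵢ)_{i ∈ I}` with inner product `∑ aᵢ* bᵢ`. -/
def HilbMod.wFree [PartialOrder A] [StarOrderedRing A] : HilbMod A where
  carrier := columns N e I
  inn := columnInn N e
  inn_smul_right v w a := rep_injective N e <| by
    rw [rep_mul, rep_columnInn, rep_columnInn]; rfl
  inn_add_left v₁ v₂ w := rep_injective N e <| by
    rw [← repHom_apply, ← repHom_apply, map_add, repHom_apply, repHom_apply, repHom_apply,
      rep_columnInn, rep_columnInn, rep_columnInn]
    change ContinuousLinearMap.adjoint (v₁.1 + v₂.1) ∘L w.1 = _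
    rw [map_add, ContinuousLinearMap.add_comp]
  star_inn v w := rep_injective N e <| by
    rw [rep_star, rep_columnInn, rep_columnInn, ContinuousLinearMap.star_eq_adjoint,
      ContinuousLinearMap.adjoint_comp, ContinuousLinearMap.adjoint_adjoint]
  inn_self_nonneg v := by
    have hpos : (0 : 𝓗 →L[ℂ] 𝓗) ≤ repHom N e (columnInn N e v v) := by
      rw [repHom_apply, rep_columnInn, ContinuousLinearMap.nonneg_iff_isPositive]
      exact ContinuousLinearMap.isPositive_adjoint_comp_self _
    have hsa : IsSelfAdjoint (columnInn N e v v) := rep_injective N e <| by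
      rw [rep_star, rep_columnInn, ContinuousLinearMap.star_eq_adjoint,
        ContinuousLinearMap.adjoint_comp, ContinuousLinearMap.adjoint_adjoint]
    rw [StarOrderedRing.nonneg_iff_spectrum_nonneg (R := ℝ) _ hsa]
    rw [StarOrderedRing.nonneg_iff_spectrum_nonneg (R := ℝ) _ (hsa.map (repHom N e)),
      hsa.map_spectrum_real (repHom N e) (rep_injective N e)] at hpos
    exact hpos
  inn_self_eq_zero v := by
    rw [← (rep_injective N e).eq_iff, rep_columnInn, ← repHom_apply, map_zero,
      ← norm_eq_zero, ContinuousLinearMap.norm_adjoint_comp_self, mul_self_eq_zero, norm_eq_zero]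
    exact Submodule.coe_eq_zero
  norm_eq v := by
    rw [← norm_rep N e, rep_columnInn, ContinuousLinearMap.norm_adjoint_comp_self,
      Real.sqrt_mul_self (norm_nonneg _)]
    rfl

/-- Projective Hilbert `A`-modules: orthogonal direct summands of some `H ⊗ A`. -/
def HilbMod.IsProjective [PartialOrder A] [StarOrderedRing A] : ObjectProperty (HilbMod A) :=
  fun V => ∃ I : Type u, HilbMod.IsSummand V (HilbMod.wFree N e I)

end vN

/-! ### Finitely generated projective and general `A`-Hilbert spaces, and `A(X)` -/

section AHilbertSpaces

variable {A : Type u} [CStarAlgebra A] [PartialOrder A] [StarOrderedRing A] (τ : FTrace A)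

/-- The Hilbert space `l²(A)`. -/
abbrev L2A : HilbSp A := l2Obj τ (HilbMod.self A)

/-- Left multiplication by `a` on `l²(A)`. -/
def leftL2 (a : A) : L2A τ →L[ℂ] L2A τ := HilbSp.Hom.op (l2Map τ (HilbMod.leftMul a))

/-- An isometric embedding of `X` into `ℓ²(I) ⊗ l²(A)` which preserves the right `A`-action. -/
structure Emb (X : HilbSp A) (I : Type*) where
  emb : X →ₗᵢ[ℂ] Ell2 I (L2A τ)
  map_act : ∀ a x k, Ell2.comp k (emb (X.act a x)) = (L2A τ).act a (Ell2.comp k (emb x))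

namespace Emb

variable {τ} {X : HilbSp A} {I : Type*} (i : Emb τ X I)

/-- The adjoint of the embedding, that is, the orthogonal projection regarded as a map onto `X`. -/
def coproj : Ell2 I (L2A τ) →L[ℂ] X := ContinuousLinearMap.adjoint i.emb.toContinuousLinearMap

/-- The orthogonal projection onto the image of `X`. -/
def proj : Ell2 I (L2A τ) →L[ℂ] Ell2 I (L2A τ) := i.emb.toContinuousLinearMap ∘L i.coproj

end Emb

/-- The projection onto `X` is left multiplication by an element of `M_n(A)`. -/
def Emb.IsMatrix {X : HilbSp A} {n : ℕ} (i : Emb τ X (Fin n)) : Prop :=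
  ∃ p : Matrix (Fin n) (Fin n) A, ∀ ξ k,
    Ell2.comp k (i.proj ξ) = ∑ l, leftL2 τ (p k l) (Ell2.comp l ξ)

open Classical in
/-- The operators `e_{kl} ⊗ a` on `ℓ²(I) ⊗ l²(A)`, where `a ∈ A` acts by left multiplication. -/
def elementary (I : Type*) : Set (Ell2 I (L2A τ) →L[ℂ] Ell2 I (L2A τ)) :=
  {T | ∃ (k l : I) (a : A), ∀ ξ m,
    Ell2.comp m (T ξ) = if m = k then leftL2 τ a (Ell2.comp l ξ) else 0}

/-- The von Neumann algebra `B(H) ⊗ A` on `H ⊗ l²(A)`, for `H = ℓ²(I)`: the double commutant of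
the operators `e_{kl} ⊗ a`. -/
def tensorVN (I : Type*) : Set (Ell2 I (L2A τ) →L[ℂ] Ell2 I (L2A τ)) :=
  Set.centralizer (Set.centralizer (elementary τ I))

/-- Finitely generated projective `A`-Hilbert spaces. -/
def HilbSp.IsFGProjective : ObjectProperty (HilbSp A) :=
  fun X => ∃ (n : ℕ) (i : Emb τ X (Fin n)), i.IsMatrix

/-- (General) `A`-Hilbert spaces. -/
def HilbSp.IsAHilbert : ObjectProperty (HilbSp A) :=
  fun X => ∃ (I : Type u) (i : Emb τ X I), i.proj ∈ tensorVN τ I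

/-- Let `F = H ⊗ A`, with components `c`, and let `p` be the orthogonal projection of `H ⊗ l²(A)`
onto `X`. The map `j : V → X` identifies the Hilbert `A`-module `V` with `p F ⊆ X` (which is
`X ∩ F`), equipped with the `A`-valued inner product of `F`. -/
structure Emb.Realizes {X : HilbSp A} {I : Type*} (i : Emb τ X I) (F : HilbMod A)
    (c : F → I → A) (V : HilbMod A) (j : V → X) : Prop where
  injective : Function.Injective j
  mem_range : ∀ x, x ∈ Set.range j ↔
    ∃ m ξ, (∀ k, Ell2.comp k ξ = toL2 τ (HilbMod.self A) (c m k)) ∧ i.coproj ξ = x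
  mem_free : ∀ x, x ∈ Set.range j ↔
    ∃ m, ∀ k, Ell2.comp k (i.emb x) = toL2 τ (HilbMod.self A) (c m k)
  inn_eq : ∀ v w m m', (∀ k, Ell2.comp k (i.emb (j v)) = toL2 τ (HilbMod.self A) (c m k)) →
    (∀ k, Ell2.comp k (i.emb (j w)) = toL2 τ (HilbMod.self A) (c m' k)) → V.inn v w = F.inn m m'

/-- `j : V → X` identifies `V` with `A(X) = p (A^n)`, for every presentation of the finitely
generated projective `A`-Hilbert space `X` as the range of a projection `p ∈ M_n(A)`. -/
def IsFGAOf (X : HilbSp A) (V : HilbMod A) (j : V → X) : Prop :=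
  ∀ (n : ℕ) (i : Emb τ X (Fin n)), i.IsMatrix → i.Realizes τ (HilbMod.free A n) (fun a => a) V j

/-- `j : V → X` identifies `V` with `A(X) = p (H ⊗ A)`, for every presentation of the
`A`-Hilbert space `X` as the range of a projection `p ∈ B(H) ⊗ A`. -/
def IsAOf {𝓗 : Type u} [NormedAddCommGroup 𝓗] [InnerProductSpace ℂ 𝓗] [CompleteSpace 𝓗]
    (N : VonNeumannAlgebra 𝓗) (e : A ≃⋆ₐ[ℂ] N.toStarSubalgebra)
    (X : HilbSp A) (V : HilbMod A) (j : V → X) : Prop :=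
  ∀ (I : Type u) (i : Emb τ X I), i.proj ∈ tensorVN τ I →
    i.Realizes τ (HilbMod.wFree N e I) (coord N e) V j

end AHilbertSpaces

/-! ### Bundles -/

/-- A notion of regularity of maps from `M` to Banach spaces (continuous or smooth). -/
structure Regularity (M : Type w) [TopologicalSpace M] where
  At : ∀ {F : Type u} [NormedAddCommGroup F] [NormedSpace ℂ F], (M → F) → M → Prop
  congr : ∀ {F : Type u} [NormedAddCommGroup F] [NormedSpace ℂ F] {f g : M → F} {x : M},
    f =ᶠ[nhds x] g → At f x → At g x
  clm : ∀ {F G : Type u} [NormedAddCommGroup F] [NormedSpace ℂ F] [NormedAddCommGroup G]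
    [NormedSpace ℂ G] (L : F →L[ℂ] G) {f : M → F} {x : M}, At f x → At (fun y => L (f y)) x
  bilin : ∀ {F G K : Type u} [NormedAddCommGroup F] [NormedSpace ℂ F] [NormedAddCommGroup G]
    [NormedSpace ℂ G] [NormedAddCommGroup K] [NormedSpace ℂ K] (B : F →L[ℂ] G →L[ℂ] K)
    {f : M → F} {g : M → G} {x : M}, At f x → At g x → At (fun y => B (f y) (g y)) x

/-- Continuous maps. -/
def contReg (M : Type w) [TopologicalSpace M] : Regularity.{u} M where
  At f x := ContinuousAt f x
  congr h hf := hf.congr h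
  clm L _ _ hf := L.continuous.continuousAt.comp hf
  bilin B _ _ _ hf hg := by fun_prop

/-- Smooth maps on a `d`-dimensional manifold. -/
def smoothReg (d : ℕ) (M : Type w) [TopologicalSpace M]
    [ChartedSpace (EuclideanSpace ℝ (Fin d)) M] : Regularity.{u} M where
  At {F} _ _ f x := ContMDiffAt (𝓡 d) 𝓘(ℝ, F) ∞ f x
  congr h hf := hf.congr_of_eventuallyEq h.symm
  clm {F G} _ _ _ _ L f x hf := by
    have h : ContMDiff 𝓘(ℝ, F) 𝓘(ℝ, G) ∞ L :=
      (L.contDiff.restrict_scalars ℝ).contMDiff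
    exact h.contMDiffAt.comp x hf
  bilin {F G K} _ _ _ _ _ _ B f g x hf hg := by
    have h : ContDiff ℝ ∞ (fun p : F × G => B p.1 p.2) :=
      (B.isBoundedBilinearMap.contDiff).restrict_scalars ℝ
    have h' : ContMDiff 𝓘(ℝ, F × G) 𝓘(ℝ, K) ∞ (fun p : F × G => B p.1 p.2) := h.contMDiff
    exact h'.contMDiffAt.comp x (hf.prodMk_space hg)

/-- The structure common to Hilbert `A`-modules and `A`-Hilbert spaces, as possible fibers of
bundles: underlying Banach spaces with a right action of `A`, Banach spaces of morphisms, and the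
notion of an isometry. -/
class FiberCat (A : outParam (Type u)) [CStarAlgebra A] (C : Type (u + 1)) [Category.{u} C] where
  Sp : C → Type u
  [spNACG : ∀ X, NormedAddCommGroup (Sp X)]
  [spNS : ∀ X, NormedSpace ℂ (Sp X)]
  ract : ∀ {X : C}, Sp X → A → Sp X
  [homNACG : ∀ X Y : C, NormedAddCommGroup (X ⟶ Y)]
  [homNS : ∀ X Y : C, NormedSpace ℂ (X ⟶ Y)]
  ev : ∀ X Y : C, (X ⟶ Y) →L[ℂ] Sp X →L[ℂ] Sp Y
  compL : ∀ X Y Z : C, (X ⟶ Y) →L[ℂ] (Y ⟶ Z) →L[ℂ] (X ⟶ Z)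
  compL_apply : ∀ {X Y Z : C} (f : X ⟶ Y) (g : Y ⟶ Z), compL X Y Z f g = f ≫ g
  ev_id : ∀ {X : C} (v : Sp X), ev X X (𝟙 X) v = v
  ev_comp : ∀ {X Y Z : C} (f : X ⟶ Y) (g : Y ⟶ Z) (v : Sp X),
    ev X Z (f ≫ g) v = ev Y Z g (ev X Y f v)
  IsIsometric : ∀ {X Y : C}, (X ⟶ Y) → Prop

attribute [reducible, instance] FiberCat.spNACG FiberCat.spNS FiberCat.homNACG FiberCat.homNS

instance {A : Type u} [CStarAlgebra A] [PartialOrder A] : FiberCat A (HilbMod A) where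
  Sp V := V.carrier
  ract v a := MulOpposite.op a • v
  ev V W := (HilbMod.adjointable V W).subtypeL
  compL U V W := LinearMap.mkContinuous₂
    (LinearMap.mk₂ ℂ (fun (f : U ⟶ V) (g : V ⟶ W) => f ≫ g)
      (fun f₁ f₂ g => HilbMod.hom_ext fun v => map_add (HilbMod.Hom.op g) _ _)
      (fun z f g => HilbMod.hom_ext fun v => map_smul (HilbMod.Hom.op g) z _)
      (fun f g₁ g₂ => HilbMod.hom_ext fun v => rfl)
      (fun z f g => HilbMod.hom_ext fun v => rfl)) 1
    (fun f g => by
      rw [one_mul, mul_comm]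
      exact ContinuousLinearMap.opNorm_comp_le (HilbMod.Hom.op g) (HilbMod.Hom.op f))
  compL_apply f g := rfl
  ev_id v := rfl
  ev_comp f g v := rfl
  IsIsometric {V W} f := ∀ v w, W.inn (HilbMod.Hom.op f v) (HilbMod.Hom.op f w) = V.inn v w

instance {A : Type u} [CStarAlgebra A] : FiberCat A (HilbSp A) where
  Sp X := X.carrier
  ract {X} x a := X.act (MulOpposite.op a) x
  ev X Y := (HilbSp.intertwiners X Y).subtypeL
  compL X Y Z := LinearMap.mkContinuous₂
    (LinearMap.mk₂ ℂ (fun (f : X ⟶ Y) (g : Y ⟶ Z) => f ≫ g)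
      (fun f₁ f₂ g => HilbSp.hom_ext (ContinuousLinearMap.ext fun v =>
        map_add (HilbSp.Hom.op g) _ _))
      (fun z f g => HilbSp.hom_ext (ContinuousLinearMap.ext fun v =>
        map_smul (HilbSp.Hom.op g) z _))
      (fun f g₁ g₂ => rfl)
      (fun z f g => rfl)) 1
    (fun f g => by
      rw [one_mul, mul_comm]
      exact ContinuousLinearMap.opNorm_comp_le (HilbSp.Hom.op g) (HilbSp.Hom.op f))
  compL_apply f g := rfl
  ev_id v := rfl
  ev_comp f g v := rfl
  IsIsometric f := ∀ x, ‖HilbSp.Hom.op f x‖ = ‖x‖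

section Bundles

variable {A : Type u} [CStarAlgebra A] {C : Type (u + 1)} [Category.{u} C] [FiberCat A C]
  {M : Type w} [TopologicalSpace M]

/-- A locally trivial bundle over `M` with fibers in `C` satisfying `P`, given by its fibers and a
trivializing atlas of fiberwise isometric isomorphisms whose transition functions, with values in
the Banach spaces of morphisms, are regular. -/
structure HBundle (R : Regularity.{u} M) (P : ObjectProperty C) where
  fiber : M → C
  fiber_mem : ∀ x, P (fiber x)
  ι : Type w
  U : ι → Set M
  isOpen : ∀ i, IsOpen (U i)
  cover : ∀ x, ∃ i, x ∈ U i
  model : ι → C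
  model_mem : ∀ i, P (model i)
  triv : ∀ i x, x ∈ U i → (fiber x ≅ model i)
  isometric : ∀ i x h, FiberCat.IsIsometric (triv i x h).hom
  transition : ∀ i j x, x ∈ U i → x ∈ U j → R.At (open Classical in fun y =>
    if h : y ∈ U i ∧ y ∈ U j then (triv i y h.1).inv ≫ (triv j y h.2).hom else 0) x

namespace HBundle

variable {R : Regularity.{u} M} {P : ObjectProperty C}

open Classical in
/-- A family of morphisms between the fibers, in local trivializations. -/
def localRep (E E' : HBundle R P) (f : ∀ x, E.fiber x ⟶ E'.fiber x) (i : E.ι) (j : E'.ι) :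
    M → (E.model i ⟶ E'.model j) := fun y =>
  if h : y ∈ E.U i ∧ y ∈ E'.U j then (E.triv i y h.1).inv ≫ f y ≫ (E'.triv j y h.2).hom else 0

/-- Morphisms of bundles: families of morphisms between the fibers which are regular in local
trivializations. -/
@[ext]
structure Hom (E E' : HBundle R P) where
  app : ∀ x, E.fiber x ⟶ E'.fiber x
  regular : ∀ i j x, x ∈ E.U i → x ∈ E'.U j → R.At (localRep E E' app i j) x

instance : Category (HBundle R P) where
  Hom E E' := Hom E E'
  id E := ⟨fun x => 𝟙 _, fun i j x hi hj => by
    refine R.congr (Filter.Eventually.of_forall fun y => ?_) (E.transition i j x hi hj)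
    by_cases hy : y ∈ E.U i ∧ y ∈ E.U j
    · simp [localRep, hy]
    · simp [localRep, hy]⟩
  comp {E E' E''} f g := ⟨fun x => f.app x ≫ g.app x, fun i k x hi hk => by
    obtain ⟨j, hj⟩ := E'.cover x
    refine R.congr ?_ (R.bilin (FiberCat.compL _ _ _) (f.regular i j x hi hj)
      (g.regular j k x hj hk))
    filter_upwards [(E.isOpen i).mem_nhds hi, (E'.isOpen j).mem_nhds hj,
      (E''.isOpen k).mem_nhds hk] with y hyi hyj hyk
    simp [localRep, hyi, hyj, hyk, FiberCat.compL_apply]⟩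
  id_comp f := Hom.ext (funext fun x => Category.id_comp _)
  comp_id f := Hom.ext (funext fun x => Category.comp_id _)
  assoc f g h := Hom.ext (funext fun x => Category.assoc _ _ _)

/-- The morphism between the fibers over `x`. -/
def Hom.at {E E' : HBundle R P} (f : E ⟶ E') (x : M) : E.fiber x ⟶ E'.fiber x :=
  HBundle.Hom.app f x

open Classical in
/-- Regular sections. -/
def IsSection (E : HBundle R P) (s : ∀ x, FiberCat.Sp (E.fiber x)) : Prop :=
  ∀ i x, x ∈ E.U i → R.At (fun y =>
    if h : y ∈ E.U i then FiberCat.ev _ _ (E.triv i y h).hom (s y) else 0) x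

/-- The regular sections `Γ(E)`. -/
def Sec (E : HBundle R P) : Type (max u w) := {s : ∀ x, FiberCat.Sp (E.fiber x) // E.IsSection s}

/-- The image of a section under a morphism of bundles. -/
def Sec.map {E E' : HBundle R P} (f : E ⟶ E') (s : E.Sec) : E'.Sec :=
  ⟨fun x => FiberCat.ev _ _ (Hom.at f x) (s.1 x), fun j x hj => by
    obtain ⟨i, hi⟩ := E.cover x
    refine R.congr ?_ (R.bilin (FiberCat.ev _ _) (HBundle.Hom.regular f i j x hi hj)
      (s.2 i x hi))
    filter_upwards [(E.isOpen i).mem_nhds hi, (E'.isOpen j).mem_nhds hj] with y hyi hyj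
    have h : FiberCat.ev _ _ (E.triv i y hyi).inv
        (FiberCat.ev _ _ (E.triv i y hyi).hom (s.1 y)) = s.1 y := by
      rw [← FiberCat.ev_comp, Iso.hom_inv_id, FiberCat.ev_id]
    simp only [localRep, hyi, hyj, and_self, dite_true, FiberCat.ev_comp, h]
    rfl⟩

end HBundle

/-! ### Connections -/

section Connections

variable {d : ℕ} [ChartedSpace (EuclideanSpace ℝ (Fin d)) M] [IsManifold (𝓡 d) ∞ M]
  {P : ObjectProperty C}

/-- A connection on the smooth bundle `E`: an `A`-linear map `∇ : Γ(E) → Γ(T*M ⊗ E)` with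
`∇(s f) = s df + ∇(s) f` for all smooth `f : M → A`. Here `cov s x v` is `(∇_v s)(x)`. -/
@[ext]
structure Connection (E : HBundle (smoothReg d M) P) where
  cov : E.Sec → ∀ x : M, TangentSpace (𝓡 d) x →L[ℝ] FiberCat.Sp (E.fiber x)
  smooth : ∀ (s : E.Sec) (X : ∀ x : M, TangentSpace (𝓡 d) x),
    ContMDiff (𝓡 d) (𝓡 d).tangent ∞ (fun x => (⟨x, X x⟩ : TangentBundle (𝓡 d) M)) →
    E.IsSection (fun x => cov s x (X x))
  add : ∀ s t r : E.Sec, (∀ x, r.1 x = s.1 x + t.1 x) → ∀ x, cov r x = cov s x + cov t x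
  leibniz : ∀ (s t : E.Sec) (f : M → A), ContMDiff (𝓡 d) 𝓘(ℝ, A) ∞ f →
    (∀ x, t.1 x = FiberCat.ract (s.1 x) (f x)) → ∀ x (v : TangentSpace (𝓡 d) x),
    cov t x v = FiberCat.ract (s.1 x) (mfderiv (𝓡 d) 𝓘(ℝ, A) f x v) +
      FiberCat.ract (cov s x v) (f x)

/-- A morphism of bundles is parallel if it is compatible with the connections:
`∇' (f s) = f (∇ s)`. -/
def IsParallel {E E' : HBundle (smoothReg d M) P} (D : Connection E) (D' : Connection E')
    (f : E ⟶ E') : Prop :=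
  ∀ (s : E.Sec) (x : M) (v : TangentSpace (𝓡 d) x),
    D'.cov (s.map f) x v = FiberCat.ev _ _ (HBundle.Hom.at f x) (D.cov s x v)

variable (M d P) in
/-- Smooth bundles with a connection. -/
structure ConnBundle where
  bundle : HBundle (smoothReg d M) P
  conn : Connection bundle

instance : Category (ConnBundle M d P) where
  Hom E E' := {f : E.bundle ⟶ E'.bundle // IsParallel E.conn E'.conn f}
  id E := ⟨𝟙 _, fun s x v => by
    have h : s.map (𝟙 E.bundle) = s := Subtype.ext (funext fun y => FiberCat.ev_id _)
    rw [h]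
    exact (FiberCat.ev_id _).symm⟩
  comp {E E' E''} f g := ⟨f.1 ≫ g.1, fun s x v => by
    have h : s.map (f.1 ≫ g.1) = (s.map f.1).map g.1 :=
      Subtype.ext (funext fun y => FiberCat.ev_comp _ _ _)
    rw [h, g.2, f.2]
    exact (FiberCat.ev_comp _ _ _).symm⟩

end Connections

end Bundles

/-! ### The functor `l²` for bundles -/

section L2Bundles

variable {A : Type u} [CStarAlgebra A] [PartialOrder A] [StarOrderedRing A] (τ : FTrace A)
  {P : ObjectProperty (HilbMod A)} {Q : ObjectProperty (HilbSp A)}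
  (h : ∀ V, P V → Q (l2Obj τ V))

/-- The functor `l²` on the full subcategories of objects with the properties `P` and `Q`. -/
def l2Sub : P.FullSubcategory ⥤ Q.FullSubcategory :=
  Q.lift (P.ι ⋙ l2 τ) (fun V => h _ V.property)

section

variable {M : Type w} [TopologicalSpace M] {R : Regularity.{u} M}

/-- The bundle `l²(W)`, by applying `l²` to the fibers and to the trivializations. -/
def l2BundleObj (W : HBundle R P) : HBundle R Q where
  fiber x := l2Obj τ (W.fiber x)
  fiber_mem x := h _ (W.fiber_mem x)
  ι := W.ι
  U := W.U
  isOpen := W.isOpen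
  cover := W.cover
  model i := l2Obj τ (W.model i)
  model_mem i := h _ (W.model_mem i)
  triv i x hx := (l2 τ).mapIso (W.triv i x hx)
  isometric i x hx := norm_l2Map_of_isometric τ _ (W.isometric i x hx)
  transition i j x hi hj := by
    refine R.congr (Filter.Eventually.of_forall fun y => ?_)
      (R.clm (l2MapL τ (W.model i) (W.model j)) (W.transition i j x hi hj))
    by_cases hy : y ∈ W.U i ∧ y ∈ W.U j
    · simp only [hy, and_self, dite_true]
      exact (l2 τ).map_comp _ _
    · simp only [hy, dite_false, map_zero]

/-- The functor `l²` on bundles. -/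
def l2Bundle : HBundle R P ⥤ HBundle R Q where
  obj W := l2BundleObj τ h W
  map {W W'} f := ⟨fun x => (l2 τ).map (HBundle.Hom.at f x), fun i j x hi hj => by
    refine R.congr (Filter.Eventually.of_forall fun y => ?_)
      (R.clm (l2MapL τ (W.model i) (W'.model j)) (HBundle.Hom.regular f i j x hi hj))
    by_cases hy : y ∈ W.U i ∧ y ∈ W'.U j
    · have hy' : y ∈ (l2BundleObj τ h W).U i ∧ y ∈ (l2BundleObj τ h W').U j := hy
      simp only [HBundle.localRep, hy, hy', and_self, dite_true]
      refine ((l2 τ).map_comp _ _).trans ?_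
      rw [(l2 τ).map_comp]
      rfl
    · have hy' : ¬ (y ∈ (l2BundleObj τ h W).U i ∧ y ∈ (l2BundleObj τ h W').U j) := hy
      simp only [HBundle.localRep, hy, hy', dite_false, map_zero]
      rfl⟩
  map_id W := HBundle.Hom.ext (funext fun x => (l2 τ).map_id _)
  map_comp f g := HBundle.Hom.ext (funext fun x => (l2 τ).map_comp _ _)

end

section

variable {d : ℕ} {M : Type w} [TopologicalSpace M] [ChartedSpace (EuclideanSpace ℝ (Fin d)) M]
  [IsManifold (𝓡 d) ∞ M]

/-- The connection `D'` on `l²(W)` extends the connection `D` on `W`: on smooth sections of `W`,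
regarded as sections of `l²(W)`, the two agree. -/
def Extends {W : HBundle (smoothReg d M) P} (D : Connection W)
    (D' : Connection ((l2Bundle τ h).obj W)) : Prop :=
  ∀ (s : W.Sec) (s' : ((l2Bundle τ h).obj W).Sec), (∀ x, s'.1 x = toL2 τ (W.fiber x) (s.1 x)) →
    ∀ (x : M) (v : TangentSpace (𝓡 d) x), D'.cov s' x v = toL2 τ (W.fiber x) (D.cov s x v)

/-- Once connections on `W` are known to extend uniquely to `l²(W)`, compatibly with parallel
morphisms, the functor `l²` on bundles with connections. -/
def l2Conn
    (h₁ : ∀ (W : HBundle (smoothReg d M) P) (D : Connection W), ∃! D', Extends τ h D D')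
    (h₂ : ∀ (W W' : HBundle (smoothReg d M) P) (D : Connection W) (D' : Connection W')
      (f : W ⟶ W'), IsParallel D D' f →
      IsParallel (h₁ W D).choose (h₁ W' D').choose ((l2Bundle τ h).map f)) :
    ConnBundle M d P ⥤ ConnBundle M d Q where
  obj E := ⟨(l2Bundle τ h).obj E.bundle, (h₁ E.bundle E.conn).choose⟩
  map f := ⟨(l2Bundle τ h).map f.1, h₂ _ _ _ _ f.1 f.2⟩
  map_id E := Subtype.ext ((l2Bundle τ h).map_id E.bundle)
  map_comp f g := Subtype.ext ((l2Bundle τ h).map_comp f.1 g.1)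

end

end L2Bundles

/-! ### Equivalences of categories -/

section Equivalences

variable {C D : Type*} [Category* C] [Category* D]

/-- The functors `F` and `G` are quasi-inverse equivalences of categories: `ε : F (G d) ≅ d` and
`η : c ≅ G (F c)` are natural isomorphisms which are compatible with each other. -/
def IsQuasiInverse (F : C ⥤ D) (G : D ⥤ C) (ε : G ⋙ F ≅ 𝟭 D) : Prop :=
  ∃ η : 𝟭 C ≅ F ⋙ G, ∀ c, F.map (η.hom.app c) ≫ ε.hom.app (F.obj c) = 𝟙 (F.obj c)

end Equivalences

end

end AHilb

open AHilb

set_option linter.unusedSectionVars false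

namespace AHilb

noncomputable section

open MulOpposite (op)
open ContinuousLinearMap (adjoint)

/-! ### The Hilbert space `l²(A)` -/

section L2Basics

variable {A : Type u} [CStarAlgebra A] [PartialOrder A] [StarOrderedRing A] (τ : FTrace A)

/-! The proof rests on one fact about l²(A): a bounded operator commuting with the right action of A
is left multiplication by an element of A (`IsLeftFull`). For such an operator T of norm at most 1,
the vector ξ = T(1) is a ‖·‖₂-limit of elements of A. Functional calculus truncates these elements
to norm at most 1 without spoiling the approximation. Bounded families in a von Neumann algebra have
weak limits in it, and τ is normal, so ξ lies in A (`isLeftFull_of_isNormal`).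

Hence A(X) can be defined without any presentation of X: it is the space of bounded A-linear
operators T : l²(A) → X, placed in X by T ↦ T(1), with ⟨S, T⟩ = S*T, which belongs to A by the fact
above. The map l²(A(X)) → X is always isometric, and it is onto when X embeds in H ⊗ l²(A), because
bounded vectors are then dense. The map V → A(l²(V)), v ↦ (a ↦ va), preserves inner products, and it
is onto when V is a summand of A^n or H ⊗ A, because a bounded A-linear operator from l²(A) to H ⊗
l²(A) is a column with entries in A. The two kinds of free module are treated together through
`IsFreeModel`. For H ⊗ A one needs in addition that boundedness of a column does not depend on the
faithful representation (`sum_star_mul_self_le_iff`), and normality of τ a second time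
(`hasSum_tau_columnInn`). The conditions p ∈ M_n(A) and p ∈ B(H) ⊗ A hold automatically, and the
description of A(X) in every presentation follows (`IsFreeModel.realizes`).

For bundles, l² and A(·) act on spaces of morphisms by bounded linear maps, hence preserve
regularity. By naturality, the unit and the counit become, in trivializations, transition functions
composed with a fixed morphism.

A connection is d + θ in local trivializations, with θ a form with values in endomorphisms. Locality
and Hadamard's lemma give this formula with θ(v) merely additive and A-linear. For finitely
generated projective Hilbert modules such a map is adjointable because there is a finite frame. For
A-Hilbert spaces it is bounded because everywhere defined A-linear operators on l²(A) are bounded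
(`continuous_of_right_linear`): every vector of l²(A) is a fraction q c⁻¹ of elements of A.
Smoothness of θ is first known only on fixed vectors, and Banach–Steinhaus upgrades it to the norm
(`contDiffOn_of_strong`). Extension and restriction of connections are then θ ↔ l²(θ), where l² is a
bounded linear bijection on morphisms, and parallelism of F is the equation dF + θ'F = Fθ, which l²
preserves and reflects. -/

theorem inner_toL2 (V : HilbMod A) (v w : V) :
    inner ℂ (toL2 τ V v) (toL2 τ V w) = τ (V.inn v w) :=
  UniformSpace.Completion.inner_coe _ _

theorem act_toL2 (V : HilbMod A) (a : A) (v : V) :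
    (l2Obj τ V).act (op a) (toL2 τ V v) = toL2 τ V (op a • v) :=
  ContinuousLinearMap.completion_apply_coe _ _

theorem toL2_injective (V : HilbMod A) : Function.Injective (toL2 τ V) :=
  (UniformSpace.Completion.coe_injective (PreL2 τ V)).comp (PreL2.toMod τ V).symm.injective

theorem denseRange_toL2 (V : HilbMod A) : DenseRange (toL2 τ V) :=
  (UniformSpace.Completion.denseRange_coe (α := PreL2 τ V)).comp
    (PreL2.toMod τ V).symm.surjective.denseRange (UniformSpace.Completion.continuous_coe _)

theorem norm_toL2_le (V : HilbMod A) (v : V) : ‖toL2 τ V v‖ ≤ ‖v‖ := by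
  refine (sq_le_sq₀ (norm_nonneg _) (norm_nonneg _)).1 ?_
  rw [norm_toL2_sq, V.norm_sq]
  exact τ.re_le_norm (V.inn_self_nonneg v)

/-- The canonical map `V → l²(V)` as a bounded operator. -/
def toL2L (V : HilbMod A) : V →L[ℂ] l2Obj τ V :=
  (toL2 τ V).mkContinuous 1 fun v => by simpa using norm_toL2_le τ V v

/-- The canonical map `A → l²(A)`. -/
abbrev toL2A : A →ₗ[ℂ] L2A τ := toL2 τ (HilbMod.self A)

theorem inner_toL2A (a b : A) : inner ℂ (toL2A τ a) (toL2A τ b) = τ (star a * b) :=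
  inner_toL2 τ (HilbMod.self A) a b

theorem norm_toL2A_sq (a : A) : ‖toL2A τ a‖ ^ 2 = (τ (star a * a)).re :=
  norm_toL2_sq τ (HilbMod.self A) a

theorem act_toL2A (a b : A) : (L2A τ).act (op a) (toL2A τ b) = toL2A τ (b * a) :=
  act_toL2 τ (HilbMod.self A) a b

theorem leftL2_toL2A (a b : A) : leftL2 τ a (toL2A τ b) = toL2A τ (a * b) :=
  l2Map_toL2 τ (HilbMod.leftMul a) b

theorem leftL2_act (a b : A) (x : L2A τ) :
    leftL2 τ a ((L2A τ).act (op b) x) = (L2A τ).act (op b) (leftL2 τ a x) :=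
  (l2Map τ (HilbMod.leftMul a)).2 (op b) x

theorem adjoint_act (X : HilbSp A) (a : A) : adjoint (X.act (op a)) = X.act (op (star a)) := by
  rw [← ContinuousLinearMap.star_eq_adjoint, ← map_star, MulOpposite.op_star]

theorem inner_act_left (X : HilbSp A) (a : A) (x y : X) :
    inner ℂ (X.act (op a) x) y = inner ℂ x (X.act (op (star a)) y) := by
  rw [← adjoint_act, ContinuousLinearMap.adjoint_inner_right]

theorem L2A_ext {E : Type*} [NormedAddCommGroup E] [NormedSpace ℂ E] {S T : L2A τ →L[ℂ] E}
    (h : ∀ a, S (toL2A τ a) = T (toL2A τ a)) : S = T :=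
  ContinuousLinearMap.ext fun x => congrFun ((denseRange_toL2 τ (HilbMod.self A)).equalizer
    S.continuous T.continuous (funext h)) x

theorem L2A_ext_inner {x y : L2A τ} (h : ∀ a, inner ℂ (toL2A τ a) x = inner ℂ (toL2A τ a) y) :
    x = y :=
  (denseRange_toL2 τ (HilbMod.self A)).eq_of_inner_right ℂ (fun a => h a)

/-- The left regular representation of `A` on `l²(A)`. -/
def leftHom : A →⋆ₐ[ℂ] (L2A τ →L[ℂ] L2A τ) where
  toFun := leftL2 τ
  map_one' := L2A_ext τ fun a => by
    rw [leftL2_toL2A, one_mul, one_apply_eq_self]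
  map_mul' a b := L2A_ext τ fun c => by
    rw [leftL2_toL2A, mul_apply_eq_comp, leftL2_toL2A, leftL2_toL2A, mul_assoc]
  map_zero' := L2A_ext τ fun a => by
    rw [leftL2_toL2A, zero_mul, map_zero, zero_apply]
  map_add' a b := L2A_ext τ fun c => by
    rw [leftL2_toL2A, add_apply, leftL2_toL2A, leftL2_toL2A, add_mul, map_add]
  commutes' z := L2A_ext τ fun a => by
    rw [leftL2_toL2A, Algebra.algebraMap_eq_smul_one, Algebra.algebraMap_eq_smul_one,
      smul_mul_assoc, one_mul, smul_apply, map_smul, one_apply_eq_self]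
  map_star' a := by
    rw [ContinuousLinearMap.star_eq_adjoint]
    refine L2A_ext τ fun c => L2A_ext_inner τ fun b => ?_
    rw [ContinuousLinearMap.adjoint_inner_right, leftL2_toL2A, leftL2_toL2A, inner_toL2A,
      inner_toL2A, star_mul, mul_assoc]

@[simp] theorem leftHom_apply (a : A) : leftHom τ a = leftL2 τ a := rfl

theorem leftL2_injective : Function.Injective (leftL2 τ) := fun a b h => by
  have := congrArg (fun T : L2A τ →L[ℂ] L2A τ => T (toL2A τ 1)) h
  simp only [leftL2_toL2A, mul_one] at this
  exact toL2_injective τ _ this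

theorem norm_leftL2 (a : A) : ‖leftL2 τ a‖ = ‖a‖ :=
  NonUnitalStarAlgHom.norm_map (leftHom τ) (leftL2_injective τ) a

theorem adjoint_leftL2 (a : A) : adjoint (leftL2 τ a) = leftL2 τ (star a) :=
  (map_star (leftHom τ) a).symm

theorem leftL2_mul (a b : A) : leftL2 τ (a * b) = leftL2 τ a ∘L leftL2 τ b :=
  map_mul (leftHom τ) a b

theorem leftL2_one : leftL2 τ 1 = ContinuousLinearMap.id ℂ _ := map_one (leftHom τ)

/-- An injective `*`-homomorphism reflects positivity. -/
theorem nonneg_of_starAlgHom {B : Type*} [CStarAlgebra B] [PartialOrder B] [StarOrderedRing B]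
    (φ : A →⋆ₐ[ℂ] B) (hφ : Function.Injective φ) {a : A} (h : 0 ≤ φ a) : 0 ≤ a := by
  have hsa : IsSelfAdjoint a := hφ <| by
    rw [map_star]
    exact IsSelfAdjoint.of_nonneg h
  rw [StarOrderedRing.nonneg_iff_spectrum_nonneg (R := ℝ) _ hsa]
  rwa [StarOrderedRing.nonneg_iff_spectrum_nonneg (R := ℝ) _ (hsa.map φ),
    hsa.map_spectrum_real φ hφ] at h

end L2Basics

/-! ### Bounded operators commuting with the right action are left multiplications -/

section Cutoff

variable {A : Type u} [CStarAlgebra A] [PartialOrder A] [StarOrderedRing A] (τ : FTrace A)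

/-- With |a| = (a*a)^(1/2), the element b is a · min(1, |a|⁻¹), the truncation of a at height 1,
while y is the square root of (|a| − 1)₊ and m = y / max(|a|, 1). Writing the excess a − b as (a m)
y splits it into two factors of equal ‖·‖₂-norm, as needed for the Cauchy–Schwarz estimate that
follows. -/
theorem exists_cutoff (a : A) : ∃ b m y : A, a - b = a * (m * y) ∧ star y = y ∧ ‖b‖ ≤ 1 ∧
    star (a * m) * (a * m) = y * y ∧ star (a - b) * b = y * y := by
  -- The spectral variable is that of a*a, so `√s` stands for |a|; the denominator `max (√s) 1`
  -- keeps the quotient continuous at 0.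
  let hy : ℝ → ℝ := fun s => √(max (√s - 1) 0)
  let hm : ℝ → ℝ := fun s => hy s / max (√s) 1
  have hpos : ∀ s : ℝ, 0 < max (√s) 1 := fun s => lt_max_of_lt_right one_pos
  have cy : Continuous hy := by fun_prop
  have cm : Continuous hm := cy.div (by fun_prop) fun s => (hpos s).ne'
  set s := star a * a with hs
  have hs0 : 0 ≤ s := star_mul_self_nonneg a
  have hsa : IsSelfAdjoint s := IsSelfAdjoint.of_nonneg hs0
  have hspec : ∀ t ∈ spectrum ℝ s, 0 ≤ t := fun t ht => spectrum_nonneg_of_nonneg hs0 ht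
  set y := cfc hy s with hydef
  set m := cfc hm s with hmdef
  have ys : star y = y := (cfc_predicate hy s : IsSelfAdjoint _)
  have ms : star m = m := (cfc_predicate hm s : IsSelfAdjoint _)
  have sid : cfc (id : ℝ → ℝ) s = s := cfc_id ℝ s
  have hmy : m * y = cfc (fun t => hm t * hy t) s := by
    rw [← cfc_mul hm hy s cm.continuousOn cy.continuousOn]
  have hb : 1 - m * y = cfc (fun t => 1 - hm t * hy t) s := by
    rw [hmy, ← cfc_const_one ℝ s, ← cfc_sub _ _ s (by fun_prop) (by fun_prop)]
  have hyy : y * y = cfc (fun t => hy t * hy t) s := by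
    rw [← cfc_mul hy hy s cy.continuousOn cy.continuousOn]
  refine ⟨a * (1 - m * y), m, y, by rw [mul_sub, mul_one, sub_sub_cancel], ys, ?_, ?_, ?_⟩
  · have h1 : star (a * (1 - m * y)) * (a * (1 - m * y)) =
        cfc (fun t => (1 - hm t * hy t) * (t * (1 - hm t * hy t))) s := by
      rw [star_mul, mul_assoc, ← mul_assoc (star a), ← hs, hb,
        (cfc_predicate (fun t => 1 - hm t * hy t) s : IsSelfAdjoint _).star_eq,
        cfc_mul _ _ s (by fun_prop) (by fun_prop), cfc_mul _ _ s (by fun_prop) (by fun_prop)]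
      congr 2
      exact sid.symm
    -- On the spectrum the function is t / max(√t, 1)², which is at most 1.
    have h2 : ‖star (a * (1 - m * y)) * (a * (1 - m * y))‖ ≤ 1 := by
      rw [h1]
      refine norm_cfc_le zero_le_one fun t ht => ?_
      have ht0 := hspec t ht
      have hr : 0 ≤ √t := Real.sqrt_nonneg t
      have hrr : √t * √t = t := Real.mul_self_sqrt ht0
      have e : hm t * hy t = max (√t - 1) 0 / max (√t) 1 := by
        simp only [hm, hy]
        rw [div_mul_eq_mul_div, Real.mul_self_sqrt (le_max_right _ _)]
      rw [e]
      rcases le_total (√t) 1 with h | h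
      · rw [max_eq_right (by linarith), zero_div, sub_zero, one_mul, mul_one,
          Real.norm_of_nonneg ht0, ← hrr]
        nlinarith
      · have hne : √t ≠ 0 := by linarith
        rw [max_eq_left (by linarith), max_eq_left h]
        have : (1 - (√t - 1) / √t) * (t * (1 - (√t - 1) / √t)) = 1 := by
          field_simp
          nlinarith
        rw [this]
        simp
    rw [CStarRing.norm_star_mul_self] at h2
    nlinarith [norm_nonneg (a * (1 - m * y))]
  · rw [star_mul, mul_assoc, ← mul_assoc (star a), ← hs, ms, hyy]
    have : m * (s * m) = cfc (fun t => hm t * (t * hm t)) s := by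
      rw [cfc_mul _ _ s (by fun_prop) (by fun_prop), cfc_mul _ _ s (by fun_prop) (by fun_prop)]
      congr 2
      exact sid.symm
    rw [this]
    refine cfc_congr fun t ht => ?_
    have hrr : √t * √t = t := Real.mul_self_sqrt (hspec t ht)
    simp only [hm]
    rcases le_total (√t) 1 with h | h
    · have : hy t = 0 := by
        simp only [hy]
        rw [max_eq_right (by linarith), Real.sqrt_zero]
      simp [this]
    · have hne : √t ≠ 0 := by linarith
      rw [max_eq_left h]
      field_simp
      nlinarith
  · rw [mul_sub, mul_one, sub_sub_cancel, ← mul_one_sub, star_mul, star_mul, ys, ms, mul_assoc,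
      mul_assoc, ← mul_assoc (star a), ← hs, hyy, hb]
    have : y * (m * (s * cfc (fun t => 1 - hm t * hy t) s)) =
        cfc (fun t => hy t * (hm t * (t * (1 - hm t * hy t)))) s := by
      rw [cfc_mul _ _ s (by fun_prop) (by fun_prop), cfc_mul _ _ s (by fun_prop) (by fun_prop),
        cfc_mul _ _ s (by fun_prop) (by fun_prop)]
      congr 3
      exact sid.symm
    rw [this]
    refine cfc_congr fun t ht => ?_
    have hrr : √t * √t = t := Real.mul_self_sqrt (hspec t ht)
    rcases le_total (√t) 1 with h | h
    · have : hy t = 0 := by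
        simp only [hy]
        rw [max_eq_right (by linarith), Real.sqrt_zero]
      simp [this]
    · have hne : √t ≠ 0 := by linarith
      have e : hy t * hy t = √t - 1 := by
        simp only [hy]
        rw [Real.mul_self_sqrt (le_max_right _ _), max_eq_left (by linarith)]
      have em : hm t = hy t / √t := by simp only [hm, max_eq_left h]
      have : hy t * (hm t * (t * (1 - hm t * hy t))) =
          (hy t * hy t) * (√t * √t * (1 - hy t * hy t / √t) / √t) := by
        rw [em, hrr]
        ring
      rw [this, e]
      field_simp
      ring

/-- Put ξ = T(1). The truncation b of an approximant a behaves like a nearest point in a convex set: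
Re ⟨a − b, ξ − b⟩ ≤ 0, because ⟨a − b, b⟩ = ‖y‖₂², while Re ⟨a − b, ξ⟩ = Re ⟨a m, T y⟩ ≤ ‖y‖₂².
Hence ‖ξ − b‖² ≤ Re ⟨ξ − a, ξ − b⟩, and truncation does not increase the distance to ξ. -/
theorem exists_bounded_approx {T : L2A τ →L[ℂ] L2A τ}
    (hT : ∀ b x, T ((L2A τ).act (op b) x) = (L2A τ).act (op b) (T x)) (hT1 : ‖T‖ ≤ 1)
    {ε : ℝ} (hε : 0 < ε) : ∃ b : A, ‖b‖ ≤ 1 ∧ ‖T (toL2A τ 1) - toL2A τ b‖ ≤ ε := by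
  obtain ⟨a, ha⟩ := (denseRange_toL2 τ (HilbMod.self A)).exists_dist_lt (T (toL2A τ 1)) hε
  change A at a
  obtain ⟨b, m, y, hab, hy, hb, ham, hbb⟩ := exists_cutoff a
  refine ⟨b, hb, ?_⟩
  set ξ := T (toL2A τ 1)
  have h1 : inner ℂ (toL2A τ a - toL2A τ b) (toL2A τ b) = τ (y * y) := by
    rw [← map_sub, inner_toL2A, hbb]
  have hny : ‖toL2A τ y‖ ^ 2 = (τ (y * y)).re := by
    rw [norm_toL2A_sq, hy]
  have hnam : ‖toL2A τ (a * m)‖ ^ 2 = (τ (y * y)).re := by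
    rw [norm_toL2A_sq, ham]
  have heq : ‖toL2A τ (a * m)‖ = ‖toL2A τ y‖ :=
    (sq_eq_sq₀ (norm_nonneg _) (norm_nonneg _)).1 (hnam.trans hny.symm)
  -- The self-adjoint factor y moves across the inner product as a right multiplication, and ξ y =
  -- T(1) y = T(y).
  have h2 : inner ℂ (toL2A τ a - toL2A τ b) ξ = inner ℂ (toL2A τ (a * m)) (T (toL2A τ y)) := by
    rw [← map_sub, hab, ← mul_assoc, ← act_toL2A, inner_act_left, hy, ← hT, act_toL2A, one_mul]
  have h3 : (inner ℂ (toL2A τ a - toL2A τ b) ξ).re ≤ (τ (y * y)).re := by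
    rw [h2]
    calc _ ≤ ‖toL2A τ (a * m)‖ * ‖T (toL2A τ y)‖ := re_inner_le_norm (𝕜 := ℂ) _ _
      _ ≤ ‖toL2A τ y‖ * (1 * ‖toL2A τ y‖) := by
        rw [heq]
        gcongr
        exact T.le_of_opNorm_le hT1 _
      _ = _ := by rw [← hny]; ring
  have h4 : (inner ℂ (toL2A τ a - toL2A τ b) (ξ - toL2A τ b)).re ≤ 0 := by
    rw [inner_sub_right, h1, Complex.sub_re]
    linarith
  have h5 : ‖ξ - toL2A τ b‖ ^ 2 = (inner ℂ (ξ - toL2A τ a) (ξ - toL2A τ b)).re +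
      (inner ℂ (toL2A τ a - toL2A τ b) (ξ - toL2A τ b)).re := by
    rw [← Complex.add_re, ← inner_add_left, sub_add_sub_cancel]
    exact (inner_self_eq_norm_sq (𝕜 := ℂ) _).symm
  have h6 : (inner ℂ (ξ - toL2A τ a) (ξ - toL2A τ b)).re ≤ ‖ξ - toL2A τ a‖ * ‖ξ - toL2A τ b‖ :=
    re_inner_le_norm (𝕜 := ℂ) _ _
  have h7 : ‖ξ - toL2A τ a‖ < ε := by rwa [← dist_eq_norm]
  rcases (norm_nonneg (ξ - toL2A τ b)).eq_or_lt with h | h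
  · rw [← h]
    exact hε.le
  · nlinarith

end Cutoff

/-! ### Weak limits of bounded families in A -/

section WeakLimit

open Filter Topology

variable {A : Type u} [CStarAlgebra A] {𝓗 : Type u} [NormedAddCommGroup 𝓗]
  [InnerProductSpace ℂ 𝓗] [CompleteSpace 𝓗]

theorem exists_tendsto_ultrafilter {α : Type*} (𝒰 : Ultrafilter α) {z : α → ℂ} {K : ℝ}
    (hz : ∀ n, ‖z n‖ ≤ K) : ∃ l, Tendsto z 𝒰 (𝓝 l) := by
  obtain ⟨l, -, hl⟩ := (isCompact_closedBall (0 : ℂ) K).ultrafilter_le_nhds (𝒰.map z)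
    (Filter.le_principal_iff.2 (Filter.mem_map.2 (Filter.univ_mem' fun n => by
      simpa using hz n)))
  exact ⟨l, hl⟩

/-- Bounded sequences of operators have weak limits along ultrafilters. -/
theorem exists_weak_limit_operator {α : Type*} (𝒰 : Ultrafilter α) {T : α → 𝓗 →L[ℂ] 𝓗} {C : ℝ}
    (hT : ∀ n, ‖T n‖ ≤ C) : ∃ S : 𝓗 →L[ℂ] 𝓗, ∀ x y,
      Tendsto (fun n => inner ℂ (T n x) y) 𝒰 (𝓝 (inner ℂ (S x) y)) := by
  have hb : ∀ x y n, ‖inner ℂ (T n x) y‖ ≤ C * ‖x‖ * ‖y‖ := fun x y n =>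
    (norm_inner_le_norm _ _).trans (by gcongr; exact (T n).le_of_opNorm_le (hT n) x)
  choose B hB using fun x y => exists_tendsto_ultrafilter 𝒰 (hb x y)
  -- The limits of the matrix coefficients form a bounded sesquilinear form, which comes from an
  -- operator.
  let B' : 𝓗 →L⋆[ℂ] 𝓗 →L[ℂ] ℂ := LinearMap.mkContinuous₂
    (LinearMap.mk₂'ₛₗ (starRingEnd ℂ) (RingHom.id ℂ) B
      (fun x x' y => tendsto_nhds_unique (hB _ _) (by
        simpa only [map_add, inner_add_left] using (hB x y).add (hB x' y)))
      (fun z x y => tendsto_nhds_unique (hB _ _) (by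
        simpa only [map_smul, inner_smul_left, smul_eq_mul] using (hB x y).const_mul (starRingEnd ℂ z)))
      (fun x y y' => tendsto_nhds_unique (hB _ _) (by
        simpa only [inner_add_right] using (hB x y).add (hB x y')))
      (fun z x y => tendsto_nhds_unique (hB _ _) (by
        simpa only [inner_smul_right, smul_eq_mul, RingHom.id_apply] using (hB x y).const_mul z))) C
    (fun x y => le_of_tendsto (hB x y).norm (Eventually.of_forall (hb x y)))
  refine ⟨InnerProductSpace.continuousLinearMapOfBilin B', fun x y => ?_⟩
  rw [InnerProductSpace.continuousLinearMapOfBilin_apply]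
  exact hB x y

/-- The weak operator limit still commutes with the commutant of `N`, so it lies in A by the double
commutant property. Normality writes τ as an absolutely convergent sum of vector functionals, and
dominated convergence moves the limit inside that sum. -/
theorem exists_weak_limit (N : VonNeumannAlgebra 𝓗) (e : A ≃⋆ₐ[ℂ] N.toStarSubalgebra)
    {τ : FTrace A} (hτ : τ.IsNormal N e) {α : Type*} (𝒰 : Ultrafilter α) {b : α → A} {C : ℝ}
    (hb : ∀ n, ‖b n‖ ≤ C) :
    ∃ a, ∀ c, Tendsto (fun n => τ (c * b n)) 𝒰 (𝓝 (τ (c * a))) := by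
  obtain ⟨S, hS⟩ := exists_weak_limit_operator 𝒰 (T := fun n => rep N e (b n)) (C := C)
    fun n => (norm_rep N e _).trans_le (hb n)
  obtain ⟨a, rfl⟩ : S ∈ Set.range (rep N e) := by
    refine mem_range_rep N e fun c hc => ContinuousLinearMap.ext fun x => ?_
    refine ext_inner_right ℂ fun y => ?_
    change inner ℂ (c (S x)) y = inner ℂ (S (c x)) y
    refine tendsto_nhds_unique (l := (𝒰 : Filter α)) ?_ (hS (c x) y)
    have h := hS x (star c y)
    have e1 : ∀ n, inner ℂ (rep N e (b n) (c x)) y = inner ℂ (rep N e (b n) x) (star c y) := by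
      intro n
      have : rep N e (b n) (c x) = c (rep N e (b n) x) :=
        congrArg (fun T : 𝓗 →L[ℂ] 𝓗 => T x) (hc _ (e (b n)).2)
      rw [this, ContinuousLinearMap.star_eq_adjoint, ContinuousLinearMap.adjoint_inner_right]
    simp only [e1]
    rwa [ContinuousLinearMap.star_eq_adjoint, ContinuousLinearMap.adjoint_inner_right] at h
  refine ⟨a, fun c => ?_⟩
  obtain ⟨x, y, hx, hy, hsum⟩ := hτ
  have hS' : ∀ u v, Tendsto (fun n => inner ℂ v (rep N e (b n) u)) 𝒰
      (𝓝 (inner ℂ v (rep N e a u))) := fun u v => by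
    have := (Complex.continuous_conj.tendsto _).comp (hS u v)
    simpa only [Function.comp_def, inner_conj_symm] using this
  have hC : 0 ≤ C := by
    obtain ⟨n⟩ := (𝒰 : Filter α).nonempty_of_neBot
    exact (norm_nonneg _).trans (hb n)
  rw [← (hsum (c * a)).tsum_eq]
  simp_rw [← fun n => (hsum (c * b n)).tsum_eq]
  refine tendsto_tsum_of_dominated_convergence
    (bound := fun k => ‖c‖ * C * (‖x k‖ ^ 2 + ‖y k‖ ^ 2)) ((hx.add hy).mul_left _) (fun k => ?_)
    (Eventually.of_forall fun n k => ?_)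
  · have e1 : ∀ d, inner ℂ (x k) (rep N e (c * d) (y k)) =
        inner ℂ (rep N e (star c) (x k)) (rep N e d (y k)) := fun d => by
      rw [rep_mul, rep_star, ContinuousLinearMap.star_eq_adjoint,
        ContinuousLinearMap.adjoint_inner_left]
      rfl
    simp only [e1]
    exact hS' _ _
  · have h1 : ‖rep N e (c * b n) (y k)‖ ≤ ‖c‖ * C * ‖y k‖ :=
      ContinuousLinearMap.le_of_opNorm_le _ ((norm_rep N e _).trans_le ((norm_mul_le _ _).trans
        (mul_le_mul_of_nonneg_left (hb n) (norm_nonneg c)))) _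
    calc _ ≤ ‖x k‖ * (‖c‖ * C * ‖y k‖) :=
          (norm_inner_le_norm _ _).trans (mul_le_mul_of_nonneg_left h1 (norm_nonneg _))
      _ = ‖c‖ * C * (‖x k‖ * ‖y k‖) := by ring
      _ ≤ _ := by
        refine mul_le_mul_of_nonneg_left ?_ (by positivity)
        nlinarith [sq_nonneg (‖x k‖ - ‖y k‖), sq_nonneg (‖x k‖), sq_nonneg (‖y k‖)]

end WeakLimit

/-! ### The commutant of the right action -/

section Commutant

open Filter Topology

variable {A : Type u} [CStarAlgebra A] [PartialOrder A] [StarOrderedRing A] (τ : FTrace A)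

/-- Every bounded operator on `l²(A)` that commutes with the right action of `A` is the left
multiplication by an element of `A`. -/
def IsLeftFull : Prop := ∀ T : L2A τ →L[ℂ] L2A τ,
  (∀ b x, T ((L2A τ).act (op b) x) = (L2A τ).act (op b) (T x)) → ∃ a, T = leftL2 τ a

variable {τ}

/-- The vector 1 is cyclic for the right action, so an operator commuting with this action is
determined by its value there. -/
theorem eq_leftL2 {T : L2A τ →L[ℂ] L2A τ}
    (hT : ∀ b x, T ((L2A τ).act (op b) x) = (L2A τ).act (op b) (T x)) {a : A}
    (h : T (toL2A τ 1) = toL2A τ a) : T = leftL2 τ a :=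
  L2A_ext τ fun b => by
    rw [leftL2_toL2A, ← act_toL2A, ← h, ← hT, act_toL2A, one_mul]

/-- After rescaling, T(1) is a norm limit of elements bₙ of the unit ball of A. A weak limit a of
the bₙ along an ultrafilter satisfies τ(c* bₙ) → τ(c* a) for every c in A, so a and T(1) have the
same inner products with the dense subspace A. -/
theorem isLeftFull_of_isNormal {𝓗 : Type u} [NormedAddCommGroup 𝓗] [InnerProductSpace ℂ 𝓗]
    [CompleteSpace 𝓗] (N : VonNeumannAlgebra 𝓗) (e : A ≃⋆ₐ[ℂ] N.toStarSubalgebra)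
    (hτ : τ.IsNormal N e) : IsLeftFull τ := by
  have key : ∀ T : L2A τ →L[ℂ] L2A τ, ‖T‖ ≤ 1 →
      (∀ b x, T ((L2A τ).act (op b) x) = (L2A τ).act (op b) (T x)) → ∃ a, T = leftL2 τ a := by
    intro T hT1 hT
    choose b hb hbT using fun n : ℕ => exists_bounded_approx τ hT hT1 (ε := 1 / ((n : ℝ) + 1))
      (by positivity)
    obtain ⟨a, ha⟩ := exists_weak_limit N e hτ (hyperfilter ℕ) hb
    refine ⟨a, eq_leftL2 hT (L2A_ext_inner τ fun c => ?_)⟩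
    rw [inner_toL2A]
    refine tendsto_nhds_unique ?_ (ha (star c))
    simp only [← inner_toL2A]
    have h : Tendsto (fun n => toL2A τ (b n)) atTop (𝓝 (T (toL2A τ 1))) := by
      rw [tendsto_iff_norm_sub_tendsto_zero]
      refine squeeze_zero (fun n => norm_nonneg _) (fun n => ?_)
        tendsto_one_div_add_atTop_nhds_zero_nat
      rw [norm_sub_rev]
      exact hbT n
    exact tendsto_const_nhds.inner (h.mono_left Nat.hyperfilter_le_atTop)
  intro T hT
  have hpos : 0 < ‖T‖ + 1 := by positivity
  have hne : ((‖T‖ + 1 : ℝ) : ℂ) ≠ 0 := by exact_mod_cast hpos.ne'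
  -- Dividing by ‖T‖ + 1 instead of ‖T‖ avoids treating T = 0 separately.
  obtain ⟨a, ha⟩ := key ((((‖T‖ + 1 : ℝ) : ℂ)⁻¹) • T) (by
      rw [norm_smul, norm_inv, Complex.norm_real, Real.norm_of_nonneg hpos.le,
        inv_mul_le_iff₀ hpos]
      linarith) (fun b x => by rw [smul_apply, hT, smul_apply, map_smul])
  refine ⟨((‖T‖ + 1 : ℝ) : ℂ) • a, ?_⟩
  rw [← leftHom_apply, map_smul, leftHom_apply, ← ha, smul_smul, mul_inv_cancel₀ hne, one_smul]

end Commutant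

/-! ### Automatic continuity of `A`-linear maps on `l²(A)` -/

section Involution

variable {A : Type u} [CStarAlgebra A] [PartialOrder A] [StarOrderedRing A] (τ : FTrace A)

/-- The entrywise adjoint on `A`, for the norm `‖·‖₂`. -/
def preStar (a : PreL2 τ (HilbMod.self A)) : PreL2 τ (HilbMod.self A) := star (R := A) a

/-- The trace property τ(a a*) = τ(a* a) is what makes the adjoint isometric for ‖·‖₂. -/
theorem isometry_preStar : Isometry (preStar τ) := by
  refine Isometry.of_dist_eq fun a b => ?_
  rw [dist_eq_norm, dist_eq_norm]
  have h : ∀ c : PreL2 τ (HilbMod.self A), ‖preStar τ c‖ = ‖c‖ := fun c => by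
    refine (sq_eq_sq₀ (norm_nonneg _) (norm_nonneg _)).1 ?_
    rw [PreL2.norm_sq, PreL2.norm_sq]
    have h' : ∀ d : A, (τ (star (star d) * star d)).re = (τ (star d * d)).re := fun d => by
      rw [star_star, τ.map_mul_comm]
    exact h' c
  rw [← h (a - b)]
  exact congrArg norm (star_sub (R := A) a b).symm

/-- The conjugation `J` of `l²(A)`, extending `a ↦ a*`. -/
def conjL2 : L2A τ → L2A τ := UniformSpace.Completion.map (preStar τ)

theorem continuous_conjL2 : Continuous (conjL2 τ) := UniformSpace.Completion.continuous_map

theorem conjL2_toL2A (a : A) : conjL2 τ (toL2A τ a) = toL2A τ (star a) :=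
  UniformSpace.Completion.map_coe (isometry_preStar τ).uniformContinuous _

theorem L2A_induction {p : L2A τ → Prop} (hp : IsClosed {x | p x}) (h : ∀ a, p (toL2A τ a))
    (x : L2A τ) : p x :=
  (denseRange_toL2 τ (HilbMod.self A)).induction_on x hp h

theorem conjL2_conjL2 (x : L2A τ) : conjL2 τ (conjL2 τ x) = x := by
  induction x using L2A_induction with
  | hp => exact isClosed_eq ((continuous_conjL2 τ).comp (continuous_conjL2 τ)) continuous_id
  | h a => rw [conjL2_toL2A, conjL2_toL2A, star_star]

/-- J exchanges the two actions, so injectivity of left multiplications and left denominators can be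
traded for their right-handed versions. -/
theorem conjL2_act (a : A) (x : L2A τ) :
    conjL2 τ ((L2A τ).act (op a) x) = leftL2 τ (star a) (conjL2 τ x) := by
  induction x using L2A_induction with
  | hp =>
    exact isClosed_eq ((continuous_conjL2 τ).comp (ContinuousLinearMap.continuous _))
      ((ContinuousLinearMap.continuous _).comp (continuous_conjL2 τ))
  | h b => rw [act_toL2A, conjL2_toL2A, conjL2_toL2A, leftL2_toL2A, star_mul]

theorem conjL2_zero : conjL2 τ 0 = 0 := by
  rw [← map_zero (toL2A τ), conjL2_toL2A, star_zero]

end Involution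

/-! ### Vectors of l²(A) as fractions of elements of A -/

section Affiliated

variable {A : Type u} [CStarAlgebra A] [PartialOrder A] [StarOrderedRing A] {τ : FTrace A}

/-- Here σ is the adjoint of ρ. A subspace invariant under both has an orthogonal complement
invariant under ρ, so the decomposition of x into its two parts is respected by ρ. -/
theorem starProjection_comm {W : Type*} [NormedAddCommGroup W] [InnerProductSpace ℂ W]
    [CompleteSpace W] (K : Submodule ℂ W) [K.HasOrthogonalProjection] {ρ σ : W →L[ℂ] W}
    (hρσ : ∀ x y, inner ℂ x (ρ y) = inner ℂ (σ x) y) (hρ : ∀ x ∈ K, ρ x ∈ K)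
    (hσ : ∀ x ∈ K, σ x ∈ K) (x : W) : K.starProjection (ρ x) = ρ (K.starProjection x) := by
  refine Submodule.eq_starProjection_of_mem_orthogonal (hρ _ (K.starProjection_apply_mem x)) ?_
  rw [← map_sub, Submodule.mem_orthogonal]
  intro k hk
  rw [hρσ]
  exact Submodule.inner_right_of_mem_orthogonal (hσ k hk) (K.sub_starProjection_mem_orthogonal x)

/-- Every `ξ ∈ l²(A)` is of the form `q c⁻¹` with `q, c ∈ A`, where `c` acts injectively. -/
theorem exists_right_denominator (hK : IsLeftFull τ) (ξ : L2A τ) : ∃ c q : A, star c = c ∧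
    (∀ x, leftL2 τ c x = 0 → x = 0) ∧ (∀ x, (L2A τ).act (op c) x = 0 → x = 0) ∧
    (L2A τ).act (op c) ξ = toL2A τ q := by
  -- The densely defined operator a ↦ ξ a is studied through the projection onto its closed graph in
  -- l²(A) ⊕ l²(A), in the manner of Murray and von Neumann.
  let W := WithLp 2 (L2A τ × L2A τ)
  let ι₁ : L2A τ →L[ℂ] W := (WithLp.prodContinuousLinearEquiv 2 ℂ _ _).symm.toContinuousLinearMap ∘L
    ContinuousLinearMap.inl ℂ _ _
  let ι₂ : L2A τ →L[ℂ] W := (WithLp.prodContinuousLinearEquiv 2 ℂ _ _).symm.toContinuousLinearMap ∘L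
    ContinuousLinearMap.inr ℂ _ _
  let π₁ : W →L[ℂ] L2A τ := ContinuousLinearMap.fst ℂ _ _ ∘L
    (WithLp.prodContinuousLinearEquiv 2 ℂ _ _).toContinuousLinearMap
  let π₂ : W →L[ℂ] L2A τ := ContinuousLinearMap.snd ℂ _ _ ∘L
    (WithLp.prodContinuousLinearEquiv 2 ℂ _ _).toContinuousLinearMap
  have hin : ∀ x y : W, inner ℂ x y = inner ℂ (π₁ x) (π₁ y) + inner ℂ (π₂ x) (π₂ y) :=
    fun x y => WithLp.prod_inner_apply x y
  have h11 : ∀ x, π₁ (ι₁ x) = x := fun x => rfl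
  have h21 : ∀ x, π₂ (ι₁ x) = 0 := fun x => rfl
  have h12 : ∀ x, π₁ (ι₂ x) = 0 := fun x => rfl
  have h22 : ∀ x, π₂ (ι₂ x) = x := fun x => rfl
  let ρ : A → W →L[ℂ] W := fun b =>
    ι₁ ∘L (L2A τ).act (op b) ∘L π₁ + ι₂ ∘L (L2A τ).act (op b) ∘L π₂
  have hρ1 : ∀ b x, π₁ (ρ b x) = (L2A τ).act (op b) (π₁ x) := fun b x => by
    simp only [ρ, add_apply, ContinuousLinearMap.comp_apply, map_add, h11, h12, add_zero]
  have hρ2 : ∀ b x, π₂ (ρ b x) = (L2A τ).act (op b) (π₂ x) := fun b x => by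
    simp only [ρ, add_apply, ContinuousLinearMap.comp_apply, map_add, h21, h22, zero_add]
  have hρι : ∀ b x, ρ b (ι₁ x) = ι₁ ((L2A τ).act (op b) x) := fun b x => by
    simp only [ρ, add_apply, ContinuousLinearMap.comp_apply, h11, h21, map_zero, add_zero]
  have hadj : ∀ b x y, inner ℂ x (ρ b y) = inner ℂ (ρ (star b) x) y := fun b x y => by
    rw [hin, hin, hρ1, hρ1, hρ2, hρ2, inner_act_left, inner_act_left, star_star]
  let G : A →ₗ[ℂ] W := ι₁.toLinearMap ∘ₗ toL2A τ +
    { toFun := fun a => ι₂ ((L2A τ).act (op a) ξ)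
      map_add' := fun a b => by rw [MulOpposite.op_add, map_add, add_apply, map_add]
      map_smul' := fun z a => by
        rw [MulOpposite.op_smul, map_smul, smul_apply, map_smul, RingHom.id_apply] }
  have hG : ∀ a, G a = ι₁ (toL2A τ a) + ι₂ ((L2A τ).act (op a) ξ) := fun a => rfl
  let K := (LinearMap.range G).topologicalClosure
  have : CompleteSpace K := (Submodule.isClosed_topologicalClosure _).completeSpace_coe
  have hGK : ∀ a, G a ∈ K := fun a => Submodule.le_topologicalClosure _ ⟨a, rfl⟩
  have hind : ∀ {p : W → Prop}, IsClosed {x | p x} → (∀ a, p (G a)) → ∀ x ∈ K, p x := by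
    intro p hp h x hx
    exact closure_minimal (by rintro _ ⟨a, rfl⟩; exact h a) hp hx
  have hρK : ∀ b, ∀ x ∈ K, ρ b x ∈ K := fun b => by
    refine hind ((Submodule.isClosed_topologicalClosure _).preimage (ρ b).continuous) fun a => ?_
    have : ρ b (G a) = G (a * b) := by
      rw [hG, hG, map_add, hρι, act_toL2A, MulOpposite.op_mul, map_mul (L2A τ).act]
      simp only [ρ, add_apply, ContinuousLinearMap.comp_apply, h12, h22, map_zero, zero_add]
      rfl
    change ρ b (G a) ∈ K
    rw [this]
    exact hGK _
  let P := K.starProjection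
  have hP : ∀ b x, P (ρ b x) = ρ b (P x) := fun b x =>
    starProjection_comm K (hadj b) (hρK b) (hρK _) x
  have hPs : ∀ x y, inner ℂ (P x) y = inner ℂ x (P y) := fun x y =>
    K.inner_starProjection_left_eq_right x y
  -- The graph is invariant under the right action, so the first column of its projection consists
  -- of left multiplications by some p and q in A. The point (p, q) = P(1, 0) lies on the closed
  -- graph, which is meant to say ξ p = q.
  obtain ⟨p, hp⟩ := hK (π₁ ∘L P ∘L ι₁) fun b x => by
    simp only [ContinuousLinearMap.comp_apply]
    rw [← hρι, hP, hρ1]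
  obtain ⟨q, hq⟩ := hK (π₂ ∘L P ∘L ι₁) fun b x => by
    simp only [ContinuousLinearMap.comp_apply]
    rw [← hρι, hP, hρ2]
  have hp' : ∀ x, π₁ (P (ι₁ x)) = leftL2 τ p x := fun x => congrArg (fun T : _ →L[ℂ] _ => T x) hp
  have hq' : ∀ x, π₂ (P (ι₁ x)) = leftL2 τ q x := fun x => congrArg (fun T : _ →L[ℂ] _ => T x) hq
  have hι : ∀ x (y : W), inner ℂ (ι₁ x) y = inner ℂ x (π₁ y) := fun x y => by
    rw [hin, h11, h21, inner_zero_left, add_zero]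
  have hι' : ∀ x (y : W), inner ℂ y (ι₁ x) = inner ℂ (π₁ y) x := fun x y => by
    rw [hin, h11, h21, inner_zero_right, add_zero]
  -- Since ⟨x, p x⟩ = ‖P(x, 0)‖², a vector x killed by p makes (x, 0) orthogonal to the graph, whose
  -- first components run through the dense subspace A.
  have hinj : ∀ x, leftL2 τ p x = 0 → x = 0 := fun x hx => by
    have h0 : P (ι₁ x) = 0 := by
      rw [← inner_self_eq_zero (𝕜 := ℂ), hPs]
      have : P (P (ι₁ x)) = P (ι₁ x) :=
        Submodule.starProjection_eq_self_iff.2 (K.starProjection_apply_mem _)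
      rw [this, hι, hp', hx, inner_zero_right]
    refine L2A_ext_inner τ fun a => ?_
    rw [inner_zero_right]
    have h1 : inner ℂ (G a) (ι₁ x) = inner ℂ (toL2A τ a) x := by
      rw [hι', hG, map_add, h11, h12, add_zero]
    rw [← h1, ← Submodule.starProjection_eq_self_iff.2 (hGK a)]
    change inner ℂ (P (G a)) (ι₁ x) = 0
    rw [hPs, h0, inner_zero_right]
  have hps : star p = p := leftL2_injective τ <| by
    rw [← adjoint_leftL2]
    refine (ContinuousLinearMap.eq_adjoint_iff _ _).2 (fun x y => ?_) |>.symm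
    rw [← hp', ← hp', ← hι', hPs, hι]
  refine ⟨p, q, hps, hinj, fun x hx => ?_, ?_⟩
  -- As p is self-adjoint, J turns right multiplication by p into left multiplication by p.
  · have := conjL2_act τ p x
    rw [hx, conjL2_zero, hps] at this
    rw [← conjL2_conjL2 τ x, hinj _ this.symm, conjL2_zero]
  · refine L2A_ext_inner τ fun b => ?_
    -- The relation π₂ w = ξ · π₁ w is stated weakly, in a form continuous in w, so that it passes
    -- to the closure of the graph without discussing closability. On the graph both sides equal ⟨b,
    -- ξ a⟩.
    have key : ∀ w ∈ K, inner ℂ (leftL2 τ b (conjL2 τ (π₁ w))) ξ = inner ℂ (toL2A τ b) (π₂ w) := by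
      refine hind (isClosed_eq ?_ ?_) fun a => ?_
      · have := (leftL2 τ b).continuous.comp ((continuous_conjL2 τ).comp π₁.continuous)
        exact this.inner continuous_const
      · exact continuous_const.inner π₂.continuous
      · rw [hG, map_add, map_add, h11, h12, h21, h22, add_zero, zero_add, conjL2_toL2A,
          leftL2_toL2A, ← act_toL2A, inner_act_left, star_star]
    have := key _ (K.starProjection_apply_mem (ι₁ (toL2A τ 1)))
    change inner ℂ (leftL2 τ b (conjL2 τ (π₁ (P _)))) ξ = inner ℂ (toL2A τ b) (π₂ (P _)) at this
    rw [hp', hq', leftL2_toL2A, leftL2_toL2A, mul_one, mul_one, conjL2_toL2A, leftL2_toL2A,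
      ← act_toL2A, inner_act_left, star_star] at this
    exact this

/-- This is the right denominator of Jξ, read through J. -/
theorem exists_left_denominator (hK : IsLeftFull τ) (ξ : L2A τ) : ∃ c q : A,
    (∀ x, leftL2 τ c x = 0 → x = 0) ∧ leftL2 τ c ξ = toL2A τ q := by
  obtain ⟨c, q, hc, hinj, -, h⟩ := exists_right_denominator hK (conjL2 τ ξ)
  refine ⟨c, star q, hinj, ?_⟩
  have := congrArg (conjL2 τ) h
  rwa [conjL2_act, conjL2_conjL2, conjL2_toL2A, hc] at this

/-- Everywhere defined right `A`-linear maps on `l²(A)` are bounded. -/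
theorem continuous_of_right_linear (hK : IsLeftFull τ) (t : L2A τ →ₗ[ℂ] L2A τ)
    (ht : ∀ b x, t ((L2A τ).act (op b) x) = (L2A τ).act (op b) (t x)) : Continuous t := by
  obtain ⟨c, q, hc, hq⟩ := exists_left_denominator hK (t (toL2A τ 1))
  -- If x d = b lies in A, then right linearity gives (c t(x)) d = c t(1) b = q b = (q x) d, and d
  -- can be cancelled.
  have key : ∀ x, leftL2 τ c (t x) = leftL2 τ q x := fun x => by
    obtain ⟨d, b, -, -, hd, hb⟩ := exists_right_denominator hK x
    rw [← sub_eq_zero]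
    refine hd _ ?_
    have e : toL2A τ b = (L2A τ).act (op b) (toL2A τ 1) := by rw [act_toL2A, one_mul]
    rw [map_sub, sub_eq_zero, ← leftL2_act, ← leftL2_act, ← ht, hb, leftL2_toL2A, e, ht,
      leftL2_act, hq, act_toL2A]
  -- The graph is closed: c ∘ t is the bounded operator q, and c is injective.
  refine t.continuous_of_seq_closed_graph fun u x y hu hy => ?_
  rw [← sub_eq_zero]
  refine hc _ ?_
  rw [map_sub, sub_eq_zero, key]
  refine tendsto_nhds_unique (((leftL2 τ c).continuous.tendsto y).comp hy) ?_
  simp only [Function.comp_def, key]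
  exact ((leftL2 τ q).continuous.tendsto x).comp hu

end Affiliated

/-! ### Morphisms of Hilbert modules from adjoint pairs -/

namespace HilbMod

variable {A : Type u} [CStarAlgebra A] [PartialOrder A] [StarOrderedRing A] {V W : HilbMod A}

theorem inn_sub_left (v₁ v₂ w : V) : V.inn (v₁ - v₂) w = V.inn v₁ w - V.inn v₂ w := by
  rw [eq_sub_iff_add_eq, ← V.inn_add_left, sub_add_cancel]

theorem ext_inn_left {w₁ w₂ : V} (h : ∀ v, V.inn w₁ v = V.inn w₂ v) : w₁ = w₂ :=
  V.ext_inn fun v => by rw [← V.star_inn, h, V.star_inn]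

theorem tendsto_inn_left {v : ℕ → V} {v₀ : V} (h : Filter.Tendsto v Filter.atTop (nhds v₀))
    (w : V) : Filter.Tendsto (fun n => V.inn (v n) w) Filter.atTop (nhds (V.inn v₀ w)) := by
  rw [tendsto_iff_norm_sub_tendsto_zero] at h ⊢
  refine squeeze_zero (fun n => norm_nonneg _) (fun n => ?_) (g := fun n => ‖v n - v₀‖ * ‖w‖)
    (by simpa using h.mul_const ‖w‖)
  rw [← inn_sub_left]
  exact norm_inn_le _ _

/-- A map with an adjoint is a morphism. -/
def homMk (f : V → W) (g : W → V) (h : ∀ v w, W.inn (f v) w = V.inn v (g w)) : V ⟶ W :=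
  let f' : V →ₗ[ℂ] W :=
    { toFun := f
      map_add' := fun x y => ext_inn_left fun w => by
        rw [h, V.inn_add_left, W.inn_add_left, h, h]
      map_smul' := fun z x => ext_inn_left fun w => by
        rw [h, V.inn_csmul_left, RingHom.id_apply, W.inn_csmul_left, h] }
  -- As in the Hellinger–Toeplitz theorem, the adjoint identity makes the graph closed.
  ⟨⟨f', f'.continuous_of_seq_closed_graph fun v v₀ y hv hy => ext_inn_left fun w => by
      refine tendsto_nhds_unique (tendsto_inn_left hy w) ?_
      change Filter.Tendsto (fun n => W.inn (f (v n)) w) _ (nhds (W.inn (f v₀) w))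
      simp only [h]
      exact tendsto_inn_left hv _⟩, fun a v => ext_inn_left fun w => by
        change W.inn (f (op a • v)) w = W.inn (op a • f v) w
        rw [h, V.inn_smul_left, W.inn_smul_left, h], g, h⟩

/-- A surjective map preserving the inner products is an isomorphism. -/
def isoMk (f : V → W) (h : ∀ v w, W.inn (f v) (f w) = V.inn v w) (hs : Function.Surjective f) :
    V ≅ W where
  hom := homMk f (Function.surjInv hs) fun v w => by rw [← h, Function.surjInv_eq hs]
  inv := homMk (Function.surjInv hs) f fun v w => by rw [← h, Function.surjInv_eq hs]
  hom_inv_id := hom_ext fun v => V.ext_inn fun w => by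
    change V.inn w (Function.surjInv hs (f v)) = V.inn w v
    rw [← h, Function.surjInv_eq hs, h]
  inv_hom_id := hom_ext fun v => Function.surjInv_eq hs v

theorem norm_smul_le (v : V) (a : A) : ‖op a • v‖ ≤ ‖v‖ * ‖a‖ := by
  refine (sq_le_sq₀ (norm_nonneg _) (by positivity)).1 ?_
  rw [V.norm_sq, V.inn_smul_left, V.inn_smul_right, mul_pow, V.norm_sq]
  calc _ ≤ ‖star a‖ * (‖V.inn v v‖ * ‖a‖) :=
        (norm_mul_le _ _).trans (mul_le_mul_of_nonneg_left (norm_mul_le _ _) (norm_nonneg _))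
    _ = _ := by rw [norm_star]; ring

/-- The morphism `a ↦ v a`. -/
def elem (v : V) : self A ⟶ V :=
  homMk (V := self A) (fun a : A => op a • v) (fun w => V.inn v w) fun (a : A) w => by
    rw [V.inn_smul_left]; rfl

end HilbMod

/-! ### Bounded operators into Hilbert sums -/

namespace Ell2

variable {I : Type*} {K K' : Type*} [NormedAddCommGroup K] [InnerProductSpace ℂ K]
  [NormedAddCommGroup K'] [InnerProductSpace ℂ K']

theorem ext_comp {x y : Ell2 I K} (h : ∀ i, comp i x = comp i y) : x = y :=
  lp.ext (funext h)

theorem sum_norm_comp_le (s : Finset I) (x : Ell2 I K) : ∑ i ∈ s, ‖comp i x‖ ^ 2 ≤ ‖x‖ ^ 2 := by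
  have := lp.sum_rpow_le_norm_rpow (p := 2) (E := fun _ : I => K) (by norm_num) x s
  simp only [ENNReal.toReal_ofNat, Real.rpow_ofNat] at this
  exact this

/-- The operator `x ↦ (Tᵢ x)ᵢ`. -/
def mkCol (T : I → K →L[ℂ] K') (C : ℝ) (hC : 0 ≤ C)
    (h : ∀ (s : Finset I) x, ∑ i ∈ s, ‖T i x‖ ^ 2 ≤ C ^ 2 * ‖x‖ ^ 2) : K →L[ℂ] Ell2 I K' :=
  LinearMap.mkContinuous
    { toFun := fun x => (⟨fun i => T i x, memℓp_gen' (C := C ^ 2 * ‖x‖ ^ 2) fun s => by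
        simpa using h s x⟩ : lp (fun _ : I => K') 2)
      map_add' := fun x y => ext_comp fun i => map_add (T i) x y
      map_smul' := fun z x => ext_comp fun i => map_smul (T i) z x } C fun x => by
    refine lp.norm_le_of_forall_sum_le (p := 2) (by norm_num) (by positivity) fun s => ?_
    have := h s x
    rw [← mul_pow] at this
    simp only [ENNReal.toReal_ofNat, Real.rpow_ofNat]
    exact this

open Classical in
/-- The inclusion of the `k`-th summand. -/
def single (k : I) : K →L[ℂ] Ell2 I K :=
  mkCol (fun i => if i = k then ContinuousLinearMap.id ℂ K else 0) 1 zero_le_one fun s x => by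
    calc _ = ∑ i ∈ s, if i = k then ‖x‖ ^ 2 else 0 := by
          refine Finset.sum_congr rfl fun i _ => ?_
          split_ifs <;> simp
      _ ≤ _ := by
        rw [Finset.sum_ite_eq']
        split_ifs
        · simp
        · positivity

open Classical in
theorem comp_single (i k : I) (x : K) : comp i (single k x) = if i = k then x else 0 := by
  change (if i = k then ContinuousLinearMap.id ℂ K else 0) x = _
  split_ifs <;> rfl

theorem comp_single_self (k : I) (x : K) : comp k (single k x) = x := by
  rw [comp_single, if_pos rfl]

theorem inner_single (k : I) (x : K) (y : Ell2 I K) :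
    inner ℂ (single k x) y = inner ℂ x (comp k y) := by
  rw [inner_eq_tsum, tsum_eq_single k, comp_single_self]
  intro i hi
  rw [comp_single, if_neg hi, inner_zero_left]

theorem ext_inner_single {x y : Ell2 I K}
    (h : ∀ k z, inner ℂ (single k z) x = inner ℂ (single k z) y) : x = y :=
  ext_comp fun k => ext_inner_left ℂ fun z => by rw [← inner_single, h, inner_single]

theorem sum_single [Fintype I] (x : Ell2 I K) : ∑ k, single k (comp k x) = x := by
  refine ext_comp fun i => ?_
  rw [map_sum, Finset.sum_eq_single i, comp_single_self]
  · intro k _ hk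
    rw [comp_single, if_neg hk.symm]
  · exact fun h => absurd (Finset.mem_univ i) h

/-- Passing to adjoints replaces the density of the span of the summands by the fact that a vector
is determined by its components. -/
theorem clm_ext {E : Type*} [NormedAddCommGroup E] [InnerProductSpace ℂ E] [CompleteSpace E]
    [CompleteSpace K] {S T : Ell2 I K →L[ℂ] E} (h : ∀ k x, S (single k x) = T (single k x)) :
    S = T := by
  rw [← ContinuousLinearMap.adjoint_adjoint S, ← ContinuousLinearMap.adjoint_adjoint T]
  congr 1
  refine ContinuousLinearMap.ext fun y => ext_inner_single fun k z => ?_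
  rw [ContinuousLinearMap.adjoint_inner_right, ContinuousLinearMap.adjoint_inner_right, h]

end Ell2

/-! ### Bounded vectors -/

section Bounded

variable {A : Type u} [CStarAlgebra A] [PartialOrder A] [StarOrderedRing A] {τ : FTrace A}

namespace HilbSp

variable {X Y Z : HilbSp A}

theorem map_act (f : X ⟶ Y) (a : A) (x : X) :
    Hom.op f (X.act (op a) x) = Y.act (op a) (Hom.op f x) := f.2 (op a) x

theorem norm_act_le (x : X) (a : A) : ‖X.act (op a) x‖ ≤ ‖x‖ * ‖a‖ := by
  have h : ‖X.act (op a)‖ ≤ ‖op a‖ := NonUnitalStarAlgHom.norm_apply_le X.act (op a)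
  rw [mul_comm]
  exact ContinuousLinearMap.le_of_opNorm_le _ h x

/-- The adjoint of a morphism. -/
def adj (f : X ⟶ Y) : Y ⟶ X := ⟨adjoint (Hom.op f), fun a y => by
  obtain ⟨a, rfl⟩ := MulOpposite.op_surjective a
  refine ext_inner_left ℂ fun x => ?_
  rw [ContinuousLinearMap.adjoint_inner_right, ← star_star a, ← inner_act_left, ← inner_act_left,
    ← map_act, ContinuousLinearMap.adjoint_inner_right]⟩

theorem inner_adj (f : X ⟶ Y) (x : X) (y : Y) :
    inner ℂ x (Hom.op (adj f) y) = inner ℂ (Hom.op f x) y :=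
  ContinuousLinearMap.adjoint_inner_right _ _ _

@[simp] theorem op_add (f g : X ⟶ Y) : Hom.op (f + g) = Hom.op f + Hom.op g := rfl

@[simp] theorem op_smul (z : ℂ) (f : X ⟶ Y) : Hom.op (z • f) = z • Hom.op f := rfl

theorem isClosed_intertwiners (X Y : HilbSp A) :
    IsClosed (intertwiners X Y : Set (X →L[ℂ] Y)) := by
  have : (intertwiners X Y : Set (X →L[ℂ] Y)) =
      ⋂ (a : Aᵐᵒᵖ) (x : X), {f | f (X.act a x) = Y.act a (f x)} := by
    ext f
    simp only [Set.mem_iInter]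
    rfl
  rw [this]
  refine isClosed_iInter fun a => isClosed_iInter fun x => isClosed_eq ?_ ?_
  · fun_prop
  · fun_prop

instance (X Y : HilbSp A) : CompleteSpace (X ⟶ Y) :=
  (isClosed_intertwiners X Y).completeSpace_coe

theorem isometric_iff_inner (f : X ⟶ Y) (hf : ∀ x, ‖Hom.op f x‖ = ‖x‖) (x y : X) :
    inner ℂ (Hom.op f x) (Hom.op f y) = inner ℂ x y :=
  (LinearIsometry.inner_map_map ⟨(Hom.op f).toLinearMap, hf⟩ x y)

end HilbSp

/-- Left multiplication by `a` as an endomorphism of the right module `l²(A)`. -/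
def leftEnd (τ : FTrace A) (a : A) : L2A τ ⟶ L2A τ := l2Map τ (HilbMod.leftMul a)

/-- The vector 1 generates l²(A) topologically as a right module; the module axioms below are
therefore checked at 1 only. -/
theorem L2A_hom_ext {X : HilbSp A} {S T : L2A τ ⟶ X}
    (h : HilbSp.Hom.op S (toL2A τ 1) = HilbSp.Hom.op T (toL2A τ 1)) : S = T :=
  l2_hom_ext τ fun (a : A) => by
    have e : toL2 τ (HilbMod.self A) a = (L2A τ).act (op a) (toL2A τ 1) := by
      rw [act_toL2A, one_mul]
      rfl
    rw [e, HilbSp.map_act, HilbSp.map_act, h]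

/-- Precomposition with left multiplication by a corresponds, under T ↦ T(1), to the right action of
a on X. -/
instance {X : HilbSp A} : SMul Aᵐᵒᵖ (L2A τ ⟶ X) where
  smul a T := leftEnd τ a.unop ≫ T

theorem op_smul_hom {X : HilbSp A} (a : A) (T : L2A τ ⟶ X) (x : L2A τ) :
    HilbSp.Hom.op (op a • T) x = HilbSp.Hom.op T (leftL2 τ a x) := rfl

theorem op_smul_hom_one {X : HilbSp A} (a : A) (T : L2A τ ⟶ X) :
    HilbSp.Hom.op (op a • T) (toL2A τ 1) = X.act (op a) (HilbSp.Hom.op T (toL2A τ 1)) := by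
  rw [op_smul_hom, leftL2_toL2A, ← HilbSp.map_act, act_toL2A, mul_one, one_mul]

instance {X : HilbSp A} : Module Aᵐᵒᵖ (L2A τ ⟶ X) where
  one_smul T := L2A_hom_ext <| by
    rw [← MulOpposite.op_one, op_smul_hom_one, MulOpposite.op_one, map_one, one_apply_eq_self]
  mul_smul a b T := L2A_hom_ext <| by
    obtain ⟨a, rfl⟩ := MulOpposite.op_surjective a
    obtain ⟨b, rfl⟩ := MulOpposite.op_surjective b
    rw [op_smul_hom_one, ← MulOpposite.op_mul, op_smul_hom_one, op_smul_hom_one,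
      MulOpposite.op_mul, map_mul, mul_apply_eq_comp]
  smul_zero a := L2A_hom_ext <| by
    obtain ⟨a, rfl⟩ := MulOpposite.op_surjective a
    rw [op_smul_hom_one]
    exact map_zero _
  smul_add a S T := L2A_hom_ext <| by
    obtain ⟨a, rfl⟩ := MulOpposite.op_surjective a
    rw [op_smul_hom_one, HilbSp.op_add, HilbSp.op_add, add_apply, add_apply, map_add,
      op_smul_hom_one, op_smul_hom_one]
  add_smul a b T := L2A_hom_ext <| by
    obtain ⟨a, rfl⟩ := MulOpposite.op_surjective a
    obtain ⟨b, rfl⟩ := MulOpposite.op_surjective b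
    rw [HilbSp.op_add, add_apply, ← MulOpposite.op_add, op_smul_hom_one, op_smul_hom_one,
      op_smul_hom_one, MulOpposite.op_add, map_add, add_apply]
  zero_smul T := L2A_hom_ext <| by
    rw [← MulOpposite.op_zero, op_smul_hom_one, MulOpposite.op_zero, map_zero]
    rfl

instance {X : HilbSp A} : IsScalarTower ℂ Aᵐᵒᵖ (L2A τ ⟶ X) where
  smul_assoc z a T := L2A_hom_ext <| by
    obtain ⟨a, rfl⟩ := MulOpposite.op_surjective a
    rw [HilbSp.op_smul, smul_apply, ← MulOpposite.op_smul, op_smul_hom_one, op_smul_hom_one,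
      MulOpposite.op_smul, map_smul, smul_apply]

/-- The operator S*T on l²(A) commutes with the right action because S and T do. -/
theorem exists_boundedInn (hK : IsLeftFull τ) {X : HilbSp A} (S T : L2A τ ⟶ X) :
    ∃ a, adjoint (HilbSp.Hom.op S) ∘L HilbSp.Hom.op T = leftL2 τ a :=
  hK _ fun b => (T ≫ HilbSp.adj S).2 (op b)

/-- The element `S* T` of `A`. -/
def boundedInn (hK : IsLeftFull τ) {X : HilbSp A} (S T : L2A τ ⟶ X) : A :=
  (exists_boundedInn hK S T).choose

theorem inner_leftL2_boundedInn (hK : IsLeftFull τ) {X : HilbSp A} (S T : L2A τ ⟶ X)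
    (x y : L2A τ) : inner ℂ x (leftL2 τ (boundedInn hK S T) y) =
      inner ℂ (HilbSp.Hom.op S x) (HilbSp.Hom.op T y) := by
  rw [boundedInn, ← (exists_boundedInn hK S T).choose_spec, ContinuousLinearMap.comp_apply,
    ContinuousLinearMap.adjoint_inner_right]

theorem eq_of_inner_leftL2 {a b : A}
    (h : ∀ x y, inner ℂ x (leftL2 τ a y) = inner ℂ x (leftL2 τ b y)) : a = b :=
  leftL2_injective τ (ContinuousLinearMap.ext fun y => ext_inner_left ℂ fun x => h x y)

theorem eq_boundedInn (hK : IsLeftFull τ) {X : HilbSp A} {S T : L2A τ ⟶ X} {a : A}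
    (h : ∀ x y, inner ℂ (HilbSp.Hom.op S x) (HilbSp.Hom.op T y) = inner ℂ x (leftL2 τ a y)) :
    boundedInn hK S T = a :=
  eq_of_inner_leftL2 fun x y => by rw [inner_leftL2_boundedInn, h]

/-- The Hilbert `A`-module `A(X)` of bounded vectors of `X`, that is, of bounded `A`-linear
operators `l²(A) → X`, with `⟨S, T⟩ = S* T`. -/
def bounded (hK : IsLeftFull τ) (X : HilbSp A) : HilbMod A where
  carrier := L2A τ ⟶ X
  inn := boundedInn hK
  inn_smul_right S T a := eq_boundedInn hK fun x y => by
    rw [op_smul_hom, ← inner_leftL2_boundedInn hK, leftL2_mul]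
    rfl
  inn_add_left S S' T := eq_boundedInn hK fun x y => by
    rw [HilbSp.op_add, add_apply, inner_add_left, ← inner_leftL2_boundedInn hK,
      ← inner_leftL2_boundedInn hK, ← inner_add_right, ← leftHom_apply, ← leftHom_apply,
      ← leftHom_apply, map_add, add_apply]
  star_inn S T := (eq_boundedInn hK fun x y => by
    rw [← adjoint_leftL2, ContinuousLinearMap.adjoint_inner_right, ← inner_conj_symm,
      ← inner_leftL2_boundedInn hK, inner_conj_symm]).symm
  inn_self_nonneg S := nonneg_of_starAlgHom (leftHom τ) (leftL2_injective τ) <| by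
    rw [leftHom_apply, boundedInn, ← (exists_boundedInn hK S S).choose_spec,
      ContinuousLinearMap.nonneg_iff_isPositive]
    exact ContinuousLinearMap.isPositive_adjoint_comp_self _
  inn_self_eq_zero S := by
    rw [← (leftL2_injective τ).eq_iff, boundedInn, ← (exists_boundedInn hK S S).choose_spec,
      ← leftHom_apply τ 0, map_zero, ← norm_eq_zero, ContinuousLinearMap.norm_adjoint_comp_self,
      mul_self_eq_zero, norm_eq_zero]
    exact Submodule.coe_eq_zero
  norm_eq S := by
    rw [← norm_leftL2 τ, boundedInn, ← (exists_boundedInn hK S S).choose_spec,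
      ContinuousLinearMap.norm_adjoint_comp_self, Real.sqrt_mul_self (norm_nonneg _)]
    rfl

variable (hK : IsLeftFull τ)

/-- Composition with a morphism, as a morphism of the modules of bounded vectors. -/
def boundedMap {X Y : HilbSp A} (f : X ⟶ Y) : bounded hK X ⟶ bounded hK Y :=
  HilbMod.homMk (V := bounded hK X) (W := bounded hK Y) (fun T : L2A τ ⟶ X => T ≫ f)
    (fun T : L2A τ ⟶ Y => T ≫ HilbSp.adj f) fun (S : L2A τ ⟶ X) (T : L2A τ ⟶ Y) =>
      eq_boundedInn hK fun x y => by
        rw [HilbSp.op_comp, ← HilbSp.inner_adj, ← HilbSp.op_comp, ← inner_leftL2_boundedInn hK]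
        rfl

/-- The functor `X ↦ A(X)`. -/
def boundedFunctor : HilbSp A ⥤ HilbMod A where
  obj := bounded hK
  map := boundedMap hK
  map_id X := HilbMod.hom_ext fun (T : L2A τ ⟶ X) => Category.comp_id T
  map_comp f g := HilbMod.hom_ext fun (T : L2A τ ⟶ _) => (Category.assoc T f g).symm

/-- `f ↦ A(f)` as a bounded linear map. -/
def boundedMapL (X Y : HilbSp A) : (X ⟶ Y) →L[ℂ] (bounded hK X ⟶ bounded hK Y) :=
  LinearMap.mkContinuous
    { toFun := boundedMap hK
      map_add' := fun f g => HilbMod.hom_ext fun (T : L2A τ ⟶ X) => rfl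
      map_smul' := fun z f => HilbMod.hom_ext fun (T : L2A τ ⟶ X) => rfl } 1 fun f => by
    rw [one_mul]
    refine ContinuousLinearMap.opNorm_le_bound _ (norm_nonneg _) fun T => ?_
    exact ContinuousLinearMap.opNorm_comp_le (HilbSp.Hom.op f) (HilbSp.Hom.op (X := L2A τ) T)

theorem boundedMap_isometric {X Y : HilbSp A} (f : X ⟶ Y) (hf : ∀ x, ‖HilbSp.Hom.op f x‖ = ‖x‖)
    (S T : bounded hK X) : (bounded hK Y).inn (HilbMod.Hom.op (boundedMap hK f) S)
      (HilbMod.Hom.op (boundedMap hK f) T) = (bounded hK X).inn S T :=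
  eq_boundedInn hK fun x y => by
    refine (HilbSp.isometric_iff_inner f hf _ _).trans ?_
    exact (inner_leftL2_boundedInn hK _ _ _ _).symm

end Bounded

/-! ### The unit and the counit -/

section Counit

variable {A : Type u} [CStarAlgebra A] [PartialOrder A] [StarOrderedRing A] {τ : FTrace A}

/-- The extension to `l²(V)` of a linear map on `V` preserving the scalar products. -/
def l2Extend {V : HilbMod A} {K : Type*} [NormedAddCommGroup K] [InnerProductSpace ℂ K]
    [CompleteSpace K] (f : V →ₗ[ℂ] K) (hf : ∀ v, ‖f v‖ ^ 2 = (τ (V.inn v v)).re) :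
    l2Obj τ V →ₗᵢ[ℂ] K where
  toLinearMap := (f.extendOfNorm (toL2 τ V)).toLinearMap
  norm_map' x := by
    have h : ∀ v, ‖f v‖ = ‖toL2 τ V v‖ := fun v =>
      (sq_eq_sq₀ (norm_nonneg _) (norm_nonneg _)).1 ((hf v).trans (norm_toL2_sq τ V v).symm)
    refine (denseRange_toL2 τ V).induction_on
      (p := fun x => ‖f.extendOfNorm (toL2 τ V) x‖ = ‖x‖) x
      (isClosed_eq (by fun_prop) (by fun_prop)) fun v => ?_
    rw [LinearMap.extendOfNorm_eq (denseRange_toL2 τ V) ⟨1, fun v => by rw [h, one_mul]⟩, h]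

theorem l2Extend_toL2 {V : HilbMod A} {K : Type*} [NormedAddCommGroup K] [InnerProductSpace ℂ K]
    [CompleteSpace K] (f : V →ₗ[ℂ] K) (hf : ∀ v, ‖f v‖ ^ 2 = (τ (V.inn v v)).re) (v : V) :
    l2Extend f hf (toL2 τ V v) = f v := by
  have h : ∀ v, ‖f v‖ = ‖toL2 τ V v‖ := fun v =>
    (sq_eq_sq₀ (norm_nonneg _) (norm_nonneg _)).1 ((hf v).trans (norm_toL2_sq τ V v).symm)
  exact LinearMap.extendOfNorm_eq (denseRange_toL2 τ V) ⟨1, fun v => by rw [h, one_mul]⟩ v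

variable (hK : IsLeftFull τ)

/-- The map `T ↦ T 1` from `A(X)` to `X`. -/
def evalOne (X : HilbSp A) : bounded hK X →ₗ[ℂ] X where
  toFun T := HilbSp.Hom.op (X := L2A τ) T (toL2A τ 1)
  map_add' _ _ := rfl
  map_smul' _ _ := rfl

/-- Both sides are ⟨1, S*T 1⟩ with S = T, as τ is the vector state of 1 in l²(A). -/
theorem norm_sq_hom_one {X : HilbSp A} (T : L2A τ ⟶ X) :
    ‖HilbSp.Hom.op T (toL2A τ 1)‖ ^ 2 = (τ (boundedInn hK T T)).re := by
  rw [← inner_self_eq_norm_sq (𝕜 := ℂ), ← inner_leftL2_boundedInn hK, leftL2_toL2A, inner_toL2A,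
    star_one, one_mul, mul_one]
  rfl

theorem norm_evalOne (X : HilbSp A) (T : bounded hK X) :
    ‖evalOne hK X T‖ ^ 2 = (τ ((bounded hK X).inn T T)).re :=
  norm_sq_hom_one hK (X := X) T

/-- The canonical morphism `l²(A(X)) → X`. -/
def counit (X : HilbSp A) : l2Obj τ (bounded hK X) ⟶ X :=
  ⟨(l2Extend (evalOne hK X) (norm_evalOne hK X)).toContinuousLinearMap, fun a x => by
    obtain ⟨a, rfl⟩ := MulOpposite.op_surjective a
    refine (denseRange_toL2 τ (bounded hK X)).induction_on (p := fun x =>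
      l2Extend (evalOne hK X) (norm_evalOne hK X) ((l2Obj τ (bounded hK X)).act (op a) x) =
        X.act (op a) (l2Extend (evalOne hK X) (norm_evalOne hK X) x)) x
      (isClosed_eq (by fun_prop) (by fun_prop)) fun T => ?_
    rw [act_toL2, l2Extend_toL2, l2Extend_toL2]
    exact op_smul_hom_one a (X := X) T⟩

theorem counit_toL2 (X : HilbSp A) (T : L2A τ ⟶ X) :
    HilbSp.Hom.op (counit hK X) (toL2 τ (bounded hK X) T) = HilbSp.Hom.op T (toL2A τ 1) :=
  l2Extend_toL2 _ (norm_evalOne hK X) _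

theorem norm_counit (X : HilbSp A) (x : l2Obj τ (bounded hK X)) :
    ‖HilbSp.Hom.op (counit hK X) x‖ = ‖x‖ :=
  (l2Extend (evalOne hK X) (norm_evalOne hK X)).norm_map x

/-- The bounded vectors are dense in `X`. -/
def HasDenseBounded (τ : FTrace A) (X : HilbSp A) : Prop :=
  DenseRange fun T : L2A τ ⟶ X => HilbSp.Hom.op T (toL2A τ 1)

/-- The range of an isometry with complete domain is closed, and it contains the dense set of
bounded vectors. -/
theorem counit_surjective {X : HilbSp A} (hX : HasDenseBounded τ X) :
    Function.Surjective (HilbSp.Hom.op (counit hK X)) := by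
  have hcl : IsClosed (Set.range (HilbSp.Hom.op (counit hK X))) :=
    (AddMonoidHomClass.isometry_of_norm (HilbSp.Hom.op (counit hK X))
      (norm_counit hK X)).isClosedEmbedding.isClosed_range
  rw [← Set.range_eq_univ, ← hcl.closure_eq, ← dense_iff_closure_eq]
  refine hX.mono ?_
  rintro _ ⟨T, rfl⟩
  exact ⟨_, counit_toL2 hK X T⟩

/-- A surjective isometric morphism is an isomorphism. -/
def HilbSp.isoMk {X Y : HilbSp A} (f : X ⟶ Y) (hf : ∀ x, ‖HilbSp.Hom.op f x‖ = ‖x‖)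
    (hs : Function.Surjective (HilbSp.Hom.op f)) : X ≅ Y where
  hom := f
  inv := HilbSp.adj f
  hom_inv_id := HilbSp.hom_ext <| ContinuousLinearMap.ext fun x => ext_inner_left ℂ fun y => by
    rw [HilbSp.op_comp, HilbSp.inner_adj, HilbSp.isometric_iff_inner f hf, HilbSp.op_id]
  inv_hom_id := HilbSp.hom_ext <| ContinuousLinearMap.ext fun y => by
    obtain ⟨x, rfl⟩ := hs y
    have : HilbSp.Hom.op (HilbSp.adj f) (HilbSp.Hom.op f x) = x := ext_inner_left ℂ fun z => by
      rw [HilbSp.inner_adj, HilbSp.isometric_iff_inner f hf]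
    rw [HilbSp.op_comp, this, HilbSp.op_id]

/-- The isomorphism `l²(A(X)) ≅ X`. -/
def counitIso {X : HilbSp A} (hX : HasDenseBounded τ X) : l2Obj τ (bounded hK X) ≅ X :=
  HilbSp.isoMk (counit hK X) (norm_counit hK X) (counit_surjective hK hX)

theorem counit_naturality {X Y : HilbSp A} (f : X ⟶ Y) :
    l2Map τ (boundedMap hK f) ≫ counit hK Y = counit hK X ≫ f :=
  l2_hom_ext τ fun (T : L2A τ ⟶ X) => by
    rw [HilbSp.op_comp, HilbSp.op_comp]
    refine (congrArg (HilbSp.Hom.op (counit hK Y)) (l2Map_toL2 τ (boundedMap hK f) T)).trans ?_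
    exact (counit_toL2 hK Y (T ≫ f)).trans
      (congrArg (HilbSp.Hom.op f) (counit_toL2 hK X T)).symm

/-- The canonical map `V → A(l²(V))`. -/
def unitFun (V : HilbMod A) (v : V) : bounded hK (l2Obj τ V) := l2Map τ (HilbMod.elem v)

theorem unitFun_toL2A (V : HilbMod A) (v : V) (a : A) :
    HilbSp.Hom.op (X := L2A τ) (unitFun hK V v) (toL2A τ a) = toL2 τ V (op a • v) :=
  l2Map_toL2 τ (HilbMod.elem v) a

/-- Two elements of A agree when their coefficients on A in l²(A) do; here both coefficients are
τ(a* ⟨v, w⟩ b), the scalar product of va and wb. -/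
theorem inn_unitFun (V : HilbMod A) (v w : V) :
    (bounded hK (l2Obj τ V)).inn (unitFun hK V v) (unitFun hK V w) = V.inn v w := by
  refine leftL2_injective τ (L2A_ext τ fun b => L2A_ext_inner τ fun a => ?_)
  refine (inner_leftL2_boundedInn hK _ _ _ _).trans ?_
  rw [unitFun_toL2A, unitFun_toL2A, inner_toL2, leftL2_toL2A, inner_toL2A, V.inn_smul_left,
    V.inn_smul_right]

theorem unitFun_one (V : HilbMod A) (v : V) :
    HilbSp.Hom.op (X := L2A τ) (unitFun hK V v) (toL2A τ 1) = toL2 τ V v := by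
  rw [unitFun_toL2A, MulOpposite.op_one, one_smul]

/-- `V` consists of all bounded vectors of `l²(V)`. -/
def IsSelfDual (V : HilbMod A) : Prop := Function.Surjective (unitFun hK V)

/-- The isomorphism `V ≅ A(l²(V))`. -/
def unitIso {V : HilbMod A} (hV : IsSelfDual hK V) : V ≅ bounded hK (l2Obj τ V) :=
  HilbMod.isoMk (unitFun hK V) (inn_unitFun hK V) hV

theorem unit_naturality {V W : HilbMod A} (f : V ⟶ W) (v : V) :
    HilbMod.Hom.op (boundedMap hK (l2Map τ f)) (unitFun hK V v) =
      unitFun hK W (HilbMod.Hom.op f v) :=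
  L2A_hom_ext <| by
    rw [unitFun_one]
    refine Eq.trans ?_ (l2Map_toL2 τ f v)
    rw [← unitFun_one hK]
    rfl

theorem unit_counit (V : HilbMod A) (v : V) :
    HilbSp.Hom.op (counit hK (l2Obj τ V)) (toL2 τ _ (unitFun hK V v)) = toL2 τ V v :=
  (counit_toL2 hK _ _).trans (unitFun_one hK V v)

end Counit

/-! ### Free modules as modules of bounded vectors -/

section FreeModel

variable {A : Type u} [CStarAlgebra A] [PartialOrder A] [StarOrderedRing A]

/-- The Hilbert `A`-module `F`, with components `c`, is the module of bounded vectors of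
`ℓ²(I) ⊗ l²(A)`. -/
structure IsFreeModel (τ : FTrace A) {I : Type*} (F : HilbMod A) (c : F → I → A) : Prop where
  map_add : ∀ m m' k, c (m + m') k = c m k + c m' k
  map_smul : ∀ (z : ℂ) m k, c (z • m) k = z • c m k
  map_op_smul : ∀ a m k, c (op a • m) k = c m k * a
  exists_col : ∀ m, ∃ T : L2A τ →L[ℂ] Ell2 I (L2A τ), ∀ k x,
    Ell2.comp k (T x) = leftL2 τ (c m k) x
  hasSum_inn : ∀ m m' a b,
    HasSum (fun k => τ (star (c m k * a) * (c m' k * b))) (τ (star a * (F.inn m m' * b)))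
  exists_elem : ∀ T : L2A τ →L[ℂ] Ell2 I (L2A τ),
    (∀ k b x, Ell2.comp k (T ((L2A τ).act (op b) x)) = (L2A τ).act (op b) (Ell2.comp k (T x))) →
    ∃ m, ∀ k x, Ell2.comp k (T x) = leftL2 τ (c m k) x

variable {τ : FTrace A} {I : Type*}

namespace Emb

variable {X : HilbSp A} (i : Emb τ X I)

theorem coproj_emb (x : X) : i.coproj (i.emb x) = x :=
  ext_inner_left ℂ fun y => by
    rw [coproj, ContinuousLinearMap.adjoint_inner_right]
    exact i.emb.inner_map_map y x

theorem inner_coproj (x : X) (ξ : Ell2 I (L2A τ)) :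
    inner ℂ x (i.coproj ξ) = inner ℂ (i.emb x) ξ := by
  rw [coproj, ContinuousLinearMap.adjoint_inner_right]
  rfl

/-- The embedding is A-linear and the right action is closed under adjoints, so the adjoint of the
embedding is A-linear too. -/
theorem coproj_act {ξ η : Ell2 I (L2A τ)} {b : A}
    (h : ∀ k, Ell2.comp k η = (L2A τ).act (op b) (Ell2.comp k ξ)) :
    i.coproj η = X.act (op b) (i.coproj ξ) := ext_inner_left ℂ fun x => by
  rw [inner_coproj, ← star_star b, ← inner_act_left, inner_coproj, Ell2.inner_eq_tsum,
    Ell2.inner_eq_tsum]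
  refine tsum_congr fun k => ?_
  rw [h, i.map_act, inner_act_left, star_star]

/-- The composition of a right `A`-linear operator into `ℓ²(I) ⊗ l²(A)` with the projection. -/
def coprojHom {Y : HilbSp A} (T : Y →L[ℂ] Ell2 I (L2A τ))
    (hT : ∀ k b x, Ell2.comp k (T (Y.act (op b) x)) = (L2A τ).act (op b) (Ell2.comp k (T x))) :
    Y ⟶ X :=
  ⟨i.coproj ∘L T, fun b x => i.coproj_act fun k => hT k b.unop x⟩

@[simp] theorem op_coprojHom {Y : HilbSp A} (T : Y →L[ℂ] Ell2 I (L2A τ)) (hT) (y : Y) :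
    HilbSp.Hom.op (i.coprojHom T hT) y = i.coproj (T y) := rfl

theorem comp_single_act (k l : I) (b : A) (x : L2A τ) :
    Ell2.comp k (Ell2.single l ((L2A τ).act (op b) x)) =
      (L2A τ).act (op b) (Ell2.comp k (Ell2.single l x)) := by
  rw [Ell2.comp_single, Ell2.comp_single]
  split_ifs
  · rfl
  · rw [map_zero]

/-- Including l²(A) as the k-th summand and projecting to X gives bounded vectors. A vector
orthogonal to all of them and to their multiples by A has k-th component orthogonal to A, for every
k, hence is 0. -/
theorem hasDenseBounded (i : Emb τ X I) : HasDenseBounded τ X := by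
  let R : Submodule ℂ X := LinearMap.range
    ({ toFun := fun T => HilbSp.Hom.op T (toL2A τ 1)
       map_add' := fun _ _ => rfl
       map_smul' := fun _ _ => rfl } : (L2A τ ⟶ X) →ₗ[ℂ] X)
  have hR : Rᗮ = ⊥ := by
    refine (Submodule.eq_bot_iff _).2 fun x hx => ?_
    refine LinearIsometry.injective i.emb ((Ell2.ext_comp fun k => ?_).trans
      (map_zero i.emb).symm)
    refine L2A_ext_inner τ fun a => ?_
    rw [map_zero, inner_zero_right, ← Ell2.inner_single]
    let T : L2A τ ⟶ X := i.coprojHom (Ell2.single k) fun m b x => comp_single_act m k b x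
    have h : inner ℂ (HilbSp.Hom.op (op a • T) (toL2A τ 1)) x = 0 :=
      Submodule.inner_right_of_mem_orthogonal (K := R) ⟨op a • T, rfl⟩ hx
    rw [op_smul_hom, leftL2_toL2A, mul_one, op_coprojHom, ← inner_conj_symm, inner_coproj,
      inner_conj_symm] at h
    exact h
  have h2 : R.topologicalClosure = ⊤ := (Submodule.topologicalClosure_eq_top_iff).2 hR
  exact Submodule.dense_iff_topologicalClosure_eq_top.2 h2

/-- The matrix entries of the projection are right `A`-linear. -/
theorem exists_entry (hK : IsLeftFull τ) (k l : I) :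
    ∃ a, ∀ x, Ell2.comp k (i.proj (Ell2.single l x)) = leftL2 τ a x := by
  obtain ⟨a, ha⟩ := hK (Ell2.comp k ∘L i.proj ∘L Ell2.single l) fun b x => by
    simp only [ContinuousLinearMap.comp_apply, proj]
    rw [i.coproj_act fun m => comp_single_act m l b x]
    exact i.map_act _ _ _
  exact ⟨a, fun x => congrArg (fun T : _ →L[ℂ] _ => T x) ha⟩

/-- The entries of the projection commute with the right action, hence lie in A; the matrix
condition in the definition holds for every A-linear embedding. -/
theorem isMatrix (hK : IsLeftFull τ) {n : ℕ} (i : Emb τ X (Fin n)) : i.IsMatrix := by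
  choose p hp using i.exists_entry hK
  refine ⟨p, fun ξ k => ?_⟩
  conv_lhs => rw [← Ell2.sum_single ξ]
  rw [map_sum, map_sum]
  exact Finset.sum_congr rfl fun l _ => hp k l _

/-- Let S commute with all elementary operators and let Qₖ be the projection onto the k-th summand.
Then Qₖ and Qₘ p Qₖ are elementary, since the entries of p lie in A, and Qₘ S p Qₖ = S Qₘ p Qₖ = Qₘ
p Qₖ S = Qₘ p S Qₖ for all m and k, so S commutes with p. -/
theorem proj_mem_tensorVN (hK : IsLeftFull τ) : i.proj ∈ tensorVN τ I := by
  intro S hS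
  have hQ : ∀ k y, S (Ell2.single k (Ell2.comp k y)) = Ell2.single k (Ell2.comp k (S y)) := by
    intro k y
    have : (Ell2.single k ∘L Ell2.comp k : Ell2 I (L2A τ) →L[ℂ] _) ∈ elementary τ I :=
      ⟨k, k, 1, fun ξ m => by
        rw [ContinuousLinearMap.comp_apply, Ell2.comp_single, leftL2_one]
        rfl⟩
    exact (congrArg (fun T : _ →L[ℂ] _ => T y) (hS _ this)).symm
  have hE : ∀ m k y, S (Ell2.single m (Ell2.comp m (i.proj (Ell2.single k (Ell2.comp k y))))) =
      Ell2.single m (Ell2.comp m (i.proj (Ell2.single k (Ell2.comp k (S y))))) := by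
    intro m k y
    obtain ⟨a, ha⟩ := i.exists_entry hK m k
    have : (Ell2.single m ∘L Ell2.comp m ∘L i.proj ∘L Ell2.single k ∘L Ell2.comp k :
        Ell2 I (L2A τ) →L[ℂ] _) ∈ elementary τ I :=
      ⟨m, k, a, fun ξ m' => by
        simp only [ContinuousLinearMap.comp_apply]
        rw [Ell2.comp_single, ha]⟩
    exact (congrArg (fun T : _ →L[ℂ] _ => T y) (hS _ this)).symm
  refine Ell2.clm_ext fun k x => Ell2.ext_comp fun m => ?_
  change Ell2.comp m (S (i.proj (Ell2.single k x))) = Ell2.comp m (i.proj (S (Ell2.single k x)))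
  rw [← Ell2.comp_single_self m (Ell2.comp m (S (i.proj (Ell2.single k x)))), ← hQ]
  have h1 := hE m k (Ell2.single k x)
  have h2 := hQ k (Ell2.single k x)
  rw [Ell2.comp_single_self] at h1 h2
  rw [h1, ← h2, Ell2.comp_single_self]

end Emb

namespace IsFreeModel

variable {F : HilbMod A} {c : F → I → A} (hF : IsFreeModel τ F c)
include hF

/-- The operator `l²(A) → ℓ²(I) ⊗ l²(A)` given by an element of the free module. -/
def col (m : F) : L2A τ →L[ℂ] Ell2 I (L2A τ) := (hF.exists_col m).choose

theorem comp_col (m : F) (k : I) (x : L2A τ) :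
    Ell2.comp k (hF.col m x) = leftL2 τ (c m k) x := (hF.exists_col m).choose_spec k x

theorem col_act (m : F) (k : I) (b : A) (x : L2A τ) :
    Ell2.comp k (hF.col m ((L2A τ).act (op b) x)) =
      (L2A τ).act (op b) (Ell2.comp k (hF.col m x)) := by
  rw [comp_col, comp_col, leftL2_act]

theorem comp_col_one (m : F) (k : I) :
    Ell2.comp k (hF.col m (toL2A τ 1)) = toL2A τ (c m k) := by
  rw [comp_col, leftL2_toL2A, mul_one]

/-- For x and y in A this is the field `hasSum_inn`; both sides are continuous and A is dense in
l²(A). -/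
theorem inner_col (m m' : F) (x y : L2A τ) :
    inner ℂ (hF.col m x) (hF.col m' y) = inner ℂ x (leftL2 τ (F.inn m m') y) := by
  induction x using L2A_induction with
  | hp => exact isClosed_eq (by fun_prop) (by fun_prop)
  | h a =>
    induction y using L2A_induction with
    | hp => exact isClosed_eq (by fun_prop) (by fun_prop)
    | h b =>
      rw [Ell2.inner_eq_tsum, leftL2_toL2A, inner_toL2A, ← (hF.hasSum_inn m m' a b).tsum_eq]
      refine tsum_congr fun k => ?_
      rw [comp_col, comp_col, leftL2_toL2A, leftL2_toL2A, inner_toL2A]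

theorem eq_col {m : F} {S T : L2A τ →L[ℂ] Ell2 I (L2A τ)}
    (hS : ∀ k x, Ell2.comp k (S x) = leftL2 τ (c m k) x)
    (hT : ∀ k x, Ell2.comp k (T x) = leftL2 τ (c m k) x) : S = T :=
  ContinuousLinearMap.ext fun x => Ell2.ext_comp fun k => by rw [hS, hT]

theorem exists_eq_col {T : L2A τ →L[ℂ] Ell2 I (L2A τ)}
    (hT : ∀ k b x, Ell2.comp k (T ((L2A τ).act (op b) x)) =
      (L2A τ).act (op b) (Ell2.comp k (T x))) : ∃ m, hF.col m = T := by
  obtain ⟨m, hm⟩ := hF.exists_elem T hT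
  exact ⟨m, hF.eq_col (hF.comp_col m) hm⟩

/-- The inclusion of the free module into `ℓ²(I) ⊗ l²(A)`. -/
def incl : F →ₗ[ℂ] Ell2 I (L2A τ) where
  toFun m := hF.col m (toL2A τ 1)
  map_add' m m' := Ell2.ext_comp fun k => by
    rw [comp_col_one, _root_.map_add, comp_col_one, comp_col_one, hF.map_add, _root_.map_add]
  map_smul' z m := Ell2.ext_comp fun k => by
    rw [comp_col_one, _root_.map_smul, comp_col_one, hF.map_smul, _root_.map_smul,
      RingHom.id_apply]

theorem norm_incl (m : F) : ‖hF.incl m‖ ^ 2 = (τ (F.inn m m)).re := by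
  rw [← inner_self_eq_norm_sq (𝕜 := ℂ)]
  change RCLike.re (inner ℂ (hF.col m (toL2A τ 1)) (hF.col m (toL2A τ 1))) = _
  rw [inner_col, leftL2_toL2A, inner_toL2A, star_one, one_mul, mul_one]
  rfl

/-- The isometry `l²(F) → ℓ²(I) ⊗ l²(A)`. -/
def l2Incl : l2Obj τ F →ₗᵢ[ℂ] Ell2 I (L2A τ) := l2Extend hF.incl hF.norm_incl

theorem l2Incl_toL2 (m : F) : hF.l2Incl (toL2 τ F m) = hF.col m (toL2A τ 1) :=
  l2Extend_toL2 hF.incl hF.norm_incl m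

theorem comp_l2Incl_act (k : I) (a : A) (x : l2Obj τ F) :
    Ell2.comp k (hF.l2Incl ((l2Obj τ F).act (op a) x)) =
      (L2A τ).act (op a) (Ell2.comp k (hF.l2Incl x)) := by
  refine (denseRange_toL2 τ F).induction_on (p := fun x =>
    Ell2.comp k (hF.l2Incl ((l2Obj τ F).act (op a) x)) =
      (L2A τ).act (op a) (Ell2.comp k (hF.l2Incl x))) x
    (isClosed_eq (by fun_prop) (by fun_prop)) fun m => ?_
  rw [act_toL2, l2Incl_toL2, l2Incl_toL2, comp_col_one, comp_col_one, hF.map_op_smul, act_toL2A]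

/-- The embedding of `l²(V)` for a direct summand `V` of a free module. -/
def embOfSummand {V : HilbMod A} {j : V ⟶ F} {p : F ⟶ V} (hjp : HilbMod.IsAdjoint j p)
    (h : j ≫ p = 𝟙 V) : Emb τ (l2Obj τ V) I where
  emb := hF.l2Incl.comp ⟨(HilbSp.Hom.op (l2Map τ j)).toLinearMap,
    norm_l2Map_of_isometric τ j fun v w => by
      rw [hjp, ← HilbMod.op_comp, h, HilbMod.op_id]⟩
  map_act a x k := by
    obtain ⟨a, rfl⟩ := MulOpposite.op_surjective a
    change Ell2.comp k (hF.l2Incl (HilbSp.Hom.op (l2Map τ j) _)) = (L2A τ).act (op a)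
      (Ell2.comp k (hF.l2Incl (HilbSp.Hom.op (l2Map τ j) _)))
    rw [HilbSp.map_act, comp_l2Incl_act]

/-- A bounded A-linear operator from l²(A) to l²(V), followed by the embedding, is a column with
entries in A, hence an element m of F. The image of m under the projection F → V represents the
operator. -/
theorem isSelfDual (hK : IsLeftFull τ) {V : HilbMod A} (hV : HilbMod.IsSummand V F) :
    IsSelfDual hK V := by
  obtain ⟨j, p, hjp, h⟩ := hV
  intro T
  change L2A τ ⟶ l2Obj τ V at T
  obtain ⟨m, hm⟩ := hF.exists_eq_col
    (T := (hF.embOfSummand hjp h).emb.toContinuousLinearMap ∘L HilbSp.Hom.op T) fun k b x => by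
      change Ell2.comp k ((hF.embOfSummand hjp h).emb (HilbSp.Hom.op T _)) = _
      rw [HilbSp.map_act]
      exact (hF.embOfSummand hjp h).map_act _ _ _
  have hm1 : hF.col m (toL2A τ 1) =
      hF.l2Incl (HilbSp.Hom.op (l2Map τ j) (HilbSp.Hom.op T (toL2A τ 1))) := by
    rw [hm]
    rfl
  rw [← l2Incl_toL2] at hm1
  have hm2 := hF.l2Incl.injective hm1
  refine ⟨HilbMod.Hom.op p m, L2A_hom_ext ?_⟩
  rw [unitFun_one, ← l2Map_toL2, hm2, ← HilbSp.op_comp]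
  have : l2Map τ j ≫ l2Map τ p = 𝟙 (l2Obj τ V) := by
    exact ((l2 τ).map_comp j p).symm.trans ((congrArg (l2 τ).map h).trans ((l2 τ).map_id V))
  rw [this, HilbSp.op_id]

/-- The element of the free module given by a bounded vector of `X`. -/
theorem exists_lift {X : HilbSp A} (i : Emb τ X I) (T : L2A τ ⟶ X) :
    ∃ m, ∀ x, hF.col m x = i.emb (HilbSp.Hom.op T x) := by
  obtain ⟨m, hm⟩ := hF.exists_eq_col
    (T := i.emb.toContinuousLinearMap ∘L HilbSp.Hom.op T) fun k b x => by
      change Ell2.comp k (i.emb (HilbSp.Hom.op T _)) = _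
      rw [HilbSp.map_act]
      exact i.map_act _ _ _
  exact ⟨m, fun x => congrArg (fun T : _ →L[ℂ] _ => T x) hm⟩

/-- A bounded vector of X, embedded in ℓ²(I) ⊗ l²(A), is an element of F, and an element of F
projects to a bounded vector of X. These two maps are adjoint to each other, and their composite on
A(X) is the identity because the projection fixes X. -/
theorem isSummand_bounded (hK : IsLeftFull τ) {X : HilbSp A} (i : Emb τ X I) :
    HilbMod.IsSummand (bounded hK X) F := by
  choose up hup using hF.exists_lift i
  let down : F → (L2A τ ⟶ X) := fun m => i.coprojHom (hF.col m) (hF.col_act m)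
  have hadj : ∀ (T : L2A τ ⟶ X) m, F.inn (up T) m = boundedInn hK T (down m) := fun T m =>
    eq_of_inner_leftL2 (τ := τ) fun x y => by
      rw [← hF.inner_col, inner_leftL2_boundedInn, hup, ← Emb.inner_coproj]
      rfl
  refine ⟨HilbMod.homMk (V := bounded hK X) up down hadj,
    HilbMod.homMk (W := bounded hK X) down up fun m (T : L2A τ ⟶ X) => ?_, fun T m => hadj T m,
    HilbMod.hom_ext fun (T : L2A τ ⟶ X) => ?_⟩
  · rw [← F.star_inn, hadj]
    exact ((bounded hK X).star_inn _ _).symm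
  · change down (up T) = T
    refine HilbSp.hom_ext (ContinuousLinearMap.ext fun x => ?_)
    rw [Emb.op_coprojHom, hup, Emb.coproj_emb]

/-- Elements of F are the same as bounded A-linear columns. Projecting a column gives a bounded
vector of X, and embedding a bounded vector gives a column, so both pF and X ∩ F consist of the
values T(1). The module on the left does not involve the embedding, whence the independence of A(X)
from the presentation. -/
theorem realizes (hK : IsLeftFull τ) {X : HilbSp A} (i : Emb τ X I) :
    i.Realizes τ F c (bounded hK X)
      (fun T : L2A τ ⟶ X => HilbSp.Hom.op T (toL2A τ 1)) := by
  have hcol : ∀ {ξ : Ell2 I (L2A τ)} {m : F},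
      (∀ k, Ell2.comp k ξ = toL2 τ (HilbMod.self A) (c m k)) → ξ = hF.col m (toL2A τ 1) :=
    fun h => Ell2.ext_comp fun k => (h k).trans (hF.comp_col_one _ k).symm
  refine ⟨fun S T h => L2A_hom_ext h, fun x => ⟨?_, ?_⟩, fun x => ⟨?_, ?_⟩, ?_⟩
  · rintro ⟨T, rfl⟩
    obtain ⟨m, hm⟩ := hF.exists_lift i T
    refine ⟨m, i.emb (HilbSp.Hom.op T (toL2A τ 1)), fun k => ?_, i.coproj_emb _⟩
    exact (congrArg (Ell2.comp k) (hm _)).symm.trans (hF.comp_col_one m k)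
  · rintro ⟨m, ξ, hξ, rfl⟩
    exact ⟨i.coprojHom (hF.col m) (hF.col_act m), congrArg i.coproj (hcol hξ).symm⟩
  · rintro ⟨T, rfl⟩
    obtain ⟨m, hm⟩ := hF.exists_lift i T
    exact ⟨m, fun k => (congrArg (Ell2.comp k) (hm _)).symm.trans (hF.comp_col_one m k)⟩
  · rintro ⟨m, hm⟩
    refine ⟨i.coprojHom (hF.col m) (hF.col_act m), ?_⟩
    refine (congrArg i.coproj (hcol hm).symm).trans (i.coproj_emb x)
  · intro S T m m' hm hm'
    change L2A τ ⟶ X at S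
    change L2A τ ⟶ X at T
    -- The element of F is recovered up to its column from its components, as A embeds in l²(A).
    -- This suffices, because the inner product of F can be computed from columns.
    have key : ∀ (S : L2A τ ⟶ X) m, (∀ k, Ell2.comp k (i.emb (HilbSp.Hom.op S (toL2A τ 1))) =
        toL2 τ (HilbMod.self A) (c m k)) → ∀ x, i.emb (HilbSp.Hom.op S x) = hF.col m x := by
      intro S m hm
      obtain ⟨m₁, hm₁⟩ := hF.exists_lift i S
      have e : ∀ k, c m₁ k = c m k := fun k => toL2_injective τ (HilbMod.self A) <| by
        rw [← hm, ← hm₁, comp_col_one]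
        rfl
      intro x
      rw [← hm₁]
      exact Ell2.ext_comp fun k => by rw [comp_col, comp_col, e]
    refine eq_boundedInn hK fun x y => ?_
    rw [← hF.inner_col, ← key S m hm, ← key T m' hm', i.emb.inner_map_map]

end IsFreeModel

theorem isFreeModel_free (hK : IsLeftFull τ) (n : ℕ) :
    IsFreeModel τ (HilbMod.free A n) (fun a => a) where
  map_add _ _ _ := rfl
  map_smul _ _ _ := rfl
  map_op_smul _ _ _ := rfl
  exists_col m := ⟨∑ k, Ell2.single k ∘L leftL2 τ (m k), fun k x => by
    rw [sum_apply, map_sum, Finset.sum_eq_single k]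
    · exact Ell2.comp_single_self _ _
    · intro l _ hl
      exact (Ell2.comp_single _ _ _).trans (if_neg hl.symm)
    · exact fun h => absurd (Finset.mem_univ k) h⟩
  hasSum_inn m m' a b := by
    have : τ (star a * ((HilbMod.free A n).inn m m' * b)) =
        ∑ k, τ (star (m k * a) * (m' k * b)) := by
      rw [← map_sum]
      change τ (star a * ((∑ k, star (m k) * m' k) * b)) = _
      rw [Finset.sum_mul, Finset.mul_sum]
      simp only [star_mul, mul_assoc]
    rw [this]
    exact hasSum_fintype _
  exists_elem T hT := by
    choose m hm using fun k => hK (Ell2.comp k ∘L T) fun b x => hT k b x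
    exact ⟨m, fun k x => congrArg (fun T : _ →L[ℂ] _ => T x) (hm k)⟩

end FreeModel

/-! ### The module `H ⊗ A` -/

section WFree

variable {A : Type u} [CStarAlgebra A] [PartialOrder A] [StarOrderedRing A]

/-- An injective *-homomorphism preserves and reflects positivity, so boundedness of the partial
sums is a property of A alone. It can thus be moved between the representation on 𝓗 and the left
regular representation on l²(A). -/
theorem sum_star_mul_self_le_iff {K : Type*} [NormedAddCommGroup K] [InnerProductSpace ℂ K]
    [CompleteSpace K] (φ : A →⋆ₐ[ℂ] (K →L[ℂ] K)) (hφ : Function.Injective φ) {I : Type*}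
    (s : Finset I) (a : I → A) (C : ℝ) :
    0 ≤ ((C ^ 2 : ℝ) : ℂ) • (1 : A) - ∑ k ∈ s, star (a k) * a k ↔
      ∀ x, ∑ k ∈ s, ‖φ (a k) x‖ ^ 2 ≤ C ^ 2 * ‖x‖ ^ 2 := by
  set D := ((C ^ 2 : ℝ) : ℂ) • (1 : A) - ∑ k ∈ s, star (a k) * a k
  have h1 : 0 ≤ D ↔ 0 ≤ φ D :=
    ⟨fun h => map_nonneg φ h, nonneg_of_starAlgHom φ hφ⟩
  have h2 : ∀ x, inner ℂ (φ D x) x =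
      ((C ^ 2 * ‖x‖ ^ 2 - ∑ k ∈ s, ‖φ (a k) x‖ ^ 2 : ℝ) : ℂ) := by
    intro x
    have e : φ D x = ((C ^ 2 : ℝ) : ℂ) • x - ∑ k ∈ s, adjoint (φ (a k)) (φ (a k) x) := by
      simp only [D, map_sub, map_sum, map_mul, map_star, map_smul, map_one, sub_apply, sum_apply,
        smul_apply, one_apply_eq_self, mul_apply_eq_comp, ContinuousLinearMap.star_eq_adjoint]
    rw [e, inner_sub_left, inner_smul_left, sum_inner, inner_self_eq_norm_sq_to_K]
    simp only [ContinuousLinearMap.adjoint_inner_left, inner_self_eq_norm_sq_to_K]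
    push_cast
    simp
  rw [h1, ContinuousLinearMap.nonneg_iff_isPositive, ContinuousLinearMap.isPositive_iff_complex]
  refine forall_congr' fun x => ?_
  rw [h2]
  have h3 : ∀ r : ℝ, ((((r : ℂ).re : ℝ) : ℂ) = (r : ℂ) ∧ 0 ≤ (r : ℂ).re) ↔ 0 ≤ r := fun r => by
    simp
  exact (h3 _).trans sub_nonneg

variable {𝓗 : Type u} [NormedAddCommGroup 𝓗] [InnerProductSpace ℂ 𝓗] [CompleteSpace 𝓗]
  (N : VonNeumannAlgebra 𝓗) (e : A ≃⋆ₐ[ℂ] N.toStarSubalgebra) {τ : FTrace A}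

theorem coord_eq {I : Type u} {T : columns N e I} {k : I} {a : A}
    (h : ∀ x, Ell2.comp k (T.1 x) = rep N e a x) : coord N e T k = a :=
  rep_injective N e <| ContinuousLinearMap.ext fun x => by rw [← coord_spec, h]

theorem hasSum_inner_comp {I : Type*} {K : Type*} [NormedAddCommGroup K] [InnerProductSpace ℂ K]
    (x y : Ell2 I K) :
    HasSum (fun k => inner ℂ (Ell2.comp k x) (Ell2.comp k y)) (inner ℂ x y) :=
  lp.hasSum_inner (G := fun _ : I => K) x y

theorem summable_norm_comp_prod {I : Type*} {S : 𝓗 →L[ℂ] Ell2 I 𝓗} {u : ℕ → 𝓗}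
    (hu : Summable fun n => ‖u n‖ ^ 2) :
    Summable fun p : ℕ × I => ‖Ell2.comp p.2 (S (u p.1))‖ ^ 2 := by
  have hs : ∀ z : Ell2 I 𝓗, HasSum (fun k => ‖Ell2.comp k z‖ ^ 2) (‖z‖ ^ 2) := fun z => by
    have := lp.hasSum_norm (p := 2) (E := fun _ : I => 𝓗) (by norm_num) z
    simp only [ENNReal.toReal_ofNat, Real.rpow_ofNat] at this
    exact this
  refine (summable_prod_of_nonneg fun p => by positivity).2
    ⟨fun n => (hs (S (u n))).summable, ?_⟩
  simp only [(hs _).tsum_eq]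
  refine Summable.of_nonneg_of_le (fun n => by positivity) (fun n => ?_) (hu.mul_left (‖S‖ ^ 2))
  rw [← mul_pow]
  gcongr
  exact S.le_opNorm _

/-- Normality writes τ as a sum over n of vector functionals, and each of these sees the inner
product of two columns as a sum over the components k. The double series converges absolutely, so
the two summations can be exchanged. -/
theorem hasSum_tau_columnInn (hτ : τ.IsNormal N e) {I : Type u} (S T : columns N e I) (a b : A) :
    HasSum (fun k => τ (star (coord N e S k * a) * (coord N e T k * b)))
      (τ (star a * (columnInn N e S T * b))) := by
  obtain ⟨x, y, hx, hy, hsum⟩ := hτ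
  have hrep : ∀ (c : A) {z : ℕ → 𝓗}, Summable (fun n => ‖z n‖ ^ 2) →
      Summable fun n => ‖rep N e c (z n)‖ ^ 2 := fun c z hz =>
    Summable.of_nonneg_of_le (fun n => by positivity) (fun n => by
      rw [← mul_pow]
      gcongr
      exact ContinuousLinearMap.le_opNorm _ _) (hz.mul_left (‖rep N e c‖ ^ 2))
  let f : ℕ → I → ℂ := fun n k => inner ℂ (Ell2.comp k (S.1 (rep N e a (x n))))
    (Ell2.comp k (T.1 (rep N e b (y n))))
  have hf : Summable (Function.uncurry f) := by
    refine Summable.of_norm_bounded ((summable_norm_comp_prod (S := S.1) (hrep a hx)).add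
      (summable_norm_comp_prod (S := T.1) (hrep b hy))) fun p => ?_
    refine (norm_inner_le_norm _ _).trans ?_
    nlinarith [sq_nonneg (‖Ell2.comp p.2 (S.1 (rep N e a (x p.1)))‖ -
      ‖Ell2.comp p.2 (T.1 (rep N e b (y p.1)))‖),
      sq_nonneg ‖Ell2.comp p.2 (S.1 (rep N e a (x p.1)))‖,
      sq_nonneg ‖Ell2.comp p.2 (T.1 (rep N e b (y p.1)))‖]
  have hadj : ∀ (c d : A) (u v : 𝓗), inner ℂ u (rep N e (star c * d) v) =
      inner ℂ (rep N e c u) (rep N e d v) := fun c d u v => by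
    rw [rep_mul, rep_star, ContinuousLinearMap.star_eq_adjoint, mul_apply_eq_comp,
      ContinuousLinearMap.adjoint_inner_right]
  have h1 : ∀ k, HasSum (fun n => f n k) (τ (star (coord N e S k * a) * (coord N e T k * b))) := by
    intro k
    have h := hsum (star (coord N e S k * a) * (coord N e T k * b))
    simp only [hadj] at h
    simp only [rep_mul, mul_apply_eq_comp, ← coord_spec] at h
    exact h
  have h2 : ∀ n, HasSum (fun k => f n k)
      (inner ℂ (x n) (rep N e (star a * (columnInn N e S T * b)) (y n))) := by
    intro n
    have e1 : inner ℂ (x n) (rep N e (star a * (columnInn N e S T * b)) (y n)) =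
        inner ℂ (S.1 (rep N e a (x n))) (T.1 (rep N e b (y n))) := by
      rw [hadj, rep_mul, mul_apply_eq_comp, rep_columnInn, ContinuousLinearMap.comp_apply,
        ContinuousLinearMap.adjoint_inner_right]
    rw [e1]
    exact hasSum_inner_comp _ _
  have h3 := hf.hasSum.prod_fiberwise h2
  have h4 := (hsum (star a * (columnInn N e S T * b))).unique h3
  rw [h4]
  exact ((Equiv.prodComm I ℕ).hasSum_iff.2 hf.hasSum).prod_fiberwise h1

/-- The columns bounded on 𝓗 and those bounded on l²(A) are the same families: both conditions mean
that ∑ aₖ* aₖ has bounded partial sums in A. -/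
theorem isFreeModel_wFree (hτ : τ.IsNormal N e) (hK : IsLeftFull τ) (I : Type u) :
    IsFreeModel τ (HilbMod.wFree N e I) (coord N e) where
  map_add (S T : columns N e I) k := coord_eq N e fun x => by
    rw [rep_add, add_apply, ← coord_spec, ← coord_spec, ← map_add]
    rfl
  map_smul z (T : columns N e I) k := coord_eq N e fun x => by
    rw [rep_smul, smul_apply, ← coord_spec, ← map_smul]
    rfl
  map_op_smul a (T : columns N e I) k := coord_eq N e fun x => by
    rw [rep_mul, mul_apply_eq_comp, ← coord_spec]
    rfl
  exists_col (T : columns N e I) := by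
    refine ⟨Ell2.mkCol (fun k => leftL2 τ (coord N e T k)) ‖T.1‖ (norm_nonneg _) fun s => ?_,
      fun k x => rfl⟩
    refine (sum_star_mul_self_le_iff (leftHom τ) (leftL2_injective τ) s (coord N e T) _).1 ?_
    refine (sum_star_mul_self_le_iff (repHom N e) (rep_injective N e) s (coord N e T) _).2 ?_
    intro x
    simp only [repHom_apply, ← coord_spec]
    refine (Ell2.sum_norm_comp_le s _).trans ?_
    rw [← mul_pow]
    gcongr
    exact T.1.le_opNorm x
  hasSum_inn S T a b := hasSum_tau_columnInn N e hτ S T a b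
  exists_elem T hT := by
    choose m hm using fun k => hK (Ell2.comp k ∘L T) fun b x => hT k b x
    have hm' : ∀ k x, Ell2.comp k (T x) = leftL2 τ (m k) x := fun k x =>
      congrArg (fun T : _ →L[ℂ] _ => T x) (hm k)
    have hbd : ∀ (s : Finset I) x, ∑ k ∈ s, ‖rep N e (m k) x‖ ^ 2 ≤ ‖T‖ ^ 2 * ‖x‖ ^ 2 := by
      intro s
      refine (sum_star_mul_self_le_iff (repHom N e) (rep_injective N e) s m _).1 ?_
      refine (sum_star_mul_self_le_iff (leftHom τ) (leftL2_injective τ) s m _).2 ?_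
      intro x
      simp only [leftHom_apply, ← hm']
      refine (Ell2.sum_norm_comp_le s _).trans ?_
      rw [← mul_pow]
      gcongr
      exact T.le_opNorm x
    let S : columns N e I := ⟨Ell2.mkCol (fun k => rep N e (m k)) ‖T‖ (norm_nonneg _) hbd,
      fun k => ⟨m k, fun x => rfl⟩⟩
    refine ⟨S, fun k x => ?_⟩
    rw [coord_eq N e (T := S) (k := k) (a := m k) fun x => rfl, hm']

end WFree

/-! ### Equivalences of categories -/

section Equivalence

variable {A : Type u} [CStarAlgebra A] [PartialOrder A] [StarOrderedRing A] {τ : FTrace A}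
  (hK : IsLeftFull τ) {P : ObjectProperty (HilbMod A)} {Q : ObjectProperty (HilbSp A)}

theorem l2Map_unit_counit {V : HilbMod A} (hV : IsSelfDual hK V) :
    l2Map τ (unitIso hK hV).hom ≫ counit hK (l2Obj τ V) = 𝟙 (l2Obj τ V) :=
  l2_hom_ext τ fun v => by
    rw [HilbSp.op_comp, l2Map_toL2]
    exact unit_counit hK V v

theorem unit_hom_naturality {V W : HilbMod A} (hV : IsSelfDual hK V) (hW : IsSelfDual hK W)
    (f : V ⟶ W) : f ≫ (unitIso hK hW).hom = (unitIso hK hV).hom ≫ boundedMap hK (l2Map τ f) :=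
  HilbMod.hom_ext fun v => (unit_naturality hK f v).symm

theorem unit_inv_naturality {V W : HilbMod A} (hV : IsSelfDual hK V) (hW : IsSelfDual hK W)
    (f : V ⟶ W) : boundedMap hK (l2Map τ f) ≫ (unitIso hK hW).inv = (unitIso hK hV).inv ≫ f := by
  rw [Iso.comp_inv_eq, Category.assoc, unit_hom_naturality hK hV hW, Iso.inv_hom_id_assoc]

theorem counit_inv_naturality {X Y : HilbSp A} (hX : HasDenseBounded τ X)
    (hY : HasDenseBounded τ Y) (f : X ⟶ Y) :
    f ≫ (counitIso hK hY).inv = (counitIso hK hX).inv ≫ l2Map τ (boundedMap hK f) := by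
  rw [Iso.comp_inv_eq, Category.assoc, Iso.eq_inv_comp]
  exact (counit_naturality hK f).symm

variable (h : ∀ V, P V → Q (l2Obj τ V)) (h' : ∀ X, Q X → P (bounded hK X))
  (hQ : ∀ X, Q X → HasDenseBounded τ X) (hP : ∀ V, P V → IsSelfDual hK V)

/-- The functor `X ↦ A(X)` on full subcategories. -/
def boundedSub : Q.FullSubcategory ⥤ P.FullSubcategory :=
  P.lift (Q.ι ⋙ boundedFunctor hK) fun X => h' _ X.property

/-- The natural isomorphism `l²(A(X)) ≅ X`. -/
def counitSub : boundedSub hK h' ⋙ l2Sub τ h ≅ 𝟭 _ :=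
  NatIso.ofComponents (fun X => Q.isoMk (counitIso hK (hQ _ X.property)))
    fun f => Q.ι.map_injective (counit_naturality hK f.hom)

include hP in
theorem isQuasiInverse_sub : IsQuasiInverse (l2Sub τ h) (boundedSub hK h')
    (counitSub hK h h' hQ) :=
  ⟨NatIso.ofComponents (fun V => P.isoMk (unitIso hK (hP _ V.property)))
    fun {X Y} f => P.ι.map_injective
      (unit_hom_naturality hK (hP _ X.property) (hP _ Y.property) f.hom),
    fun V => Q.ι.map_injective (l2Map_unit_counit hK (hP _ V.property))⟩

/-! ### The equivalence for bundles -/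

section Bundles

variable {M : Type w} [TopologicalSpace M] {R : Regularity.{u} M}

/-- The bundle `A(X)`, by applying `A(·)` to the fibers and to the trivializations. -/
def boundedBundleObj (X : HBundle R Q) : HBundle R P where
  fiber x := bounded hK (X.fiber x)
  fiber_mem x := h' _ (X.fiber_mem x)
  ι := X.ι
  U := X.U
  isOpen := X.isOpen
  cover := X.cover
  model i := bounded hK (X.model i)
  model_mem i := h' _ (X.model_mem i)
  triv i x hx := (boundedFunctor hK).mapIso (X.triv i x hx)
  isometric i x hx := boundedMap_isometric hK _ (X.isometric i x hx)
  transition i j x hi hj := by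
    refine R.congr (Filter.Eventually.of_forall fun y => ?_)
      (R.clm (boundedMapL hK (X.model i) (X.model j)) (X.transition i j x hi hj))
    by_cases hy : y ∈ X.U i ∧ y ∈ X.U j
    · simp only [hy, and_self, dite_true]
      exact (boundedFunctor hK).map_comp _ _
    · simp only [hy, dite_false, map_zero]

/-- The functor `A(·)` on bundles. -/
def boundedBundle : HBundle R Q ⥤ HBundle R P where
  obj X := boundedBundleObj hK h' X
  map {X Y} f := ⟨fun x => boundedMap hK (HBundle.Hom.at f x), fun i j x hi hj => by
    refine R.congr (Filter.Eventually.of_forall fun y => ?_)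
      (R.clm (boundedMapL hK (X.model i) (Y.model j)) (HBundle.Hom.regular f i j x hi hj))
    by_cases hy : y ∈ X.U i ∧ y ∈ Y.U j
    · have hy' : y ∈ (boundedBundleObj hK h' X).U i ∧ y ∈ (boundedBundleObj hK h' Y).U j := hy
      simp only [HBundle.localRep, hy, hy', and_self, dite_true]
      refine ((boundedFunctor hK).map_comp _ _).trans ?_
      rw [(boundedFunctor hK).map_comp]
      rfl
    · have hy' : ¬ (y ∈ (boundedBundleObj hK h' X).U i ∧ y ∈ (boundedBundleObj hK h' Y).U j) := hy
      simp only [HBundle.localRep, hy, hy', dite_false, map_zero]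
      rfl⟩
  map_id X := HBundle.Hom.ext (funext fun x => (boundedFunctor hK).map_id _)
  map_comp f g := HBundle.Hom.ext (funext fun x => (boundedFunctor hK).map_comp _ _)

/-- The isomorphism of bundles `l²(A(X)) ≅ X`. -/
def counitBundleIso (X : HBundle R Q) : l2BundleObj τ h (boundedBundleObj hK h' X) ≅ X where
  hom := ⟨fun x => counit hK (X.fiber x), fun i j x hi hj => by
    -- By naturality, in trivializations the counit is a transition function of X preceded by the
    -- constant counit of the model, and composition with a constant morphism preserves regularity.
    refine R.congr (Filter.Eventually.of_forall fun y => ?_)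
      (R.clm (FiberCat.compL _ _ (X.model j) (counit hK (X.model i))) (X.transition i j x hi hj))
    by_cases hy : y ∈ X.U i ∧ y ∈ X.U j
    · have hy' : y ∈ (l2BundleObj τ h (boundedBundleObj hK h' X)).U i ∧ y ∈ X.U j := hy
      simp only [HBundle.localRep, hy, hy', and_self, dite_true]
      rw [FiberCat.compL_apply]
      exact (Category.assoc _ _ _).symm.trans ((congrArg (· ≫ (X.triv j y hy.2).hom)
        (counit_naturality hK (X.triv i y hy.1).inv).symm).trans (Category.assoc _ _ _))
    · have hy' : ¬ (y ∈ (l2BundleObj τ h (boundedBundleObj hK h' X)).U i ∧ y ∈ X.U j) := hy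
      simp only [HBundle.localRep, hy, hy', dite_false, map_zero]
      rfl⟩
  inv := ⟨fun x => (counitIso hK (hQ _ (X.fiber_mem x))).inv, fun i j x hi hj => by
    refine R.congr (Filter.Eventually.of_forall fun y => ?_)
      (R.clm ((FiberCat.compL (X.model i) (X.model j) _).flip
        (counitIso hK (hQ _ (X.model_mem j))).inv) (X.transition i j x hi hj))
    by_cases hy : y ∈ X.U i ∧ y ∈ X.U j
    · have hy' : y ∈ X.U i ∧ y ∈ (l2BundleObj τ h (boundedBundleObj hK h' X)).U j := hy
      simp only [HBundle.localRep, hy, hy', and_self, dite_true]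
      rw [ContinuousLinearMap.flip_apply, FiberCat.compL_apply, Category.assoc]
      exact congrArg ((X.triv i y hy.1).inv ≫ ·) (counit_inv_naturality hK _ _ _)
    · have hy' : ¬ (y ∈ X.U i ∧ y ∈ (l2BundleObj τ h (boundedBundleObj hK h' X)).U j) := hy
      simp only [HBundle.localRep, hy, hy', dite_false, map_zero]
      rfl⟩
  hom_inv_id := HBundle.Hom.ext (funext fun x => (counitIso hK (hQ _ (X.fiber_mem x))).hom_inv_id)
  inv_hom_id := HBundle.Hom.ext (funext fun x => (counitIso hK (hQ _ (X.fiber_mem x))).inv_hom_id)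

/-- The isomorphism of bundles `W ≅ A(l²(W))`. -/
def unitBundleIso (W : HBundle R P) : W ≅ boundedBundleObj hK h' (l2BundleObj τ h W) where
  hom := ⟨fun x => (unitIso hK (hP _ (W.fiber_mem x))).hom, fun i j x hi hj => by
    -- The unit is likewise a transition function of W followed by the constant unit of the model.
    refine R.congr (Filter.Eventually.of_forall fun y => ?_)
      (R.clm ((FiberCat.compL (W.model i) (W.model j) _).flip
        (unitIso hK (hP _ (W.model_mem j))).hom) (W.transition i j x hi hj))
    by_cases hy : y ∈ W.U i ∧ y ∈ W.U j
    · have hy' : y ∈ W.U i ∧ y ∈ (boundedBundleObj hK h' (l2BundleObj τ h W)).U j := hy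
      simp only [HBundle.localRep, hy, hy', and_self, dite_true]
      rw [ContinuousLinearMap.flip_apply, FiberCat.compL_apply, Category.assoc]
      exact congrArg ((W.triv i y hy.1).inv ≫ ·) (unit_hom_naturality hK _ _ _)
    · have hy' : ¬ (y ∈ W.U i ∧ y ∈ (boundedBundleObj hK h' (l2BundleObj τ h W)).U j) := hy
      simp only [HBundle.localRep, hy, hy', dite_false, map_zero]
      rfl⟩
  inv := ⟨fun x => (unitIso hK (hP _ (W.fiber_mem x))).inv, fun i j x hi hj => by
    refine R.congr (Filter.Eventually.of_forall fun y => ?_)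
      (R.clm (FiberCat.compL _ _ (W.model j) (unitIso hK (hP _ (W.model_mem i))).inv)
        (W.transition i j x hi hj))
    by_cases hy : y ∈ W.U i ∧ y ∈ W.U j
    · have hy' : y ∈ (boundedBundleObj hK h' (l2BundleObj τ h W)).U i ∧ y ∈ W.U j := hy
      simp only [HBundle.localRep, hy, hy', and_self, dite_true]
      rw [FiberCat.compL_apply]
      exact (Category.assoc _ _ _).symm.trans ((congrArg (· ≫ (W.triv j y hy.2).hom)
        (unit_inv_naturality hK (hP _ (W.model_mem i)) (hP _ (W.fiber_mem y))
          (W.triv i y hy.1).inv).symm).trans (Category.assoc _ _ _))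
    · have hy' : ¬ (y ∈ (boundedBundleObj hK h' (l2BundleObj τ h W)).U i ∧ y ∈ W.U j) := hy
      simp only [HBundle.localRep, hy, hy', dite_false, map_zero]
      rfl⟩
  hom_inv_id := HBundle.Hom.ext (funext fun x => (unitIso hK (hP _ (W.fiber_mem x))).hom_inv_id)
  inv_hom_id := HBundle.Hom.ext (funext fun x => (unitIso hK (hP _ (W.fiber_mem x))).inv_hom_id)

/-- The natural isomorphism of bundles `l²(A(X)) ≅ X`. -/
def counitBundle : boundedBundle (R := R) hK h' ⋙ l2Bundle τ h ≅ 𝟭 _ :=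
  NatIso.ofComponents (fun X => counitBundleIso hK h h' hQ X)
    fun f => HBundle.Hom.ext (funext fun x => counit_naturality hK (HBundle.Hom.at f x))

include hP in
theorem isQuasiInverse_bundle : IsQuasiInverse (l2Bundle (R := R) τ h) (boundedBundle hK h')
    (counitBundle hK h h' hQ) :=
  ⟨NatIso.ofComponents (fun W => unitBundleIso hK h h' hP W)
    fun {W W'} f => HBundle.Hom.ext (funext fun x => unit_hom_naturality hK
      (hP _ (W.fiber_mem x)) (hP _ (W'.fiber_mem x)) (HBundle.Hom.at f x)),
    fun W => HBundle.Hom.ext (funext fun x => l2Map_unit_counit hK (hP _ (W.fiber_mem x)))⟩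

end Bundles

end Equivalence

/-! ### Finitely generated projective and general objects -/

section Presentations

variable {A : Type u} [CStarAlgebra A] [PartialOrder A] [StarOrderedRing A] {τ : FTrace A}
  (hK : IsLeftFull τ)

include hK in
theorem isFGProjective_l2Obj (V : HilbMod A) (hV : HilbMod.IsFGProjective V) :
    HilbSp.IsFGProjective τ (l2Obj τ V) := by
  obtain ⟨n, j, p, hjp, h⟩ := hV
  exact ⟨n, (isFreeModel_free hK n).embOfSummand hjp h, Emb.isMatrix hK _⟩

theorem isFGProjective_bounded (X : HilbSp A) (hX : HilbSp.IsFGProjective τ X) :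
    HilbMod.IsFGProjective (bounded hK X) := by
  obtain ⟨n, i, -⟩ := hX
  exact ⟨n, (isFreeModel_free hK n).isSummand_bounded hK i⟩

theorem hasDenseBounded_of_isFGProjective (X : HilbSp A) (hX : HilbSp.IsFGProjective τ X) :
    HasDenseBounded τ X := by
  obtain ⟨n, i, -⟩ := hX
  exact i.hasDenseBounded

theorem isSelfDual_of_isFGProjective (V : HilbMod A) (hV : HilbMod.IsFGProjective V) :
    IsSelfDual hK V := by
  obtain ⟨n, hn⟩ := hV
  exact (isFreeModel_free hK n).isSelfDual hK hn

/-- On A(X) the counit is T ↦ T(1), for which `IsFreeModel.realizes` covers all presentations at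
once. -/
theorem isFGAOf_counit (X : HilbSp A) :
    IsFGAOf τ X (bounded hK X)
      (fun v => HilbSp.Hom.op (counit hK X) (toL2 τ (bounded hK X) v)) := by
  intro n i _
  have e : (fun v => HilbSp.Hom.op (counit hK X) (toL2 τ (bounded hK X) v)) =
      fun T : L2A τ ⟶ X => HilbSp.Hom.op T (toL2A τ 1) := funext (counit_toL2 hK X)
  rw [e]
  exact (isFreeModel_free hK n).realizes hK i

variable {𝓗 : Type u} [NormedAddCommGroup 𝓗] [InnerProductSpace ℂ 𝓗] [CompleteSpace 𝓗]
  (N : VonNeumannAlgebra 𝓗) (e : A ≃⋆ₐ[ℂ] N.toStarSubalgebra) (hτ : τ.IsNormal N e)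
include hτ

include hK in
theorem isAHilbert_l2Obj (V : HilbMod A) (hV : HilbMod.IsProjective N e V) :
    HilbSp.IsAHilbert τ (l2Obj τ V) := by
  obtain ⟨I, j, p, hjp, h⟩ := hV
  exact ⟨I, (isFreeModel_wFree N e hτ hK I).embOfSummand hjp h, Emb.proj_mem_tensorVN _ hK⟩

theorem isProjective_bounded (X : HilbSp A) (hX : HilbSp.IsAHilbert τ X) :
    HilbMod.IsProjective N e (bounded hK X) := by
  obtain ⟨I, i, -⟩ := hX
  exact ⟨I, (isFreeModel_wFree N e hτ hK I).isSummand_bounded hK i⟩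

omit hτ in
theorem hasDenseBounded_of_isAHilbert (X : HilbSp A) (hX : HilbSp.IsAHilbert τ X) :
    HasDenseBounded τ X := by
  obtain ⟨I, i, -⟩ := hX
  exact i.hasDenseBounded

theorem isSelfDual_of_isProjective (V : HilbMod A) (hV : HilbMod.IsProjective N e V) :
    IsSelfDual hK V := by
  obtain ⟨I, hI⟩ := hV
  exact (isFreeModel_wFree N e hτ hK I).isSelfDual hK hI

theorem isAOf_counit (X : HilbSp A) :
    IsAOf τ N e X (bounded hK X)
      (fun v => HilbSp.Hom.op (counit hK X) (toL2 τ (bounded hK X) v)) := by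
  intro I i _
  have e : (fun v => HilbSp.Hom.op (counit hK X) (toL2 τ (bounded hK X) v)) =
      fun T : L2A τ ⟶ X => HilbSp.Hom.op T (toL2A τ 1) := funext (counit_toL2 hK X)
  rw [e]
  exact (isFreeModel_wFree N _ hτ hK I).realizes hK i

end Presentations

/-! ### Smooth functions with values in Banach spaces -/

section Analysis

open Filter Topology MeasureTheory

open Convolution in
/-- Hadamard's lemma. -/
theorem exists_hadamard {E F : Type*} [NormedAddCommGroup E] [NormedSpace ℝ E]
    [NormedAddCommGroup F] [NormedSpace ℝ F] [CompleteSpace F] {f : E → F}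
    (hf : ContDiff ℝ ∞ f) (x₀ : E) :
    ∃ g : E → E →L[ℝ] F, ContDiff ℝ ∞ g ∧ ∀ x, f x = f x₀ + g x (x - x₀) := by
  -- The factor g(x) = ∫₀¹ f'(x₀ + t(x − x₀)) dt is written as a convolution evaluated at 0, in
  -- order to use smooth dependence of convolutions on parameters; hence the sign of t in `G`. The
  -- bump equals 1 on [−2, 2], so it does not change the integral, and only provides compact
  -- support.
  let β : ContDiffBump (0 : ℝ) := ⟨2, 3, by norm_num, by norm_num⟩
  let G : E → ℝ → E →L[ℝ] F := fun x t => β t • fderiv ℝ f (x₀ + (-t) • (x - x₀))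
  let φ : ℝ → ℝ := Set.indicator (Set.Icc 0 1) fun _ => 1
  have hf' : ContDiff ℝ ∞ (fderiv ℝ f) := hf.fderiv_right (m := ∞) (by simp)
  have hG : ContDiff ℝ ∞ (Function.uncurry G) := by
    refine (β.contDiff.comp contDiff_snd).smul (hf'.comp ?_)
    exact contDiff_const.add (contDiff_snd.neg.smul (contDiff_fst.sub contDiff_const))
  have hφ : LocallyIntegrable φ := by
    refine Integrable.locallyIntegrable ?_
    exact (integrable_indicator_iff measurableSet_Icc).2 (by simp)
  refine ⟨fun x => (φ ⋆[ContinuousLinearMap.lsmul ℝ ℝ, volume] G x) 0, ?_, fun x => ?_⟩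
  · have := contDiffOn_convolution_right_with_param_comp (n := ⊤)
      (ContinuousLinearMap.lsmul ℝ ℝ : ℝ →L[ℝ] (E →L[ℝ] F) →L[ℝ] (E →L[ℝ] F))
      (s := Set.univ) (v := fun _ : E => (0 : ℝ)) contDiffOn_const (g := G) isOpen_univ
      (isCompact_closedBall (0 : ℝ) 3) (fun p t _ ht => ?_) hφ hG.contDiffOn
    · exact contDiffOn_univ.1 this
    · have : β t = 0 := β.zero_of_le_dist (by
        rw [Metric.mem_closedBall, not_le] at ht
        exact ht.le)
      simp [G, this]
  · have e : (φ ⋆[ContinuousLinearMap.lsmul ℝ ℝ, volume] G x) 0 =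
        ∫ t in (0 : ℝ)..1, fderiv ℝ f (x₀ + t • (x - x₀)) := by
      rw [convolution_def, intervalIntegral.integral_of_le zero_le_one,
        ← integral_Icc_eq_integral_Ioc, ← integral_indicator measurableSet_Icc]
      refine integral_congr_ae (Eventually.of_forall fun t => ?_)
      by_cases ht : t ∈ Set.Icc (0 : ℝ) 1
      · have : β (0 - t) = 1 := β.one_of_mem_closedBall (by
          rw [Metric.mem_closedBall, dist_zero_right, zero_sub, norm_neg,
            Real.norm_of_nonneg ht.1]
          exact ht.2.trans (by norm_num [β]))
        simp only [φ, G, Set.indicator_of_mem ht, this, ContinuousLinearMap.lsmul_apply, one_smul]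
        simp
      · simp [φ, Set.indicator_of_notMem ht]
    have hd : ∀ t : ℝ, HasDerivAt (fun t : ℝ => f (x₀ + t • (x - x₀)))
        (fderiv ℝ f (x₀ + t • (x - x₀)) (x - x₀)) t := fun t => by
      have h1 : HasDerivAt (fun t : ℝ => x₀ + t • (x - x₀)) (x - x₀) t := by
        simpa using ((hasDerivAt_id t).smul_const (x - x₀)).const_add x₀
      exact ((hf.differentiable (by simp)).differentiableAt.hasFDerivAt).comp_hasDerivAt t h1
    have hc : Continuous fun t : ℝ => fderiv ℝ f (x₀ + t • (x - x₀)) :=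
      hf'.continuous.comp (by fun_prop)
    have hi := intervalIntegral.integral_eq_sub_of_hasDerivAt (a := 0) (b := 1)
      (fun t _ => hd t) ((hc.clm_apply continuous_const).intervalIntegrable 0 1)
    beta_reduce
    rw [e, ContinuousLinearMap.intervalIntegral_apply (hc.intervalIntegrable 0 1), hi]
    simp

/-- A family of operators which is twice continuously differentiable in the strong sense is
differentiable in norm. -/
theorem hasFDerivAt_of_strong {E B H K : Type*} [NormedAddCommGroup E] [NormedSpace ℝ E]
    [FiniteDimensional ℝ E] [NormedAddCommGroup B] [NormedSpace ℝ B] [NormedAddCommGroup H]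
    [NormedSpace ℝ H] [CompleteSpace H] [NormedAddCommGroup K] [NormedSpace ℝ K]
    (ι : B →L[ℝ] H →L[ℝ] K) (hι : ∀ b, ‖ι b‖ = ‖b‖) {U : Set E} (hU : IsOpen U) {T : E → B}
    (hT : ∀ h, ContDiffOn ℝ ∞ (fun x => ι (T x) h) U) {x : E} (hx : x ∈ U) (T' : E →L[ℝ] B)
    (hT' : ∀ v h, ι (T' v) h = fderiv ℝ (fun x => ι (T x) h) x v) : HasFDerivAt T T' x := by
  obtain ⟨r, hr, hrU⟩ := Metric.nhds_basis_closedBall.mem_iff.1 (hU.mem_nhds hx)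
  -- The first-order Taylor remainder is divided by ‖y − x‖² (the quotient is 0 at y = x). On a
  -- fixed h it is bounded over the ball, by a bound on the second derivative of ι(T·)h, and
  -- Banach–Steinhaus makes the bound uniform in norm.
  let S : Metric.closedBall x r → H →L[ℝ] K := fun y =>
    (‖y.1 - x‖ ^ 2)⁻¹ • ι (T y.1 - T x - T' (y.1 - x))
  have hS : ∀ h, ∃ C, ∀ y, ‖S y h‖ ≤ C := fun h => by
    set f : E → K := fun x => ι (T x) h with hf
    have h1 : ContDiffOn ℝ ∞ (fderiv ℝ f) U :=
      ((contDiffOn_infty_iff_fderiv_of_isOpen hU).1 (hT h)).2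
    have h2 := (contDiffOn_infty_iff_fderiv_of_isOpen hU).1 h1
    obtain ⟨C, hC⟩ := (isCompact_closedBall x r).exists_bound_of_continuousOn
      (h2.2.continuousOn.mono hrU)
    have hC0 : 0 ≤ C := (norm_nonneg _).trans (hC x (Metric.mem_closedBall_self hr.le))
    have hlip : ∀ y ∈ Metric.closedBall x r, ‖fderiv ℝ f y - fderiv ℝ f x‖ ≤ C * ‖y - x‖ :=
      fun y hy => (convex_closedBall x r).norm_image_sub_le_of_norm_fderiv_le
        (fun z hz => (h2.1 z (hrU hz)).differentiableAt (hU.mem_nhds (hrU hz))) hC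
        (Metric.mem_closedBall_self hr.le) hy
    refine ⟨C, fun y => ?_⟩
    have e : S y h = (‖y.1 - x‖ ^ 2)⁻¹ • (f y.1 - f x - fderiv ℝ f x (y.1 - x)) := by
      simp only [S, smul_apply, map_sub, sub_apply, hT', hf]
    rw [e, norm_smul, norm_inv, norm_pow, norm_norm]
    have hy := y.2
    have hsub : Metric.closedBall x ‖y.1 - x‖ ⊆ Metric.closedBall x r :=
      Metric.closedBall_subset_closedBall (by rwa [← dist_eq_norm])
    have key : ‖f y.1 - f x - fderiv ℝ f x (y.1 - x)‖ ≤ C * ‖y.1 - x‖ * ‖y.1 - x‖ := by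
      refine (convex_closedBall x ‖y.1 - x‖).norm_image_sub_le_of_norm_fderiv_le'
        (fun z hz => ((hT h).differentiableOn (by simp) z (hrU (hsub hz))).differentiableAt
          (hU.mem_nhds (hrU (hsub hz)))) (fun z hz => ?_)
        (Metric.mem_closedBall_self (norm_nonneg _)) (by rw [mem_closedBall_iff_norm])
      exact (hlip z (hsub hz)).trans (mul_le_mul_of_nonneg_left (mem_closedBall_iff_norm.1 hz) hC0)
    rcases eq_or_ne ‖y.1 - x‖ 0 with h0 | h0
    · simp [h0, hC0]
    · rw [inv_mul_le_iff₀ (by positivity)]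
      linarith
  obtain ⟨C, hC⟩ := banach_steinhaus hS
  have hbound : ∀ y ∈ Metric.closedBall x r, ‖T y - T x - T' (y - x)‖ ≤ C * ‖y - x‖ ^ 2 :=
    fun y hy => by
      have := hC ⟨y, hy⟩
      simp only [S, norm_smul, hι, norm_inv, norm_pow, norm_norm] at this
      rcases eq_or_ne ‖y - x‖ 0 with h0 | h0
      · simp [sub_eq_zero.1 (norm_eq_zero.1 h0)]
      · rwa [inv_mul_le_iff₀ (by positivity), mul_comm] at this
  rw [hasFDerivAt_iff_isLittleO]
  have h1 : (fun y => T y - T x - T' (y - x)) =O[𝓝 x] fun y => ‖y - x‖ ^ 2 :=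
    Asymptotics.IsBigO.of_bound C (by
      filter_upwards [Metric.closedBall_mem_nhds x hr] with y hy
      simpa using hbound y hy)
  refine h1.trans_isLittleO ((Asymptotics.isLittleO_norm_pow_id one_lt_two).comp_tendsto ?_)
  exact tendsto_sub_nhds_zero_iff.2 tendsto_id

/-- A family of operators which is smooth in the strong sense is smooth in norm. -/
theorem contDiffOn_of_strong {E B H K : Type*} [NormedAddCommGroup E] [NormedSpace ℝ E]
    [FiniteDimensional ℝ E] [NormedAddCommGroup B] [NormedSpace ℝ B] [NormedAddCommGroup H]
    [NormedSpace ℝ H] [CompleteSpace H] [NormedAddCommGroup K] [NormedSpace ℝ K]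
    (ι : B →L[ℝ] H →L[ℝ] K) (hι : ∀ b, ‖ι b‖ = ‖b‖)
    (hB : ∀ (b : ℕ → B) (S : H →L[ℝ] K),
      (∀ h, Tendsto (fun n => ι (b n) h) atTop (𝓝 (S h))) → ∃ c, ι c = S)
    {U : Set E} (hU : IsOpen U) {T : E → B}
    (hT : ∀ h, ContDiffOn ℝ ∞ (fun x => ι (T x) h) U) : ContDiffOn ℝ ∞ T U := by
  have hinj : Function.Injective ι := (AddMonoidHomClass.isometry_of_norm ι hι).injective
  have key : ∀ T : E → B, (∀ h, ContDiffOn ℝ ∞ (fun x => ι (T x) h) U) → ∀ x ∈ U,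
      ∃ T' : E →L[ℝ] B, HasFDerivAt T T' x ∧
        ∀ v h, ι (T' v) h = fderiv ℝ (fun x => ι (T x) h) x v := by
    intro T hT x hx
    -- A directional derivative is a strong limit of difference quotients, hence a bounded operator,
    -- and it comes from B by `hB`.
    have h1 : ∀ v, ∃ b, ∀ h, ι b h = fderiv ℝ (fun x => ι (T x) h) x v := fun v => by
      let b : ℕ → B := fun n => ((n : ℝ) + 1) • (T (x + ((n : ℝ) + 1)⁻¹ • v) - T x)
      have hb : ∀ h, Tendsto (fun n => ι (b n) h) atTop
          (𝓝 (fderiv ℝ (fun x => ι (T x) h) x v)) := fun h => by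
        have hd : HasFDerivAt (fun x => ι (T x) h) (fderiv ℝ (fun x => ι (T x) h) x) x :=
          (((hT h).differentiableOn (by simp) x hx).differentiableAt
            (hU.mem_nhds hx)).hasFDerivAt
        have hc : Tendsto (fun n : ℕ => ‖(n : ℝ) + 1‖) atTop atTop :=
          tendsto_norm_atTop_atTop.comp
            (tendsto_atTop_add_const_right _ _ tendsto_natCast_atTop_atTop)
        simpa [b] using hd.lim v hc
      obtain ⟨c, hc⟩ := hB b (continuousLinearMapOfTendsto (fun n => ι (b n))
        (tendsto_pi_nhds.2 hb)) hb
      exact ⟨c, fun h => by rw [hc]; rfl⟩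
    choose b hb using h1
    let L : E →ₗ[ℝ] B :=
      { toFun := b
        map_add' := fun v w => hinj (ContinuousLinearMap.ext fun h => by simp [hb])
        map_smul' := fun r v => hinj (ContinuousLinearMap.ext fun h => by simp [hb]) }
    exact ⟨LinearMap.toContinuousLinearMap L,
      hasFDerivAt_of_strong ι hι hU hT hx _ fun v h => hb v h, fun v h => hb v h⟩
  rw [contDiffOn_infty]
  intro n
  -- The derivative of T in a fixed direction is again strongly smooth, so the induction has to
  -- range over all families T.
  induction n generalizing T with
  | zero =>
    refine contDiffOn_zero.2 fun x hx => ?_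
    obtain ⟨T', h, -⟩ := key T hT x hx
    exact h.continuousAt.continuousWithinAt
  | succ n ih =>
    have hd : ∀ x ∈ U, ∀ v h, ι (fderiv ℝ T x v) h = fderiv ℝ (fun x => ι (T x) h) x v := by
      intro x hx
      obtain ⟨T', h, h'⟩ := key T hT x hx
      rwa [h.fderiv]
    push_cast
    refine (contDiffOn_succ_iff_fderiv_of_isOpen hU).2 ⟨fun x hx => ?_, by simp, ?_⟩
    · obtain ⟨T', h, -⟩ := key T hT x hx
      exact h.differentiableAt.differentiableWithinAt
    · refine contDiffOn_clm_apply.2 fun v => ih fun h => ?_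
      have h1 := ((contDiffOn_infty_iff_fderiv_of_isOpen hU).1 (hT h)).2
      exact (h1.clm_apply contDiffOn_const).congr fun x hx => hd x hx v h

/-! ### Smooth functions on manifolds -/

section Manifold

variable {d : ℕ} {M : Type w} [TopologicalSpace M] [ChartedSpace (EuclideanSpace ℝ (Fin d)) M]

section

variable {F G K : Type*} [NormedAddCommGroup F] [NormedSpace ℝ F] [NormedAddCommGroup G]
  [NormedSpace ℝ G] [NormedAddCommGroup K] [NormedSpace ℝ K]

theorem mdifferentiableAt_of_smooth {f : M → F} {x : M}
    (hf : ContMDiffAt (𝓡 d) 𝓘(ℝ, F) ∞ f x) : MDifferentiableAt (𝓡 d) 𝓘(ℝ, F) f x :=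
  hf.mdifferentiableAt (by simp)

theorem contMDiffAt_bilin (B : F →L[ℝ] G →L[ℝ] K) {f : M → F} {g : M → G} {x : M}
    (hf : ContMDiffAt (𝓡 d) 𝓘(ℝ, F) ∞ f x) (hg : ContMDiffAt (𝓡 d) 𝓘(ℝ, G) ∞ g x) :
    ContMDiffAt (𝓡 d) 𝓘(ℝ, K) ∞ (fun y => B (f y) (g y)) x := by
  have h : ContMDiff 𝓘(ℝ, F × G) 𝓘(ℝ, K) ∞ (fun p : F × G => B p.1 p.2) :=
    B.isBoundedBilinearMap.contDiff.contMDiff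
  exact h.contMDiffAt.comp x (hf.prodMk_space hg)

theorem mfderiv_clm (L : F →L[ℝ] G) {f : M → F} {x : M}
    (hf : ContMDiffAt (𝓡 d) 𝓘(ℝ, F) ∞ f x) (v : TangentSpace (𝓡 d) x) :
    mfderiv (𝓡 d) 𝓘(ℝ, G) (fun y => L (f y)) x v = L (mfderiv (𝓡 d) 𝓘(ℝ, F) f x v) := by
  have h := L.hasMFDerivAt.comp x (mdifferentiableAt_of_smooth hf).hasMFDerivAt
  exact congrArg (fun T => T v) h.mfderiv

theorem mfderiv_bilin (B : F →L[ℝ] G →L[ℝ] K) {f : M → F} {g : M → G} {x : M}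
    (hf : ContMDiffAt (𝓡 d) 𝓘(ℝ, F) ∞ f x) (hg : ContMDiffAt (𝓡 d) 𝓘(ℝ, G) ∞ g x)
    (v : TangentSpace (𝓡 d) x) :
    mfderiv (𝓡 d) 𝓘(ℝ, K) (fun y => B (f y) (g y)) x v =
      B (f x) (mfderiv (𝓡 d) 𝓘(ℝ, G) g x v) + B (mfderiv (𝓡 d) 𝓘(ℝ, F) f x v) (g x) := by
  have hB : HasMFDerivAt 𝓘(ℝ, F × G) 𝓘(ℝ, K) (fun p : F × G => B p.1 p.2) (f x, g x)
      (B.isBoundedBilinearMap.deriv (f x, g x)) :=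
    (B.isBoundedBilinearMap.hasFDerivAt (f x, g x)).hasMFDerivAt
  have hp : MDifferentiableAt (𝓡 d) 𝓘(ℝ, F × G) (fun y => (f y, g y)) x :=
    (mdifferentiableAt_of_smooth hf).prodMk_space (mdifferentiableAt_of_smooth hg)
  have h := hB.comp x hp.hasMFDerivAt
  have e1 : mfderiv (𝓡 d) 𝓘(ℝ, F) f x v = (mfderiv (𝓡 d) 𝓘(ℝ, F × G) (fun y => (f y, g y)) x v).1 :=
    congrArg (fun T => T v)
      ((ContinuousLinearMap.fst ℝ F G).hasMFDerivAt.comp x hp.hasMFDerivAt).mfderiv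
  have e2 : mfderiv (𝓡 d) 𝓘(ℝ, G) g x v = (mfderiv (𝓡 d) 𝓘(ℝ, F × G) (fun y => (f y, g y)) x v).2 :=
    congrArg (fun T => T v)
      ((ContinuousLinearMap.snd ℝ F G).hasMFDerivAt.comp x hp.hasMFDerivAt).mfderiv
  rw [e1, e2]
  exact congrArg (fun T => T v) h.mfderiv

variable [IsManifold (𝓡 d) ∞ M]

/-- Smoothness on an open set, in the chart at `x`. -/
theorem contDiffOn_comp_extChartAt_symm {f : M → F} (x : M) {V : Set M} (hV : IsOpen V)
    (hf : ∀ y ∈ V, ContMDiffAt (𝓡 d) 𝓘(ℝ, F) ∞ f y) :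
    IsOpen ((extChartAt (𝓡 d) x).target ∩ (extChartAt (𝓡 d) x).symm ⁻¹' V) ∧
      ContDiffOn ℝ ∞ (f ∘ (extChartAt (𝓡 d) x).symm)
        ((extChartAt (𝓡 d) x).target ∩ (extChartAt (𝓡 d) x).symm ⁻¹' V) := by
  have ht : IsOpen (extChartAt (𝓡 d) x).target := isOpen_extChartAt_target x
  refine ⟨(continuousOn_extChartAt_symm x).isOpen_inter_preimage ht hV, fun z hz => ?_⟩
  have h := (contMDiffOn_extChartAt_symm (I := 𝓡 d) (n := ∞) x).contMDiffAt (ht.mem_nhds hz.1)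
  exact ((hf _ hz.2).comp z h).contDiffAt.contDiffWithinAt

theorem contMDiffAt_of_contDiffAt {f : M → F} {x : M}
    (hf : ContDiffAt ℝ ∞ (f ∘ (extChartAt (𝓡 d) x).symm) (extChartAt (𝓡 d) x x)) :
    ContMDiffAt (𝓡 d) 𝓘(ℝ, F) ∞ f x := by
  refine (hf.contMDiffAt.comp x contMDiffAt_extChartAt).congr_of_eventuallyEq ?_
  filter_upwards [extChartAt_source_mem_nhds (I := 𝓡 d) x] with z hz
  simp only [Function.comp_apply]
  rw [(extChartAt (𝓡 d) x).left_inv hz]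

variable [T2Space M]

theorem exists_bump {x : M} {V : Set M} (hV : V ∈ 𝓝 x) :
    ∃ χ : M → ℝ, ContMDiff (𝓡 d) 𝓘(ℝ, ℝ) ∞ χ ∧ χ =ᶠ[𝓝 x] 1 ∧ tsupport χ ⊆ V := by
  obtain ⟨f, -, hf⟩ := (SmoothBumpFunction.nhds_basis_tsupport (I := 𝓡 d) x).mem_iff.1 hV
  exact ⟨f, f.contMDiff, f.eventuallyEq_one, hf⟩

/-- A function which is smooth near `x` agrees near `x` with a smooth function supported in a
given neighbourhood of `x`. -/
theorem exists_extension {f : M → F} {x : M} {V : Set M} (hV : V ∈ 𝓝 x)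
    (hf : ∀ᶠ y in 𝓝 x, ContMDiffAt (𝓡 d) 𝓘(ℝ, F) ∞ f y) :
    ∃ g : M → F, ContMDiff (𝓡 d) 𝓘(ℝ, F) ∞ g ∧ g =ᶠ[𝓝 x] f ∧ tsupport g ⊆ V := by
  obtain ⟨χ, hχ, hχ1, hχV⟩ := exists_bump (d := d) (inter_mem hV hf)
  refine ⟨fun y => χ y • f y, contMDiff_of_tsupport fun y hy => ?_, ?_, fun y hy => ?_⟩
  · exact hχ.contMDiffAt.smul (hχV (tsupport_smul_subset_left _ _ hy)).2
  · filter_upwards [hχ1] with y hy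
    simp [hy]
  · exact (hχV (tsupport_smul_subset_left _ _ hy)).1

/-- The derivative of a smooth function along a smooth vector field is smooth. -/
theorem contMDiffAt_mfderiv_vectorField {f : M → F} {x : M}
    (hf : ∀ᶠ y in 𝓝 x, ContMDiffAt (𝓡 d) 𝓘(ℝ, F) ∞ f y) {X : ∀ x : M, TangentSpace (𝓡 d) x}
    (hX : ContMDiff (𝓡 d) (𝓡 d).tangent ∞ (fun x => (⟨x, X x⟩ : TangentBundle (𝓡 d) M))) :
    ContMDiffAt (𝓡 d) 𝓘(ℝ, F) ∞ (fun y => (mfderiv (𝓡 d) 𝓘(ℝ, F) f y (X y) : F)) x := by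
  -- Replacing f near x by a globally smooth function makes the smooth tangent map available.
  obtain ⟨g, hg, hgf, -⟩ := exists_extension (d := d) univ_mem hf
  have h1 : ContMDiff (𝓡 d) 𝓘(ℝ, F) ∞ (fun y => (mfderiv (𝓡 d) 𝓘(ℝ, F) g y (X y) : F)) := by
    have h2 : ContMDiff (𝓡 d).tangent 𝓘(ℝ, F).tangent ∞ (tangentMap (𝓡 d) 𝓘(ℝ, F) g) :=
      hg.contMDiff_tangentMap (by simp)
    exact (contMDiff_snd_tangentBundle_modelSpace F 𝓘(ℝ, F)).comp (h2.comp hX)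
  refine h1.contMDiffAt.congr_of_eventuallyEq ?_
  filter_upwards [hgf.eventuallyEq_nhds] with y hy
  exact congrArg (fun T : TangentSpace (𝓡 d) y →L[ℝ] F => T (X y)) hy.symm.mfderiv_eq

/-- Hadamard's lemma on manifolds. -/
theorem exists_hadamard_manifold [CompleteSpace F] {f : M → F} {x : M}
    (hf : ∀ᶠ y in 𝓝 x, ContMDiffAt (𝓡 d) 𝓘(ℝ, F) ∞ f y) :
    ∃ (c : Fin d → M → ℝ) (g : Fin d → M → F), (∀ k, ContMDiff (𝓡 d) 𝓘(ℝ, ℝ) ∞ (c k)) ∧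
      (∀ k, ∀ᶠ y in 𝓝 x, ContMDiffAt (𝓡 d) 𝓘(ℝ, F) ∞ (g k) y) ∧ (∀ k, c k x = 0) ∧
      ∀ᶠ y in 𝓝 x, f y = f x + ∑ k, c k y • g k y := by
  obtain ⟨V, hV, hVo, hxV⟩ := mem_nhds_iff.1 hf
  obtain ⟨hU, hfU⟩ := contDiffOn_comp_extChartAt_symm (d := d) x hVo hV
  let φ := extChartAt (𝓡 d) x
  have hxU : φ x ∈ φ.target ∩ φ.symm ⁻¹' V :=
    ⟨mem_extChartAt_target x, by rwa [Set.mem_preimage, extChartAt_to_inv]⟩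
  -- In the chart, f is replaced by a smooth function on the whole Euclidean space, to which
  -- Hadamard's lemma applies.
  obtain ⟨H, hH, hHf, -⟩ := exists_extension (d := d) (M := EuclideanSpace ℝ (Fin d))
    (f := f ∘ φ.symm) (x := φ x) univ_mem
    (by
      filter_upwards [hU.mem_nhds hxU] with z hz
      exact ((hfU z hz).contDiffAt (hU.mem_nhds hz)).contMDiffAt)
  obtain ⟨g, hg, hHg⟩ := exists_hadamard hH.contDiff (φ x)
  have hs : ∀ᶠ y in 𝓝 x, y ∈ φ.source := extChartAt_source_mem_nhds (I := 𝓡 d) x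
  have hφ : ∀ᶠ y in 𝓝 x, ContMDiffAt (𝓡 d) 𝓘(ℝ, EuclideanSpace ℝ (Fin d)) ∞ φ y := by
    filter_upwards [hs] with y hy
    exact contMDiffAt_extChartAt' (by rwa [extChartAt_source] at hy)
  -- The coordinates are extended to all of M, since the Leibniz rule of a connection is about
  -- globally smooth functions.
  have hex : ∀ k : Fin d, ∃ c : M → ℝ, ContMDiff (𝓡 d) 𝓘(ℝ, ℝ) ∞ c ∧
      c =ᶠ[𝓝 x] (fun y => φ y k - φ x k) := fun k => by
    obtain ⟨c, hc, hcf, -⟩ := exists_extension (d := d) (x := x) (f := fun y => φ y k - φ x k)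
      univ_mem (by
        filter_upwards [hφ] with y hy
        have h1 : ContDiff ℝ ∞ fun z : EuclideanSpace ℝ (Fin d) => z k - φ x k := by fun_prop
        exact h1.contMDiff.contMDiffAt.comp y hy)
    exact ⟨c, hc, hcf⟩
  choose c hc hcf using hex
  refine ⟨c, fun k y => g (φ y) (EuclideanSpace.single k 1), hc, fun k => ?_, fun k => ?_, ?_⟩
  · filter_upwards [hφ] with y hy
    have h1 : ContDiff ℝ ∞ fun z => g z (EuclideanSpace.single k 1) :=
      hg.clm_apply contDiff_const
    exact h1.contMDiff.contMDiffAt.comp y hy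
  · rw [(hcf k).eq_of_nhds, sub_self]
  · filter_upwards [eventually_all.2 hcf, hs,
      (continuousAt_extChartAt (I := 𝓡 d) x).eventually hHf] with y hy hys hyH
    have e1 : f y = H (φ y) := by
      rw [hyH, Function.comp_apply, φ.left_inv hys]
    have e2 : f x = H (φ x) := by
      rw [hHf.eq_of_nhds, Function.comp_apply, extChartAt_to_inv]
    have e3 : φ y - φ x = ∑ k, (φ y k - φ x k) • EuclideanSpace.single k (1 : ℝ) := by
      ext j
      simp [Finset.sum_apply, Pi.single_apply]
    rw [e1, e2, hHg, e3, map_sum]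
    refine congrArg _ (Finset.sum_congr rfl fun k _ => ?_)
    rw [map_smul, hy k]

/-- A family of operators which is smooth in the strong sense is smooth in norm. -/
theorem contMDiffAt_of_strong {B : Type*} [NormedAddCommGroup B] [NormedSpace ℝ B]
    [CompleteSpace F] (ι : B →L[ℝ] F →L[ℝ] G) (hι : ∀ b, ‖ι b‖ = ‖b‖)
    (hB : ∀ (b : ℕ → B) (S : F →L[ℝ] G),
      (∀ h, Tendsto (fun n => ι (b n) h) atTop (𝓝 (S h))) → ∃ c, ι c = S)
    {T : M → B} {V : Set M} (hV : IsOpen V)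
    (hT : ∀ h, ∀ x ∈ V, ContMDiffAt (𝓡 d) 𝓘(ℝ, G) ∞ (fun x => ι (T x) h) x) {x : M} (hx : x ∈ V) :
    ContMDiffAt (𝓡 d) 𝓘(ℝ, B) ∞ T x := by
  have hU := fun h => contDiffOn_comp_extChartAt_symm (d := d) x hV (hT h)
  have h1 := contDiffOn_of_strong ι hι hB (hU 0).1 (T := T ∘ (extChartAt (𝓡 d) x).symm)
    fun h => (hU h).2
  refine contMDiffAt_of_contDiffAt (h1.contDiffAt ((hU 0).1.mem_nhds
    ⟨mem_extChartAt_target x, ?_⟩))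
  rwa [Set.mem_preimage, extChartAt_to_inv]

end

end Manifold

end Analysis

/-! ### Fibers whose endomorphisms are the `A`-linear maps -/

/-- The properties of Hilbert `A`-modules and of `A`-Hilbert spaces used for connections. -/
class LawfulFiberCat (A : outParam (Type u)) [CStarAlgebra A] (C : Type (u + 1)) [Category.{u} C]
    [FiberCat A C] where
  completeSpace : ∀ X : C, CompleteSpace (FiberCat.Sp X)
  ractL : ∀ X : C, FiberCat.Sp X →L[ℂ] A →L[ℂ] FiberCat.Sp X
  ractL_apply : ∀ {X : C} (v : FiberCat.Sp X) (a : A), ractL X v a = FiberCat.ract v a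
  ract_one : ∀ {X : C} (v : FiberCat.Sp X), FiberCat.ract v (1 : A) = v
  ev_ract : ∀ {X Y : C} (f : X ⟶ Y) (v : FiberCat.Sp X) (a : A),
    FiberCat.ev X Y f (FiberCat.ract v a) = FiberCat.ract (FiberCat.ev X Y f v) a
  norm_ev : ∀ {X Y : C} (f : X ⟶ Y), ‖FiberCat.ev X Y f‖ = ‖f‖

attribute [instance] LawfulFiberCat.completeSpace

/-- Every additive right `A`-linear map from `X` to itself is a morphism. -/
def IsAutoRegular {A : Type u} [CStarAlgebra A] {C : Type (u + 1)} [Category.{u} C] [FiberCat A C]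
    (X : C) : Prop :=
  ∀ t : FiberCat.Sp X → FiberCat.Sp X, (∀ v w, t (v + w) = t v + t w) →
    (∀ v (a : A), t (FiberCat.ract v a) = FiberCat.ract (t v) a) →
    ∃ f : X ⟶ X, ∀ v, FiberCat.ev X X f v = t v

section Instances

variable {A : Type u} [CStarAlgebra A]

variable [PartialOrder A] [StarOrderedRing A]

/-- The right action of `A` on a Hilbert `A`-module, as a bounded bilinear map. -/
def HilbMod.ractL (V : HilbMod A) : V →L[ℂ] A →L[ℂ] V :=
  LinearMap.mkContinuous₂
    (LinearMap.mk₂ ℂ (fun (v : V) (a : A) => op a • v)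
      (fun v w a => smul_add _ _ _)
      (fun z v a => by rw [V.smul_eq z, V.smul_eq z, smul_smul, smul_smul, ← MulOpposite.op_mul,
        ← MulOpposite.op_mul, smul_mul_assoc, mul_smul_comm, one_mul, mul_one])
      (fun v a b => add_smul (op a) (op b) v)
      (fun z v a => smul_assoc z (op a) v)) 1
    (fun v a => by
      rw [one_mul]
      exact HilbMod.norm_smul_le v a)

theorem HilbMod.op_one_smul (V : HilbMod A) (v : V) : op (1 : A) • v = v := by
  rw [MulOpposite.op_one, one_smul]

/-- The right action of `A` on a Hilbert space, as a bounded bilinear map. -/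
def HilbSp.ractL (X : HilbSp A) : X →L[ℂ] A →L[ℂ] X :=
  LinearMap.mkContinuous₂
    (LinearMap.mk₂ ℂ (fun (x : X) (a : A) => X.act (op a) x)
      (fun v w a => map_add _ _ _)
      (fun z v a => map_smul _ _ _)
      (fun v a b => by rw [MulOpposite.op_add, map_add]; rfl)
      (fun z v a => by rw [MulOpposite.op_smul, map_smul]; rfl)) 1
    (fun x a => by
      rw [one_mul]
      exact HilbSp.norm_act_le x a)

instance : LawfulFiberCat A (HilbMod A) where
  completeSpace V := V.completeSpace
  ractL V := V.ractL
  ractL_apply _ _ := rfl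
  ract_one {V} v := V.op_one_smul v
  ev_ract f v a := f.2.1 a v
  norm_ev _ := rfl

instance : LawfulFiberCat A (HilbSp A) where
  completeSpace X := X.completeSpace
  ractL X := X.ractL
  ractL_apply _ _ := rfl
  ract_one {X} v := by
    change X.act (op 1) v = v
    rw [MulOpposite.op_one, map_one]
    rfl
  ev_ract f v a := f.2 (op a) v
  norm_ev _ := rfl

end Instances

/-! ### Automatic regularity of A-linear endomorphisms -/

section AutoRegular

variable {A : Type u} [CStarAlgebra A] [PartialOrder A] [StarOrderedRing A]

theorem HilbMod.inn_sum_left (V : HilbMod A) {n : ℕ} (f : Fin n → V) (w : V) :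
    V.inn (∑ k, f k) w = ∑ k, V.inn (f k) w :=
  map_sum (AddMonoidHom.mk' (fun v => V.inn v w) fun v v' => V.inn_add_left v v' w) f Finset.univ

theorem HilbMod.inn_sum_right (V : HilbMod A) {n : ℕ} (f : Fin n → V) (w : V) :
    V.inn w (∑ k, f k) = ∑ k, V.inn w (f k) :=
  map_sum (AddMonoidHom.mk' (fun v => V.inn w v) fun v v' => V.inn_add_right w v v') f Finset.univ

/-- The frame is the image of the standard basis of A^n under the projection onto V: expand j(v) in
A^n and project back. -/
theorem exists_frame {V : HilbMod A} (hV : HilbMod.IsFGProjective V) :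
    ∃ (n : ℕ) (e : Fin n → V), ∀ v, ∑ k, op (V.inn (e k) v) • e k = v := by
  obtain ⟨n, j, p, hjp, h⟩ := hV
  let b : Fin n → HilbMod.free A n := fun k => (Pi.single k 1 : Fin n → A)
  refine ⟨n, fun k => HilbMod.Hom.op p (b k), fun v => ?_⟩
  have e1 : HilbMod.Hom.op p (HilbMod.Hom.op j v) = v := by
    rw [← HilbMod.op_comp, h, HilbMod.op_id]
  have e2 : ∀ m : HilbMod.free A n, ∑ k, op ((HilbMod.free A n).inn (b k) m) • b k = m := by
    intro m
    have hb : ∀ k, (HilbMod.free A n).inn (b k) m = (m : Fin n → A) k := fun k => by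
      change ∑ i, star ((Pi.single k 1 : Fin n → A) i) * (m : Fin n → A) i = _
      rw [Finset.sum_eq_single k]
      · simp
      · intro i _ hi
        rw [Pi.single_eq_of_ne hi, star_zero, zero_mul]
      · simp
    simp_rw [hb]
    change ∑ k, op ((m : Fin n → A) k) • (Pi.single k 1 : Fin n → A) = m
    funext i
    rw [Finset.sum_apply, Finset.sum_eq_single i]
    · simp
    · intro k _ hk
      rw [Pi.smul_apply, Pi.single_eq_of_ne hk.symm, smul_zero]
    · simp
  have e3 : ∀ k, V.inn (HilbMod.Hom.op p (b k)) v =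
      (HilbMod.free A n).inn (b k) (HilbMod.Hom.op j v) := fun k => by
    rw [← V.star_inn, ← hjp, (HilbMod.free A n).star_inn]
  simp_rw [e3]
  conv_rhs => rw [← e1, ← e2 (HilbMod.Hom.op j v), map_sum]
  exact Finset.sum_congr rfl fun k _ => (p.2.1 _ _).symm

/-- In a frame t(v) = ∑ t(eₖ) ⟨eₖ, v⟩, so t has the adjoint w ↦ ∑ eₖ ⟨t(eₖ), w⟩. No continuity has
to be assumed. -/
theorem isAutoRegular_of_isFGProjective (V : HilbMod A) (hV : HilbMod.IsFGProjective V) :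
    IsAutoRegular V := by
  intro (t : V → V) hadd hact
  replace hadd : ∀ v w, t (v + w) = t v + t w := hadd
  replace hact : ∀ (v : V) (a : A), t (op a • v) = op a • t v := hact
  obtain ⟨n, e, he⟩ := exists_frame hV
  have ht : ∀ v, t v = ∑ k, op (V.inn (e k) v) • t (e k) := fun v => by
    conv_lhs => rw [← he v]
    rw [show t = AddMonoidHom.mk' t hadd from rfl, map_sum]
    exact Finset.sum_congr rfl fun k _ => hact _ _
  refine ⟨HilbMod.homMk t (fun w => ∑ k, op (V.inn (t (e k)) w) • e k) fun v w => ?_,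
    fun v => rfl⟩
  rw [ht v, V.inn_sum_left, V.inn_sum_right]
  refine Finset.sum_congr rfl fun k _ => ?_
  rw [V.inn_smul_left, V.inn_smul_right, V.star_inn]

/-- Through the embedding, t becomes an n × n matrix of everywhere defined right A-linear maps on
l²(A). These are bounded by `continuous_of_right_linear`, and t is recovered from the matrix. -/
theorem isAutoRegular_of_isFGProjective_hilbSp {τ : FTrace A} (hK : IsLeftFull τ) (X : HilbSp A)
    (hX : HilbSp.IsFGProjective τ X) : IsAutoRegular X := by
  intro (t : X → X) hadd hact
  replace hadd : ∀ v w, t (v + w) = t v + t w := hadd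
  replace hact : ∀ (v : X) (a : A), t (X.act (op a) v) = X.act (op a) (t v) := hact
  obtain ⟨n, i, -⟩ := hX
  -- Complex scalars act through multiples of 1 in A, so additivity and A-linearity imply
  -- ℂ-linearity.
  have hz : ∀ (z : ℂ) (v : X), z • v = X.act (op (z • (1 : A))) v := fun z v => by
    rw [MulOpposite.op_smul, map_smul, MulOpposite.op_one, map_one]
    rfl
  let t' : X →ₗ[ℂ] X :=
    { toFun := t
      map_add' := hadd
      map_smul' := fun z v => by rw [hz, hact, ← hz]; rfl }
  let s : Fin n → Fin n → L2A τ →ₗ[ℂ] L2A τ := fun k l =>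
    (Ell2.comp k).toLinearMap ∘ₗ i.emb.toLinearMap ∘ₗ t' ∘ₗ i.coproj.toLinearMap ∘ₗ
      (Ell2.single l).toLinearMap
  have hs : ∀ k l b x, s k l ((L2A τ).act (op b) x) = (L2A τ).act (op b) (s k l x) := by
    intro k l b x
    change Ell2.comp k (i.emb (t (i.coproj (Ell2.single l ((L2A τ).act (op b) x))))) = _
    rw [i.coproj_act fun m => Emb.comp_single_act m l b x, hact]
    exact i.map_act _ _ _
  let s' : Fin n → Fin n → L2A τ →L[ℂ] L2A τ := fun k l =>
    ⟨s k l, continuous_of_right_linear hK (s k l) (hs k l)⟩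
  let T : X →L[ℂ] X := ∑ k, ∑ l,
    i.coproj ∘L Ell2.single k ∘L s' k l ∘L Ell2.comp l ∘L i.emb.toContinuousLinearMap
  have hT : ∀ x, T x = t x := fun x => by
    have e1 : ∀ k, ∑ l, s k l (Ell2.comp l (i.emb x)) = Ell2.comp k (i.emb (t x)) := fun k => by
      change ∑ l, ((Ell2.comp k).toLinearMap ∘ₗ i.emb.toLinearMap ∘ₗ t' ∘ₗ i.coproj.toLinearMap)
        (Ell2.single l (Ell2.comp l (i.emb x))) = _
      rw [← map_sum, Ell2.sum_single]
      change Ell2.comp k (i.emb (t (i.coproj (i.emb x)))) = _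
      rw [i.coproj_emb]
    simp only [T, sum_apply, ContinuousLinearMap.comp_apply]
    calc ∑ k, ∑ l, i.coproj (Ell2.single k (s k l (Ell2.comp l (i.emb x))))
        = ∑ k, i.coproj (Ell2.single k (Ell2.comp k (i.emb (t x)))) :=
          Finset.sum_congr rfl fun k _ => by rw [← e1 k, map_sum, map_sum]
      _ = t x := by rw [← map_sum, Ell2.sum_single, i.coproj_emb]
  exact ⟨⟨T, fun a x => by rw [hT, hT]; exact hact x a.unop⟩, hT⟩

end AutoRegular

/-! ### Sections in local trivializations -/

section LocalSections

open Filter Topology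

/-- A complex bilinear map as a real bilinear map. -/
def realBilin {F G K : Type*} [NormedAddCommGroup F] [NormedSpace ℂ F] [NormedAddCommGroup G]
    [NormedSpace ℂ G] [NormedAddCommGroup K] [NormedSpace ℂ K] (B : F →L[ℂ] G →L[ℂ] K) :
    F →L[ℝ] G →L[ℝ] K :=
  (ContinuousLinearMap.restrictScalarsL ℂ G K ℝ ℝ) ∘L (B.restrictScalars ℝ)

variable {A : Type u} [CStarAlgebra A] {C : Type (u + 1)} [Category.{u} C] [FiberCat A C]

theorem ev_iso_hom_inv {X Y : C} (e : X ≅ Y) (v : FiberCat.Sp X) :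
    FiberCat.ev _ _ e.inv (FiberCat.ev _ _ e.hom v) = v := by
  rw [← FiberCat.ev_comp, Iso.hom_inv_id, FiberCat.ev_id]

theorem ev_iso_inv_hom {X Y : C} (e : X ≅ Y) (v : FiberCat.Sp Y) :
    FiberCat.ev _ _ e.hom (FiberCat.ev _ _ e.inv v) = v := by
  rw [← FiberCat.ev_comp, Iso.inv_hom_id, FiberCat.ev_id]

theorem ev_iso_injective {X Y : C} (e : X ≅ Y) : Function.Injective (FiberCat.ev _ _ e.hom) :=
  Function.LeftInverse.injective (ev_iso_hom_inv e)

namespace HBundle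

variable {M : Type w} [TopologicalSpace M]

section

variable {R : Regularity.{u} M} {P : ObjectProperty C}

open Classical in
/-- A family of vectors in the fibers, in a local trivialization. -/
def trivialize (E : HBundle R P) (i : E.ι) (s : ∀ x, FiberCat.Sp (E.fiber x)) :
    M → FiberCat.Sp (E.model i) := fun y =>
  if h : y ∈ E.U i then FiberCat.ev _ _ (E.triv i y h).hom (s y) else 0

variable {E E' : HBundle R P}

theorem trivialize_of_mem {i : E.ι} {y : M} (h : y ∈ E.U i) (s : ∀ x, FiberCat.Sp (E.fiber x)) :
    E.trivialize i s y = FiberCat.ev _ _ (E.triv i y h).hom (s y) := dif_pos h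

theorem trivialize_injective {i : E.ι} {y : M} (h : y ∈ E.U i)
    {s t : ∀ x, FiberCat.Sp (E.fiber x)} (hst : E.trivialize i s y = E.trivialize i t y) :
    s y = t y := by
  rw [trivialize_of_mem h, trivialize_of_mem h] at hst
  exact ev_iso_injective _ hst

theorem localRep_of_mem {f : ∀ x, E.fiber x ⟶ E'.fiber x} {i : E.ι} {j : E'.ι} {y : M}
    (hi : y ∈ E.U i) (hj : y ∈ E'.U j) :
    localRep E E' f i j y = (E.triv i y hi).inv ≫ f y ≫ (E'.triv j y hj).hom := dif_pos ⟨hi, hj⟩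

theorem ev_localRep {f : ∀ x, E.fiber x ⟶ E'.fiber x} {i : E.ι} {j : E'.ι} {y : M}
    (hi : y ∈ E.U i) (hj : y ∈ E'.U j) (s : ∀ x, FiberCat.Sp (E.fiber x)) :
    FiberCat.ev _ _ (localRep E E' f i j y) (E.trivialize i s y) =
      E'.trivialize j (fun x => FiberCat.ev _ _ (f x) (s x)) y := by
  rw [localRep_of_mem hi hj, trivialize_of_mem hi, trivialize_of_mem hj, FiberCat.ev_comp,
    FiberCat.ev_comp, ev_iso_hom_inv]

theorem trivialize_change {i j : E.ι} {y : M} (hi : y ∈ E.U i) (hj : y ∈ E.U j)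
    (s : ∀ x, FiberCat.Sp (E.fiber x)) :
    FiberCat.ev _ _ (localRep E E (fun _ => 𝟙 _) i j y) (E.trivialize i s y) =
      E.trivialize j s y := by
  rw [ev_localRep hi hj]
  exact congrArg (fun s => E.trivialize j s y) (funext fun x => FiberCat.ev_id _)

theorem trivialize_add (i : E.ι) (s t : ∀ x, FiberCat.Sp (E.fiber x)) :
    E.trivialize i (s + t) = E.trivialize i s + E.trivialize i t := by
  funext y
  by_cases h : y ∈ E.U i
  · simp only [Pi.add_apply, trivialize_of_mem h, map_add]
  · simp [trivialize, h]

theorem trivialize_neg (i : E.ι) (s : ∀ x, FiberCat.Sp (E.fiber x)) :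
    E.trivialize i (-s) = -E.trivialize i s := by
  funext y
  by_cases h : y ∈ E.U i
  · simp only [Pi.neg_apply, trivialize_of_mem h, map_neg]
  · simp [trivialize, h]

theorem trivialize_zero (i : E.ι) : E.trivialize i 0 = 0 := by
  funext y
  by_cases h : y ∈ E.U i
  · simp only [Pi.zero_apply, trivialize_of_mem h, map_zero]
  · simp [trivialize, h]

theorem trivialize_ract [LawfulFiberCat A C] {i : E.ι} {y : M} (h : y ∈ E.U i)
    (s : ∀ x, FiberCat.Sp (E.fiber x)) (f : M → A) :
    E.trivialize i (fun x => FiberCat.ract (s x) (f x)) y =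
      LawfulFiberCat.ractL _ (E.trivialize i s y) (f y) := by
  rw [trivialize_of_mem h, trivialize_of_mem h, LawfulFiberCat.ev_ract,
    LawfulFiberCat.ractL_apply]

end

variable {d : ℕ} [ChartedSpace (EuclideanSpace ℝ (Fin d)) M] {P : ObjectProperty C}
  {E E' : HBundle (smoothReg d M) P}

theorem Sec.smoothAt (s : E.Sec) {i : E.ι} {x : M} (hx : x ∈ E.U i) :
    ContMDiffAt (𝓡 d) 𝓘(ℝ, FiberCat.Sp (E.model i)) ∞ (E.trivialize i s.1) x := s.2 i x hx

theorem Sec.eventually_smoothAt (s : E.Sec) {i : E.ι} {x : M} (hx : x ∈ E.U i) :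
    ∀ᶠ y in 𝓝 x, ContMDiffAt (𝓡 d) 𝓘(ℝ, FiberCat.Sp (E.model i)) ∞ (E.trivialize i s.1) y := by
  filter_upwards [(E.isOpen i).mem_nhds hx] with y hy using s.smoothAt hy

theorem Hom.smoothAt (f : E ⟶ E') {i : E.ι} {j : E'.ι} {x : M} (hi : x ∈ E.U i)
    (hj : x ∈ E'.U j) : ContMDiffAt (𝓡 d) 𝓘(ℝ, E.model i ⟶ E'.model j) ∞
      (localRep E E' (Hom.at f) i j) x := HBundle.Hom.regular f i j x hi hj

theorem localRep_id_smoothAt {i j : E.ι} {x : M} (hi : x ∈ E.U i) (hj : x ∈ E.U j) :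
    ContMDiffAt (𝓡 d) 𝓘(ℝ, E.model i ⟶ E.model j) ∞ (localRep E E (fun _ => 𝟙 _) i j) x :=
  Hom.smoothAt (𝟙 E) hi hj

/-- Transition functions are smooth, so one trivialization around each point is enough. -/
theorem isSection_of_cover {s : ∀ x, FiberCat.Sp (E.fiber x)}
    (h : ∀ x, ∃ i, x ∈ E.U i ∧
      ContMDiffAt (𝓡 d) 𝓘(ℝ, FiberCat.Sp (E.model i)) ∞ (E.trivialize i s) x) :
    E.IsSection s := by
  intro j x hj
  obtain ⟨i, hi, hs⟩ := h x
  refine (smoothReg d M).congr ?_ ((smoothReg d M).bilin (FiberCat.ev _ _)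
    (localRep_id_smoothAt hi hj) hs)
  filter_upwards [(E.isOpen i).mem_nhds hi, (E.isOpen j).mem_nhds hj] with y hyi hyj
  exact trivialize_change hyi hyj s

instance : AddCommGroup E.Sec :=
  inferInstanceAs (AddCommGroup
    ({ carrier := {s | E.IsSection s}
       add_mem' := fun {s t} hs ht i x hx => by
        have h := (show ContMDiffAt (𝓡 d) 𝓘(ℝ, FiberCat.Sp (E.model i)) ∞ (E.trivialize i s) x
          from hs i x hx).add (show ContMDiffAt (𝓡 d) 𝓘(ℝ, FiberCat.Sp (E.model i)) ∞
            (E.trivialize i t) x from ht i x hx)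
        rw [← trivialize_add] at h
        exact h
       zero_mem' := fun i x hx => by
        change ContMDiffAt (𝓡 d) 𝓘(ℝ, FiberCat.Sp (E.model i)) ∞ (E.trivialize i 0) x
        rw [trivialize_zero]
        exact contMDiffAt_const
       neg_mem' := fun {s} hs i x hx => by
        have h := (show ContMDiffAt (𝓡 d) 𝓘(ℝ, FiberCat.Sp (E.model i)) ∞ (E.trivialize i s) x
          from hs i x hx).neg
        change ContMDiffAt (𝓡 d) 𝓘(ℝ, FiberCat.Sp (E.model i)) ∞ (E.trivialize i (-s)) x
        rw [trivialize_neg]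
        exact h } : AddSubgroup (∀ x, FiberCat.Sp (E.fiber x))))

theorem Sec.add_val (s t : E.Sec) : (s + t).1 = s.1 + t.1 := rfl

theorem Sec.sum_val (n : ℕ) (s : Fin n → E.Sec) (x : M) : (∑ k, s k).1 x = ∑ k, (s k).1 x :=
  map_sum (AddMonoidHom.mk' (fun s : E.Sec => s.1 x) fun _ _ => rfl) s Finset.univ

variable [LawfulFiberCat A C]

/-- The product of a section and a smooth function. -/
def Sec.ract (s : E.Sec) (f : M → A) (hf : ContMDiff (𝓡 d) 𝓘(ℝ, A) ∞ f) : E.Sec :=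
  ⟨fun x => FiberCat.ract (s.1 x) (f x), fun i x hx => by
    refine (smoothReg d M).congr ?_ ((smoothReg d M).bilin
      (LawfulFiberCat.ractL (E.model i)) (s.2 i x hx) (hf x))
    filter_upwards [(E.isOpen i).mem_nhds hx] with y hy
    exact (trivialize_ract hy s.1 f).symm⟩

variable [IsManifold (𝓡 d) ∞ M] [T2Space M]

/-- Local sections extend to global ones, after shrinking the neighbourhood. -/
theorem exists_sec {i : E.ι} {x : M} (hx : x ∈ E.U i) {G : M → FiberCat.Sp (E.model i)}
    (hG : ∀ᶠ y in 𝓝 x, ContMDiffAt (𝓡 d) 𝓘(ℝ, FiberCat.Sp (E.model i)) ∞ G y) :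
    ∃ s : E.Sec, E.trivialize i s.1 =ᶠ[𝓝 x] G := by
  classical
  obtain ⟨g, hg, hgG, hgU⟩ := exists_extension (d := d) ((E.isOpen i).mem_nhds hx) hG
  let s : ∀ y, FiberCat.Sp (E.fiber y) := fun y =>
    if h : y ∈ E.U i then FiberCat.ev _ _ (E.triv i y h).inv (g y) else 0
  have hs : ∀ y ∈ E.U i, E.trivialize i s y = g y := fun y hy => by
    rw [trivialize_of_mem hy]
    simp only [s, hy, dite_true]
    exact ev_iso_inv_hom _ _
  refine ⟨⟨s, isSection_of_cover fun y => ?_⟩, ?_⟩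
  · by_cases hy : y ∈ E.U i
    · refine ⟨i, hy, (hg y).congr_of_eventuallyEq ?_⟩
      filter_upwards [(E.isOpen i).mem_nhds hy] with z hz using hs z hz
    -- Outside `E.U i` the section vanishes near y, because the support of g is closed and contained
    -- in `E.U i`.
    · obtain ⟨j, hj⟩ := E.cover y
      refine ⟨j, hj, (contMDiffAt_const (c := 0)).congr_of_eventuallyEq ?_⟩
      have hy' : y ∉ tsupport g := fun h => hy (hgU h)
      filter_upwards [(isClosed_tsupport g).isOpen_compl.mem_nhds hy',
        (E.isOpen j).mem_nhds hj] with z hz hzj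
      have hz0 : s z = 0 := by
        simp only [s]
        split_ifs
        · rw [image_eq_zero_of_notMem_tsupport hz, map_zero]
        · rfl
      rw [trivialize_of_mem hzj, hz0, map_zero]
  · filter_upwards [hgG, (E.isOpen i).mem_nhds hx] with y hy hyi
    rw [hs y hyi, hy]

theorem exists_const_sec {i : E.ι} {x : M} (hx : x ∈ E.U i) (η : FiberCat.Sp (E.model i)) :
    ∃ s : E.Sec, E.trivialize i s.1 =ᶠ[𝓝 x] fun _ => η :=
  exists_sec hx (Eventually.of_forall fun _ => contMDiffAt_const)

end HBundle

end LocalSections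

/-! ### Connection forms -/

section ConnectionForms

open Filter Topology HBundle

variable {A : Type u} [CStarAlgebra A] {C : Type (u + 1)} [Category.{u} C] [FiberCat A C]
  {M : Type w} [TopologicalSpace M] {d : ℕ} [ChartedSpace (EuclideanSpace ℝ (Fin d)) M]
  {P : ObjectProperty C} {E E' : HBundle (smoothReg d M) P}

/-- The derivative of a function with values in a Banach space. -/
def mder {F : Type*} [NormedAddCommGroup F] [NormedSpace ℝ F] (f : M → F) (x : M)
    (v : TangentSpace (𝓡 d) x) : F := mfderiv (𝓡 d) 𝓘(ℝ, F) f x v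

section mder

variable {F G K : Type*} [NormedAddCommGroup F] [NormedSpace ℝ F] [NormedAddCommGroup G]
  [NormedSpace ℝ G] [NormedAddCommGroup K] [NormedSpace ℝ K] {x : M} (v : TangentSpace (𝓡 d) x)

theorem mder_congr {f g : M → F} (h : f =ᶠ[𝓝 x] g) : mder f x v = mder g x v :=
  congrArg (fun T : TangentSpace (𝓡 d) x →L[ℝ] F => T v) h.mfderiv_eq

theorem mder_const (c : F) : mder (fun _ => c) x v = 0 := by
  rw [mder, mfderiv_const]
  rfl

theorem mder_add {f g : M → F} (hf : ContMDiffAt (𝓡 d) 𝓘(ℝ, F) ∞ f x)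
    (hg : ContMDiffAt (𝓡 d) 𝓘(ℝ, F) ∞ g x) : mder (f + g) x v = mder f x v + mder g x v :=
  congrArg (fun T : TangentSpace (𝓡 d) x →L[ℝ] F => T v)
    (mfderiv_add (mdifferentiableAt_of_smooth hf) (mdifferentiableAt_of_smooth hg))

theorem mder_clm (L : F →L[ℝ] G) {f : M → F} (hf : ContMDiffAt (𝓡 d) 𝓘(ℝ, F) ∞ f x) :
    mder (fun y => L (f y)) x v = L (mder f x v) := mfderiv_clm L hf v

theorem mder_bilin (B : F →L[ℝ] G →L[ℝ] K) {f : M → F} {g : M → G}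
    (hf : ContMDiffAt (𝓡 d) 𝓘(ℝ, F) ∞ f x) (hg : ContMDiffAt (𝓡 d) 𝓘(ℝ, G) ∞ g x) :
    mder (fun y => B (f y) (g y)) x v = B (f x) (mder g x v) + B (mder f x v) (g x) :=
  mfderiv_bilin B hf hg v

theorem contMDiffAt_fintype_sum {n : ℕ} {f : Fin n → M → F}
    (hf : ∀ k, ContMDiffAt (𝓡 d) 𝓘(ℝ, F) ∞ (f k) x) (s : Finset (Fin n)) :
    ContMDiffAt (𝓡 d) 𝓘(ℝ, F) ∞ (fun y => ∑ k ∈ s, f k y) x :=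
  contMDiffAt_finsetSum fun k _ => hf k

theorem mder_sum {n : ℕ} {f : Fin n → M → F} (hf : ∀ k, ContMDiffAt (𝓡 d) 𝓘(ℝ, F) ∞ (f k) x)
    (s : Finset (Fin n)) : mder (fun y => ∑ k ∈ s, f k y) x v = ∑ k ∈ s, mder (f k) x v := by
  induction s using Finset.induction_on with
  | empty => simpa using mder_const v (0 : F)
  | insert k s hk ih =>
    rw [Finset.sum_insert hk, ← ih, ← mder_add v (hf k) (contMDiffAt_fintype_sum hf s)]
    refine mder_congr v (Eventually.of_forall fun y => ?_)
    exact Finset.sum_insert hk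

end mder

variable [IsManifold (𝓡 d) ∞ M]

variable (E) in
/-- Endomorphism-valued one-forms in the local trivializations. -/
abbrev LocalForm : Type (max u w) :=
  ∀ (i : E.ι) (x : M), TangentSpace (𝓡 d) x → (E.model i ⟶ E.model i)

/-- The morphism `f` intertwines `d + θ` and `d + θ'`. -/
def Intertwines (θ : LocalForm E) (θ' : LocalForm E') (f : ∀ x, E.fiber x ⟶ E'.fiber x) : Prop :=
  ∀ i j x, x ∈ E.U i → x ∈ E'.U j → ∀ v : TangentSpace (𝓡 d) x,
    mder (localRep E E' f i j) x v + localRep E E' f i j x ≫ θ' j x v =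
      θ i x v ≫ localRep E E' f i j x

/-- The local forms `θ` define a connection `d + θ`. -/
structure IsConnForm (θ : LocalForm E) : Prop where
  add : ∀ i x, x ∈ E.U i → ∀ v w, θ i x (v + w) = θ i x v + θ i x w
  smul : ∀ i x, x ∈ E.U i → ∀ (r : ℝ) v, θ i x (r • v) = r • θ i x v
  smooth : ∀ i x, x ∈ E.U i → ∀ X : ∀ x : M, TangentSpace (𝓡 d) x,
    ContMDiff (𝓡 d) (𝓡 d).tangent ∞ (fun x => (⟨x, X x⟩ : TangentBundle (𝓡 d) M)) →
    ContMDiffAt (𝓡 d) 𝓘(ℝ, E.model i ⟶ E.model i) ∞ (fun y => θ i y (X y)) x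
  compat : Intertwines θ θ fun _ => 𝟙 _

/-- In local trivializations, the covariant derivative is `(d + θ) s`. -/
def covLocal (θ : LocalForm E) (i : E.ι) (s : ∀ x, FiberCat.Sp (E.fiber x)) (x : M)
    (v : TangentSpace (𝓡 d) x) : FiberCat.Sp (E.model i) :=
  mder (E.trivialize i s) x v + FiberCat.ev _ _ (θ i x v) (E.trivialize i s x)

theorem covLocal_add_right {θ : LocalForm E} (hθ : IsConnForm θ) {i : E.ι} {x : M}
    (hx : x ∈ E.U i) (s : ∀ x, FiberCat.Sp (E.fiber x)) (v w : TangentSpace (𝓡 d) x) :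
    covLocal θ i s x (v + w) = covLocal θ i s x v + covLocal θ i s x w := by
  have h : mder (E.trivialize i s) x (v + w) =
      mder (E.trivialize i s) x v + mder (E.trivialize i s) x w := map_add _ v w
  rw [covLocal, covLocal, covLocal, hθ.add i x hx, map_add, add_apply, h, add_add_add_comm]

theorem covLocal_smul_right {θ : LocalForm E} (hθ : IsConnForm θ) {i : E.ι} {x : M}
    (hx : x ∈ E.U i) (s : ∀ x, FiberCat.Sp (E.fiber x)) (r : ℝ) (v : TangentSpace (𝓡 d) x) :
    covLocal θ i s x (r • v) = r • covLocal θ i s x v := by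
  have h : mder (E.trivialize i s) x (r • v) = r • mder (E.trivialize i s) x v := map_smul _ r v
  rw [covLocal, covLocal, hθ.smul i x hx, h, smul_add, ← Complex.coe_smul r (θ _ _ _), map_smul,
    smul_apply, Complex.coe_smul]

/-- This is the product rule for f s in trivializations, with the derivative of f eliminated by the
intertwining equation. -/
theorem ev_covLocal {θ : LocalForm E} {θ' : LocalForm E'} {f : E ⟶ E'}
    (h : Intertwines θ θ' (Hom.at f)) (s : E.Sec) {i : E.ι} {j : E'.ι} {x : M} (hi : x ∈ E.U i)
    (hj : x ∈ E'.U j) (v : TangentSpace (𝓡 d) x) :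
    covLocal θ' j (s.map f).1 x v =
      FiberCat.ev _ _ (localRep E E' (Hom.at f) i j x) (covLocal θ i s.1 x v) := by
  have e1 : E'.trivialize j (s.map f).1 =ᶠ[𝓝 x] fun y =>
      realBilin (FiberCat.ev _ _) (localRep E E' (Hom.at f) i j y) (E.trivialize i s.1 y) := by
    filter_upwards [(E.isOpen i).mem_nhds hi, (E'.isOpen j).mem_nhds hj] with y hyi hyj
    exact (ev_localRep hyi hyj s.1).symm
  have e2 := congrArg (fun T => FiberCat.ev _ _ T (E.trivialize i s.1 x)) (h i j x hi hj v)
  simp only [map_add, add_apply, FiberCat.ev_comp] at e2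
  rw [covLocal, covLocal, mder_congr v e1, mder_bilin v _ (Hom.smoothAt f hi hj) (s.smoothAt hi),
    e1.eq_of_nhds, map_add, ← e2, ← add_assoc]
  rfl

theorem Sec.map_id (s : E.Sec) : s.map (𝟙 E) = s :=
  Subtype.ext (funext fun _ => FiberCat.ev_id _)

theorem ev_covLocal_change {θ : LocalForm E} (h : Intertwines θ θ fun _ => 𝟙 _) (s : E.Sec)
    {i j : E.ι} {x : M} (hi : x ∈ E.U i) (hj : x ∈ E.U j) (v : TangentSpace (𝓡 d) x) :
    covLocal θ j s.1 x v =
      FiberCat.ev _ _ (localRep E E (fun _ => 𝟙 _) i j x) (covLocal θ i s.1 x v) := by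
  have := ev_covLocal (f := 𝟙 E) h s hi hj v
  rwa [Sec.map_id] at this

/-- The connection `D` is `d + θ` in local trivializations. -/
def HasForm (D : Connection E) (θ : LocalForm E) : Prop :=
  ∀ (s : E.Sec) i x (hx : x ∈ E.U i) (v : TangentSpace (𝓡 d) x),
    FiberCat.ev _ _ (E.triv i x hx).hom (D.cov s x v) = covLocal θ i s.1 x v

theorem HasForm.ext {D D' : Connection E} {θ : LocalForm E} (h : HasForm D θ)
    (h' : HasForm D' θ) : D = D' := by
  refine Connection.ext (funext fun s => funext fun x => ContinuousLinearMap.ext fun v => ?_)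
  obtain ⟨i, hi⟩ := E.cover x
  exact ev_iso_injective (E.triv i x hi) ((h s i x hi v).trans (h' s i x hi v).symm)

theorem HasForm.congr {D : Connection E} {θ θ' : LocalForm E} (h : HasForm D θ)
    (e : ∀ i x, x ∈ E.U i → ∀ v, θ i x v = θ' i x v) : HasForm D θ' := by
  intro s i x hx v
  rw [h s i x hx v, covLocal, covLocal, e i x hx v]

/-- The connection as a homomorphism. -/
def Connection.covHom (D : Connection E) (x : M) (v : TangentSpace (𝓡 d) x) :
    E.Sec →+ FiberCat.Sp (E.fiber x) :=
  AddMonoidHom.mk' (fun s => D.cov s x v) fun s t => by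
    rw [D.add s t (s + t) (fun _ => rfl) x]
    rfl

variable [LawfulFiberCat A C]

theorem Connection.leibniz_mder (D : Connection E) (s : E.Sec) {f : M → A}
    (hf : ContMDiff (𝓡 d) 𝓘(ℝ, A) ∞ f) (x : M) (v : TangentSpace (𝓡 d) x) :
    D.cov (s.ract f hf) x v = LawfulFiberCat.ractL _ (s.1 x) (mder f x v) +
      LawfulFiberCat.ractL _ (D.cov s x v) (f x) := by
  rw [LawfulFiberCat.ractL_apply, LawfulFiberCat.ractL_apply]
  exact D.leibniz s _ f hf (fun _ => rfl) x v

variable [T2Space M]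

/-- Connections are local. If r vanishes near x and χ is a bump function at x supported where r
vanishes, then r = r f with f = 1 − χ; since r(x) = 0 and f(x) = 0, the Leibniz rule gives ∇r(x) =
0. -/
theorem Connection.cov_congr (D : Connection E) {s t : E.Sec} {x : M}
    (h : ∀ᶠ y in 𝓝 x, s.1 y = t.1 y) (v : TangentSpace (𝓡 d) x) : D.cov s x v = D.cov t x v := by
  rw [← sub_eq_zero]
  change D.covHom x v s - D.covHom x v t = 0
  rw [← map_sub]
  change D.cov (s - t) x v = 0
  have h0 : ∀ᶠ y in 𝓝 x, (s - t).1 y = 0 := by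
    filter_upwards [h] with y hy
    exact sub_eq_zero.2 hy
  generalize s - t = r at h0 ⊢
  obtain ⟨χ, hχ, hχ1, hχV⟩ := exists_bump (d := d) h0
  let f : M → A := fun y => (1 - χ y) • (1 : A)
  have hf : ContMDiff (𝓡 d) 𝓘(ℝ, A) ∞ f := (contMDiff_const.sub hχ).smul contMDiff_const
  have hfx : f x = 0 := by
    simp only [f, hχ1.eq_of_nhds, Pi.one_apply, sub_self, zero_smul]
  have hr : r.ract f hf = r := Subtype.ext (funext fun y => by
    change FiberCat.ract (r.1 y) (f y) = r.1 y
    by_cases hy : y ∈ tsupport χ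
    · rw [hχV hy, ← LawfulFiberCat.ractL_apply, map_zero, zero_apply]
    · simp only [f, image_eq_zero_of_notMem_tsupport hy, sub_zero, one_smul,
        LawfulFiberCat.ract_one])
  have key := D.leibniz_mder r hf x v
  rwa [hr, hfx, h0.self_of_nhds, map_zero, map_zero, zero_apply, add_zero] at key

theorem Connection.cov_congr_trivialize (D : Connection E) {s t : E.Sec} {i : E.ι} {x : M}
    (hx : x ∈ E.U i) (h : E.trivialize i s.1 =ᶠ[𝓝 x] E.trivialize i t.1)
    (v : TangentSpace (𝓡 d) x) : D.cov s x v = D.cov t x v := by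
  refine D.cov_congr ?_ v
  filter_upwards [h, (E.isOpen i).mem_nhds hx] with y hy hyi using trivialize_injective hyi hy

/-- The covariant derivative of a constant local section. -/
def Connection.formAt (D : Connection E) {i : E.ι} {x : M} (hx : x ∈ E.U i)
    (v : TangentSpace (𝓡 d) x) (η : FiberCat.Sp (E.model i)) : FiberCat.Sp (E.model i) :=
  FiberCat.ev _ _ (E.triv i x hx).hom (D.cov (exists_const_sec hx η).choose x v)

theorem Connection.formAt_eq (D : Connection E) {i : E.ι} {x : M} (hx : x ∈ E.U i)
    (v : TangentSpace (𝓡 d) x) {η : FiberCat.Sp (E.model i)} {s : E.Sec}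
    (hs : E.trivialize i s.1 =ᶠ[𝓝 x] fun _ => η) :
    FiberCat.ev _ _ (E.triv i x hx).hom (D.cov s x v) = D.formAt hx v η :=
  congrArg _ (D.cov_congr_trivialize hx (hs.trans (exists_const_sec hx η).choose_spec.symm) v)

theorem Connection.formAt_add (D : Connection E) {i : E.ι} {x : M} (hx : x ∈ E.U i)
    (v : TangentSpace (𝓡 d) x) (η η' : FiberCat.Sp (E.model i)) :
    D.formAt hx v (η + η') = D.formAt hx v η + D.formAt hx v η' := by
  obtain ⟨s, hs⟩ := exists_const_sec hx η
  obtain ⟨t, ht⟩ := exists_const_sec hx η'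
  rw [← D.formAt_eq hx v hs, ← D.formAt_eq hx v ht, ← D.formAt_eq hx v (s := s + t), ← map_add]
  · exact congrArg _ ((D.covHom x v).map_add s t)
  · rw [Sec.add_val, trivialize_add]
    exact hs.add ht

theorem Connection.formAt_ract (D : Connection E) {i : E.ι} {x : M} (hx : x ∈ E.U i)
    (v : TangentSpace (𝓡 d) x) (η : FiberCat.Sp (E.model i)) (a : A) :
    D.formAt hx v (FiberCat.ract η a) = FiberCat.ract (D.formAt hx v η) a := by
  obtain ⟨s, hs⟩ := exists_const_sec hx η
  rw [← D.formAt_eq hx v hs,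
    ← D.formAt_eq hx v (s := s.ract (fun _ => a) contMDiff_const), ← LawfulFiberCat.ev_ract]
  · rw [D.leibniz_mder, mder_const, map_zero, zero_add, LawfulFiberCat.ractL_apply]
  · filter_upwards [hs, (E.isOpen i).mem_nhds hx] with y hy hyi
    refine (trivialize_ract hyi s.1 fun _ => a).trans ?_
    rw [hy, LawfulFiberCat.ractL_apply]

/-- The covariant derivative in local trivializations. -/
theorem Connection.ev_cov (D : Connection E) (s : E.Sec) {i : E.ι} {x : M} (hx : x ∈ E.U i)
    (v : TangentSpace (𝓡 d) x) :
    FiberCat.ev _ _ (E.triv i x hx).hom (D.cov s x v) =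
      mder (E.trivialize i s.1) x v + D.formAt hx v (E.trivialize i s.1 x) := by
  -- Near x the section is a constant one plus ∑ cₖ gₖ with cₖ(x) = 0. By locality, additivity and
  -- the Leibniz rule, the second part contributes ∑ dcₖ(v) gₖ(x), which is also the derivative of
  -- the section at x.
  obtain ⟨c, g, hc, hg, hc0, h⟩ := exists_hadamard_manifold (d := d) (s.eventually_smoothAt hx)
  have hcA : ∀ k, ContMDiff (𝓡 d) 𝓘(ℝ, A) ∞ fun y => c k y • (1 : A) := fun k =>
    (hc k).smul contMDiff_const
  have hsm : ∀ (q : ℝ) (η : FiberCat.Sp (E.model i)),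
      LawfulFiberCat.ractL (E.model i) η (q • (1 : A)) = q • η := fun q η => by
    rw [← Complex.coe_smul, map_smul, LawfulFiberCat.ractL_apply, LawfulFiberCat.ract_one,
      Complex.coe_smul]
  obtain ⟨s₀, hs₀⟩ := exists_const_sec hx (E.trivialize i s.1 x)
  choose t ht using fun k => exists_sec hx (hg k)
  let r : E.Sec := ∑ k, (t k).ract _ (hcA k)
  have hr : ∀ᶠ y in 𝓝 x, s.1 y = (s₀ + r).1 y := by
    filter_upwards [h, hs₀, eventually_all.2 ht, (E.isOpen i).mem_nhds hx] with y hy h0 hty hyi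
    refine trivialize_injective hyi ?_
    rw [hy, Sec.add_val, trivialize_add, Pi.add_apply, h0, trivialize_of_mem hyi r.1, Sec.sum_val,
      map_sum]
    refine congrArg _ (Finset.sum_congr rfl fun k _ => ?_)
    rw [← trivialize_of_mem hyi]
    refine Eq.trans ?_ (trivialize_ract hyi (t k).1 fun y => c k y • (1 : A)).symm
    rw [hty k, hsm]
  have hgx : ∀ k, ContMDiffAt (𝓡 d) 𝓘(ℝ, FiberCat.Sp (E.model i)) ∞
      (fun y => c k y • g k y) x := fun k => (hc k x).smul (hg k).self_of_nhds
  have e1 : mder (E.trivialize i s.1) x v = ∑ k, mder (c k) x v • g k x := by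
    rw [mder_congr v h]
    refine (mder_add v contMDiffAt_const (contMDiffAt_fintype_sum hgx Finset.univ)).trans ?_
    rw [mder_const, zero_add, mder_sum v hgx]
    refine Finset.sum_congr rfl fun k _ => ?_
    refine (mder_bilin v (ContinuousLinearMap.lsmul ℝ ℝ) (hc k x) (hg k).self_of_nhds).trans ?_
    simp [hc0]
  have e2 : ∀ k, FiberCat.ev _ _ (E.triv i x hx).hom (D.cov ((t k).ract _ (hcA k)) x v) =
      mder (c k) x v • g k x := fun k => by
    have h1 : mder (fun y => c k y • (1 : A)) x v = mder (c k) x v • (1 : A) :=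
      mder_clm v ((ContinuousLinearMap.id ℝ ℝ).smulRight (1 : A)) (hc k x)
    rw [D.leibniz_mder, h1, hc0, zero_smul, map_zero, add_zero, LawfulFiberCat.ractL_apply,
      LawfulFiberCat.ev_ract, ← trivialize_of_mem hx, (ht k).eq_of_nhds,
      ← LawfulFiberCat.ractL_apply, hsm]
  rw [D.cov_congr hr, e1, ← D.formAt_eq hx v hs₀]
  have e3 : D.cov (s₀ + r) x v = D.cov s₀ x v + ∑ k, D.cov ((t k).ract _ (hcA k)) x v := by
    refine ((D.covHom x v).map_add s₀ r).trans (congrArg _ ?_)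
    exact map_sum (D.covHom x v) _ _
  rw [e3, map_add, map_sum, Finset.sum_congr rfl fun k _ => e2 k, add_comm]

theorem ev_injective {X Y : C} {f g : X ⟶ Y} (h : ∀ v, FiberCat.ev X Y f v = FiberCat.ev X Y g v) :
    f = g := by
  rw [← sub_eq_zero, ← norm_eq_zero, ← LawfulFiberCat.norm_ev, norm_eq_zero, map_sub, sub_eq_zero]
  exact ContinuousLinearMap.ext h

theorem HasForm.ev_form {D : Connection E} {θ : LocalForm E} (h : HasForm D θ) {i : E.ι} {x : M}
    (hx : x ∈ E.U i) (v : TangentSpace (𝓡 d) x) {η : FiberCat.Sp (E.model i)} {s : E.Sec}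
    (hs : E.trivialize i s.1 =ᶠ[𝓝 x] fun _ => η) :
    FiberCat.ev _ _ (E.triv i x hx).hom (D.cov s x v) = FiberCat.ev _ _ (θ i x v) η := by
  rw [h s i x hx v, covLocal, mder_congr v hs, mder_const, zero_add, hs.eq_of_nhds]

/-- The covariant derivative of constant local sections is only known to be additive and A-linear;
automatic regularity of the models makes it a morphism. -/
theorem exists_hasForm (hP : ∀ X, P X → IsAutoRegular X) (D : Connection E) :
    ∃ θ : LocalForm E, HasForm D θ := by
  classical
  have H : ∀ i x (hx : x ∈ E.U i) (v : TangentSpace (𝓡 d) x), ∃ f : E.model i ⟶ E.model i,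
      ∀ η, FiberCat.ev _ _ f η = D.formAt hx v η := fun i x hx v =>
    hP _ (E.model_mem i) _ (D.formAt_add hx v) (D.formAt_ract hx v)
  choose f hf using H
  -- Outside `E.U i` the form plays no role, and its value there is set to 0.
  refine ⟨fun i x v => if hx : x ∈ E.U i then f i x hx v else 0, fun s i x hx v => ?_⟩
  simp only [covLocal, hx, dite_true, hf]
  exact D.ev_cov s hx v

/-- The equation of parallelism is evaluated on sections which are constant in the trivialization,
so that only the derivative of f and the two forms survive. -/
theorem HasForm.intertwines {D : Connection E} {D' : Connection E'} {θ : LocalForm E}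
    {θ' : LocalForm E'} (h : HasForm D θ) (h' : HasForm D' θ') {f : E ⟶ E'}
    (hf : IsParallel D D' f) : Intertwines θ θ' (Hom.at f) := by
  intro i j x hi hj v
  refine ev_injective fun η => ?_
  obtain ⟨s, hs⟩ := exists_const_sec hi η
  have e1 : E'.trivialize j (s.map f).1 =ᶠ[𝓝 x] fun y =>
      realBilin (FiberCat.ev _ _) (localRep E E' (Hom.at f) i j y) η := by
    filter_upwards [(E.isOpen i).mem_nhds hi, (E'.isOpen j).mem_nhds hj, hs] with y hyi hyj hy
    refine (ev_localRep hyi hyj s.1).symm.trans ?_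
    rw [hy]
    rfl
  have e2 := congrArg (FiberCat.ev _ _ (E'.triv j x hj).hom) (hf s x v)
  rw [h' _ j x hj v, covLocal, mder_congr v e1, mder_bilin v _ (Hom.smoothAt f hi hj)
    contMDiffAt_const, mder_const, map_zero, zero_add, e1.eq_of_nhds] at e2
  rw [map_add, add_apply, FiberCat.ev_comp, FiberCat.ev_comp]
  refine e2.trans ?_
  rw [← h.ev_form hi v hs, localRep_of_mem hi hj, FiberCat.ev_comp, FiberCat.ev_comp,
    ev_iso_hom_inv]

theorem isParallel_of_intertwines {D : Connection E} {D' : Connection E'} {θ : LocalForm E}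
    {θ' : LocalForm E'} (h : HasForm D θ) (h' : HasForm D' θ') {f : E ⟶ E'}
    (hf : Intertwines θ θ' (Hom.at f)) : IsParallel D D' f := by
  intro s x v
  obtain ⟨i, hi⟩ := E.cover x
  obtain ⟨j, hj⟩ := E'.cover x
  refine ev_iso_injective (E'.triv j x hj) ?_
  rw [h' _ j x hj v, ev_covLocal hf s hi hj v, ← h s i x hi v, localRep_of_mem hi hj,
    FiberCat.ev_comp, FiberCat.ev_comp, ev_iso_hom_inv]

theorem IsParallel.id (D : Connection E) : IsParallel D D (𝟙 E) := fun s x v => by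
  rw [Sec.map_id]
  exact (FiberCat.ev_id _).symm

/-- The delicate point is smoothness. The connection only shows that θ(X) applied to each fixed
vector is smooth, and `contMDiffAt_of_strong` upgrades this to smoothness in norm. -/
theorem HasForm.isConnForm (hP : ∀ X, P X → IsAutoRegular X) {D : Connection E} {θ : LocalForm E}
    (h : HasForm D θ) : IsConnForm θ where
  add i x hx v w := ev_injective fun η => by
    obtain ⟨s, hs⟩ := exists_const_sec hx η
    rw [map_add, add_apply, ← h.ev_form hx _ hs, ← h.ev_form hx _ hs, ← h.ev_form hx _ hs, map_add,
      map_add]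
  smul i x hx r v := ev_injective fun η => by
    obtain ⟨s, hs⟩ := exists_const_sec hx η
    rw [← Complex.coe_smul, map_smul, smul_apply, ← h.ev_form hx _ hs, ← h.ev_form hx _ hs,
      map_smul, ← Complex.coe_smul, map_smul]
  smooth i x hx X hX := by
    have hr : ∀ f : E.model i ⟶ E.model i, ‖realBilin (FiberCat.ev _ _) f‖ = ‖f‖ := fun f =>
      (ContinuousLinearMap.norm_restrictScalars _).trans (LawfulFiberCat.norm_ev f)
    refine contMDiffAt_of_strong (realBilin (FiberCat.ev (E.model i) (E.model i))) hr
      (fun b S hb => ?_) (E.isOpen i) (fun η y hy => ?_) hx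
    -- A strong limit of morphisms is still A-linear, hence a morphism by automatic regularity.
    · obtain ⟨f, hf⟩ := hP _ (E.model_mem i) S (fun v w => map_add S v w) fun v a => by
        refine tendsto_nhds_unique (hb _) ?_
        have h1 := (((LawfulFiberCat.ractL (E.model i)).flip a).continuous.tendsto (S v)).comp
          (hb v)
        rw [ContinuousLinearMap.flip_apply, LawfulFiberCat.ractL_apply] at h1
        refine h1.congr fun n => ?_
        rw [Function.comp_apply, ContinuousLinearMap.flip_apply, LawfulFiberCat.ractL_apply]
        exact (LawfulFiberCat.ev_ract (b n) v a).symm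
      exact ⟨f, ContinuousLinearMap.ext hf⟩
    · obtain ⟨s, hs⟩ := exists_const_sec hy η
      have h1 : ContMDiffAt (𝓡 d) 𝓘(ℝ, FiberCat.Sp (E.model i)) ∞
          (E.trivialize i fun x => D.cov s x (X x)) y := D.smooth s X hX i y hy
      refine h1.congr_of_eventuallyEq ?_
      filter_upwards [hs.eventuallyEq_nhds, (E.isOpen i).mem_nhds hy] with z hz hzi
      rw [trivialize_of_mem hzi, h.ev_form hzi _ hz]
      rfl
  compat := h.intertwines h (IsParallel.id D)

theorem HasForm.unique {D : Connection E} {θ θ' : LocalForm E} (h : HasForm D θ)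
    (h' : HasForm D θ') (i : E.ι) (x : M) (hx : x ∈ E.U i) (v : TangentSpace (𝓡 d) x) :
    θ i x v = θ' i x v := ev_injective fun η => by
  obtain ⟨s, hs⟩ := exists_const_sec hx η
  rw [← h.ev_form hx v hs, ← h'.ev_form hx v hs]

/-- The covariant derivative of the connection `d + θ`. -/
def IsConnForm.cov {θ : LocalForm E} (hθ : IsConnForm θ) (s : E.Sec) (x : M) :
    TangentSpace (𝓡 d) x →L[ℝ] FiberCat.Sp (E.fiber x) :=
  let i := (E.cover x).choose
  let L : EuclideanSpace ℝ (Fin d) →ₗ[ℝ] FiberCat.Sp (E.fiber x) :=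
    { toFun := fun v => FiberCat.ev _ _ (E.triv i x (E.cover x).choose_spec).inv
        (covLocal θ i s.1 x v)
      map_add' := fun v w =>
        (congrArg _ (covLocal_add_right hθ (E.cover x).choose_spec s.1 v w)).trans (map_add _ _ _)
      map_smul' := fun r v => by
        refine (congrArg _ (covLocal_smul_right hθ (E.cover x).choose_spec s.1 r v)).trans ?_
        rw [← Complex.coe_smul, map_smul, Complex.coe_smul]
        rfl }
  L.toContinuousLinearMap

/-- The covariant derivative was defined with a chosen trivialization at each point; compatibility
of the local forms makes the choice irrelevant. -/
theorem IsConnForm.ev_cov {θ : LocalForm E} (hθ : IsConnForm θ) (s : E.Sec) (i : E.ι) (x : M)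
    (hx : x ∈ E.U i) (v : TangentSpace (𝓡 d) x) :
    FiberCat.ev _ _ (E.triv i x hx).hom (hθ.cov s x v) = covLocal θ i s.1 x v := by
  have hj := (E.cover x).choose_spec
  rw [ev_covLocal_change hθ.compat s hj hx v, localRep_of_mem hj hx, FiberCat.ev_comp,
    FiberCat.ev_comp, FiberCat.ev_id]
  rfl

/-- The connection `d + θ`. -/
def Connection.ofForm {θ : LocalForm E} (hθ : IsConnForm θ) : Connection E where
  cov := hθ.cov
  smooth s X hX := by
    intro i x hx
    have h1 : ContMDiffAt (𝓡 d) 𝓘(ℝ, FiberCat.Sp (E.model i)) ∞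
        (fun y => covLocal θ i s.1 y (X y)) x :=
      (contMDiffAt_mfderiv_vectorField (s.eventually_smoothAt hx) hX).add
        (contMDiffAt_bilin (realBilin (FiberCat.ev _ _)) (hθ.smooth i x hx X hX) (s.smoothAt hx))
    refine h1.congr_of_eventuallyEq ?_
    filter_upwards [(E.isOpen i).mem_nhds hx] with y hy
    exact (trivialize_of_mem hy fun x => hθ.cov s x (X x)).trans (hθ.ev_cov s i y hy (X y))
  add s t r hr x := by
    obtain rfl : r = s + t := Subtype.ext (funext hr)
    obtain ⟨i, hi⟩ := E.cover x
    refine ContinuousLinearMap.ext fun v => ev_iso_injective (E.triv i x hi) ?_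
    rw [add_apply, map_add, hθ.ev_cov _ i x hi, hθ.ev_cov _ i x hi, hθ.ev_cov _ i x hi, covLocal,
      covLocal, covLocal, Sec.add_val, trivialize_add, mder_add v (s.smoothAt hi) (t.smoothAt hi),
      Pi.add_apply, map_add, add_add_add_comm]
  leibniz s t f hf ht x v := by
    obtain rfl : t = s.ract f hf := Subtype.ext (funext ht)
    obtain ⟨i, hi⟩ := E.cover x
    refine ev_iso_injective (E.triv i x hi) ?_
    have e1 : E.trivialize i (s.ract f hf).1 =ᶠ[𝓝 x] fun y =>
        realBilin (LawfulFiberCat.ractL (E.model i)) (E.trivialize i s.1 y) (f y) := by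
      filter_upwards [(E.isOpen i).mem_nhds hi] with y hy using trivialize_ract hy s.1 f
    change _ = FiberCat.ev _ _ (E.triv i x hi).hom (FiberCat.ract (s.1 x) (mder f x v) +
      FiberCat.ract (hθ.cov s x v) (f x))
    rw [map_add, LawfulFiberCat.ev_ract, LawfulFiberCat.ev_ract, hθ.ev_cov _ i x hi,
      hθ.ev_cov _ i x hi, covLocal, covLocal, mder_congr v e1, e1.eq_of_nhds,
      mder_bilin v _ (s.smoothAt hi) (hf x), ← trivialize_of_mem hi,
      ← LawfulFiberCat.ractL_apply, ← LawfulFiberCat.ractL_apply, map_add, add_apply]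
    refine (add_assoc _ _ _).trans (congrArg₂ (· + ·) rfl (congrArg₂ (· + ·) rfl ?_))
    rw [LawfulFiberCat.ractL_apply (FiberCat.ev _ _ (θ i x v) _), ← LawfulFiberCat.ev_ract,
      ← LawfulFiberCat.ractL_apply]
    rfl

theorem hasForm_ofForm {θ : LocalForm E} (hθ : IsConnForm θ) :
    HasForm (Connection.ofForm hθ) θ := hθ.ev_cov

end ConnectionForms

/-! ### Extension and restriction of connections -/

section Inverse

variable {A : Type u} [CStarAlgebra A] [PartialOrder A] [StarOrderedRing A] {τ : FTrace A}

theorem l2Map_injective {V W : HilbMod A} {f g : V ⟶ W} (h : l2Map τ f = l2Map τ g) : f = g :=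
  HilbMod.hom_ext fun v => toL2_injective τ W <| by
    rw [← l2Map_toL2, ← l2Map_toL2, h]

variable (hK : IsLeftFull τ) {V W : HilbMod A} (hV : IsSelfDual hK V) (hW : IsSelfDual hK W)

/-- The inverse of `f ↦ l²(f)`. -/
def l2MapInv : (l2Obj τ V ⟶ l2Obj τ W) →L[ℂ] (V ⟶ W) :=
  ((FiberCat.compL V (bounded hK (l2Obj τ W)) W).flip (unitIso hK hW).inv) ∘L
    (FiberCat.compL V (bounded hK (l2Obj τ V)) (bounded hK (l2Obj τ W)) (unitIso hK hV).hom) ∘L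
    boundedMapL hK (l2Obj τ V) (l2Obj τ W)

/-- By the triangle identity, l² of the inverse unit is the counit; naturality of the counit then
leaves only f. -/
theorem l2Map_l2MapInv (f : l2Obj τ V ⟶ l2Obj τ W) : l2Map τ (l2MapInv hK hV hW f) = f := by
  have e : l2MapInv hK hV hW f =
      (unitIso hK hV).hom ≫ boundedMap hK f ≫ (unitIso hK hW).inv := rfl
  have hc : l2Map τ (unitIso hK hW).inv = counit hK (l2Obj τ W) := by
    have h1 : l2Map τ (unitIso hK hW).inv ≫ l2Map τ (unitIso hK hW).hom = 𝟙 _ :=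
      ((l2 τ).mapIso (unitIso hK hW)).inv_hom_id
    have h2 := congrArg (l2Map τ (unitIso hK hW).inv ≫ ·) (l2Map_unit_counit hK hW)
    simp only [Category.comp_id] at h2
    rw [← h2, ← Category.assoc, h1, Category.id_comp]
  rw [e]
  refine ((l2 τ).map_comp _ _).trans ?_
  rw [(l2 τ).map_comp]
  change l2Map τ _ ≫ l2Map τ _ ≫ l2Map τ _ = f
  rw [hc, counit_naturality, ← Category.assoc, l2Map_unit_counit, Category.id_comp]

end Inverse

section Extension

open Filter Topology HBundle

variable {A : Type u} [CStarAlgebra A] [PartialOrder A] [StarOrderedRing A] {τ : FTrace A}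
  {P : ObjectProperty (HilbMod A)} {Q : ObjectProperty (HilbSp A)}
  (h : ∀ V, P V → Q (l2Obj τ V)) {M : Type w} [TopologicalSpace M] {d : ℕ}
  [ChartedSpace (EuclideanSpace ℝ (Fin d)) M] {W W' : HBundle (smoothReg d M) P}

/-- The local form of the extension to `l²(W)`. -/
def l2Form [IsManifold (𝓡 d) ∞ M] (θ : LocalForm W) : LocalForm ((l2Bundle τ h).obj W) :=
  fun i x v => l2Map τ (θ i x v)

theorem l2_localRep (f : ∀ x, W.fiber x ⟶ W'.fiber x) (i : W.ι) (j : W'.ι) :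
    localRep ((l2Bundle τ h).obj W) ((l2Bundle τ h).obj W') (fun x => l2Map τ (f x)) i j =
      fun y => l2MapL τ (W.model i) (W'.model j) (localRep W W' f i j y) := by
  funext y
  by_cases hy : y ∈ W.U i ∧ y ∈ W'.U j
  · have hy' : y ∈ ((l2Bundle τ h).obj W).U i ∧ y ∈ ((l2Bundle τ h).obj W').U j := hy
    simp only [localRep, hy, hy', and_self, dite_true]
    refine Eq.symm (((l2 τ).map_comp _ _).trans ?_)
    rw [(l2 τ).map_comp]
    rfl
  · have hy' : ¬ (y ∈ ((l2Bundle τ h).obj W).U i ∧ y ∈ ((l2Bundle τ h).obj W').U j) := hy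
    simp only [localRep, hy, hy', dite_false, map_zero]
    rfl

theorem l2_trivialize (i : W.ι) (s : ∀ x, W.fiber x) {y : M} (hy : y ∈ W.U i) :
    ((l2Bundle τ h).obj W).trivialize i (fun x => toL2 τ (W.fiber x) (s x)) y =
      toL2 τ (W.model i) (W.trivialize i s y) := by
  have hy' : y ∈ ((l2Bundle τ h).obj W).U i := hy
  refine (trivialize_of_mem hy' _).trans ?_
  rw [trivialize_of_mem hy]
  exact l2Map_toL2 τ (W.triv i y hy).hom (s y)

/-- A section of `W` as a section of `l²(W)`. -/
def l2Sec (s : W.Sec) : ((l2Bundle τ h).obj W).Sec :=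
  ⟨fun x => toL2 τ (W.fiber x) (s.1 x), fun i x hx => by
    refine (smoothReg d M).congr ?_ ((smoothReg d M).clm (toL2L τ (W.model i)) (s.2 i x hx))
    filter_upwards [(W.isOpen i).mem_nhds hx] with y hy
    exact (l2_trivialize h i s.1 hy).symm⟩

variable [IsManifold (𝓡 d) ∞ M]

/-- The map f ↦ l²(f) is bounded and linear, so it commutes with derivatives, and it respects
composition. The second equation is thus the image of the first, and injectivity of l² gives the
converse. -/
theorem intertwines_l2_iff {θ : LocalForm W} {θ' : LocalForm W'} (f : W ⟶ W') :
    Intertwines (l2Form h θ) (l2Form h θ') (Hom.at ((l2Bundle τ h).map f)) ↔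
      Intertwines θ θ' (Hom.at f) := by
  have key : ∀ i j x, x ∈ W.U i → x ∈ W'.U j → ∀ v : TangentSpace (𝓡 d) x,
      (mder (localRep W W' (Hom.at f) i j) x v + localRep W W' (Hom.at f) i j x ≫ θ' j x v =
        θ i x v ≫ localRep W W' (Hom.at f) i j x) ↔
      (mder (localRep ((l2Bundle τ h).obj W) ((l2Bundle τ h).obj W')
          (Hom.at ((l2Bundle τ h).map f)) i j) x v +
        localRep ((l2Bundle τ h).obj W) ((l2Bundle τ h).obj W')
          (Hom.at ((l2Bundle τ h).map f)) i j x ≫ l2Form h θ' j x v =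
        l2Form h θ i x v ≫ localRep ((l2Bundle τ h).obj W) ((l2Bundle τ h).obj W')
          (Hom.at ((l2Bundle τ h).map f)) i j x) := by
    intro i j x hi hj v
    have e := l2_localRep h (Hom.at f) i j
    have e1 := congrFun e x
    have e2 := (congrArg (fun g => mder g x v) e).trans
      (mder_clm v ((l2MapL τ (W.model i) (W'.model j)).restrictScalars ℝ) (Hom.smoothAt f hi hj))
    have hL : l2MapL τ (W.model i) (W'.model j) (mder (localRep W W' (Hom.at f) i j) x v +
        localRep W W' (Hom.at f) i j x ≫ θ' j x v) = mder (localRep ((l2Bundle τ h).obj W)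
          ((l2Bundle τ h).obj W') (Hom.at ((l2Bundle τ h).map f)) i j) x v +
        localRep ((l2Bundle τ h).obj W) ((l2Bundle τ h).obj W')
          (Hom.at ((l2Bundle τ h).map f)) i j x ≫ l2Form h θ' j x v := by
      rw [map_add]
      refine congrArg₂ (· + ·) e2.symm (((l2 τ).map_comp _ _).trans ?_)
      exact congrArg (· ≫ l2Map τ (θ' j x v)) e1.symm
    have hR : l2MapL τ (W.model i) (W'.model j) (θ i x v ≫ localRep W W' (Hom.at f) i j x) =
        l2Form h θ i x v ≫ localRep ((l2Bundle τ h).obj W) ((l2Bundle τ h).obj W')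
          (Hom.at ((l2Bundle τ h).map f)) i j x :=
      ((l2 τ).map_comp _ _).trans (congrArg (l2Map τ (θ i x v) ≫ ·) e1.symm)
    exact ⟨fun H => hL.symm.trans ((congrArg _ H).trans hR),
      fun H => l2Map_injective (hL.trans (H.trans hR.symm))⟩
  exact ⟨fun H i j x hi hj v => (key i j x hi hj v).2 (H i j x hi hj v),
    fun H i j x hi hj v => (key i j x hi hj v).1 (H i j x hi hj v)⟩

theorem intertwines_id_l2_iff {θ : LocalForm W} :
    Intertwines (l2Form h θ) (l2Form h θ) (fun _ => 𝟙 _) ↔ Intertwines θ θ fun _ => 𝟙 _ := by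
  have e := intertwines_l2_iff h (θ := θ) (θ' := θ) (𝟙 W)
  rw [CategoryTheory.Functor.map_id] at e
  exact e

theorem IsConnForm.l2Form {θ : LocalForm W} (hθ : IsConnForm θ) : IsConnForm (l2Form h θ) where
  add i x hx v w := (congrArg (l2MapL τ _ _) (hθ.add i x hx v w)).trans (map_add _ _ _)
  smul i x hx r v := (congrArg (l2MapL τ _ _) (hθ.smul i x hx r v)).trans
    (map_smul ((l2MapL τ (W.model i) (W.model i)).restrictScalars ℝ) r _)
  smooth i x hx X hX := (smoothReg d M).clm (l2MapL τ (W.model i) (W.model i))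
    (hθ.smooth i x hx X hX)
  compat := (intertwines_id_l2_iff h).2 hθ.compat

variable (hK : IsLeftFull τ) (hP : ∀ V, P V → IsSelfDual hK V)

/-- The local form of the restriction to `W`. -/
def restrictForm (θ : LocalForm ((l2Bundle τ h).obj W)) : LocalForm W := fun i x v =>
  l2MapInv hK (hP _ (W.model_mem i)) (hP _ (W.model_mem i)) (θ i x v)

theorem l2Form_restrictForm (θ : LocalForm ((l2Bundle τ h).obj W)) :
    l2Form h (restrictForm h hK hP θ) = θ :=
  funext fun _ => funext fun _ => funext fun _ => l2Map_l2MapInv hK _ _ _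

theorem IsConnForm.restrictForm {θ : LocalForm ((l2Bundle τ h).obj W)} (hθ : IsConnForm θ) :
    IsConnForm (restrictForm h hK hP θ) where
  add i x hx v w := (congrArg (l2MapInv hK _ _) (hθ.add i x hx v w)).trans (map_add _ _ _)
  smul i x hx r v := (congrArg (l2MapInv hK _ _) (hθ.smul i x hx r v)).trans
    (map_smul ((l2MapInv hK (hP _ (W.model_mem i)) (hP _ (W.model_mem i))).restrictScalars ℝ) r _)
  smooth i x hx X hX := (smoothReg d M).clm
    (l2MapInv hK (hP _ (W.model_mem i)) (hP _ (W.model_mem i))) (hθ.smooth i x hx X hX)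
  compat := by
    refine (intertwines_id_l2_iff h).1 ?_
    rw [l2Form_restrictForm]
    exact hθ.compat

theorem covLocal_l2Sec (θ : LocalForm W) (s : W.Sec) {i : W.ι} {x : M} (hx : x ∈ W.U i)
    (v : TangentSpace (𝓡 d) x) :
    covLocal (AHilb.l2Form h θ) i (l2Sec h s).1 x v =
      toL2 τ (W.model i) (covLocal θ i s.1 x v) := by
  have e1 : ((l2Bundle τ h).obj W).trivialize i (l2Sec h s).1 =ᶠ[𝓝 x] fun y =>
      (toL2L τ (W.model i)).restrictScalars ℝ (W.trivialize i s.1 y) := by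
    filter_upwards [(W.isOpen i).mem_nhds hx] with y hy using l2_trivialize h i s.1 hy
  refine Eq.trans ?_ (map_add (toL2 τ (W.model i)) _ _).symm
  refine congrArg₂ (· + ·) ((mder_congr v e1).trans (mder_clm v _ (s.smoothAt hx))) ?_
  refine Eq.trans ?_ (l2Map_toL2 τ (θ i x v) (W.trivialize i s.1 x))
  exact congrArg (HilbSp.Hom.op (l2Map τ (θ i x v))) e1.eq_of_nhds

theorem ev_triv_toL2 {i : W.ι} {x : M} (hx : x ∈ W.U i) (η : W.fiber x) :
    FiberCat.ev _ _ (((l2Bundle τ h).obj W).triv i x hx).hom (toL2 τ (W.fiber x) η) =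
      toL2 τ (W.model i) (FiberCat.ev _ _ (W.triv i x hx).hom η) :=
  l2Map_toL2 τ (W.triv i x hx).hom η

theorem extends_of_hasForm {D : Connection W} {D' : Connection ((l2Bundle τ h).obj W)}
    {θ : LocalForm W} (hD : HasForm D θ) (hD' : HasForm D' (l2Form h θ)) : Extends τ h D D' := by
  intro s s' hs x v
  obtain rfl : s' = l2Sec h s := Subtype.ext (funext hs)
  obtain ⟨i, hi⟩ := W.cover x
  refine ev_iso_injective (((l2Bundle τ h).obj W).triv i x hi) ?_
  refine (hD' _ i x hi v).trans ((covLocal_l2Sec h θ s hi v).trans ?_)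
  rw [← hD s i x hi v]
  exact (ev_triv_toL2 h hi _).symm

variable [T2Space M]

/-- An extension is prescribed on constant local sections with values in the Hilbert module. These
values are dense in l² of the model, and the form of D' consists of bounded operators, so it must be
l²(θ). -/
theorem hasForm_of_extends (hQ : ∀ X, Q X → IsAutoRegular X) {D : Connection W}
    {D' : Connection ((l2Bundle τ h).obj W)} {θ : LocalForm W} (hD : HasForm D θ)
    (hE : Extends τ h D D') : HasForm D' (l2Form h θ) := by
  obtain ⟨θ', hθ'⟩ := exists_hasForm hQ D'
  refine hθ'.congr fun i x hx v => l2_hom_ext τ fun η => ?_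
  obtain ⟨s, hs⟩ := exists_const_sec (E := W) hx η
  have hs' : ((l2Bundle τ h).obj W).trivialize i (l2Sec h s).1 =ᶠ[𝓝 x] fun _ =>
      toL2 τ (W.model i) η := by
    filter_upwards [hs, (W.isOpen i).mem_nhds hx] with y hy hyi
    exact (l2_trivialize h i s.1 hyi).trans (congrArg _ hy)
  refine (hθ'.ev_form hx v hs').symm.trans ?_
  rw [hE s (l2Sec h s) (fun _ => rfl) x v]
  refine (ev_triv_toL2 h hx _).trans (Eq.trans ?_ (l2Map_toL2 τ (θ i x v) η).symm)
  exact congrArg _ (hD.ev_form hx v hs)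

variable (hP' : ∀ V, P V → IsAutoRegular V) (hQ : ∀ X, Q X → IsAutoRegular X)

include hP' hQ in
theorem existsUnique_extension (D : Connection W) : ∃! D', Extends τ h D D' := by
  obtain ⟨θ, hθ⟩ := exists_hasForm hP' D
  have h1 := hasForm_ofForm ((hθ.isConnForm hP').l2Form h)
  exact ⟨_, extends_of_hasForm h hθ h1, fun D' hD' => (hasForm_of_extends h hQ hθ hD').ext h1⟩

include hK hP hP' hQ in
-- Since f ↦ l²(f) is a bijection on morphisms whose inverse is bounded linear, the form of D' is l²
-- of exactly one form, and that form is again smooth.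
theorem existsUnique_restriction (D' : Connection ((l2Bundle τ h).obj W)) :
    ∃! D, Extends τ h D D' := by
  obtain ⟨θ, hθ⟩ := exists_hasForm hQ D'
  have h1 := hasForm_ofForm ((hθ.isConnForm hQ).restrictForm h hK hP)
  refine ⟨_, extends_of_hasForm h h1 (by rwa [l2Form_restrictForm]), fun D hD => ?_⟩
  obtain ⟨θ₁, hθ₁⟩ := exists_hasForm hP' D
  refine HasForm.ext (hθ₁.congr fun i x hx v => l2Map_injective (τ := τ) ?_) h1
  have h2 := (hasForm_of_extends h hQ hθ₁ hD).unique hθ i x hx v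
  exact h2.trans (l2Map_l2MapInv hK _ _ _).symm

include hP' hQ in
-- Parallelism is the intertwining equation for the forms, which l² preserves and reflects. The
-- reflecting direction is what makes A(·) act on parallel morphisms.
theorem isParallel_l2_iff {D₁ : Connection W} {D₂ : Connection W'}
    {D₁' : Connection ((l2Bundle τ h).obj W)} {D₂' : Connection ((l2Bundle τ h).obj W')}
    (h₁ : Extends τ h D₁ D₁') (h₂ : Extends τ h D₂ D₂') (f : W ⟶ W') :
    IsParallel D₁' D₂' ((l2Bundle τ h).map f) ↔ IsParallel D₁ D₂ f := by
  obtain ⟨θ₁, hθ₁⟩ := exists_hasForm hP' D₁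
  obtain ⟨θ₂, hθ₂⟩ := exists_hasForm hP' D₂
  have h₁' := hasForm_of_extends h hQ hθ₁ h₁
  have h₂' := hasForm_of_extends h hQ hθ₂ h₂
  exact ⟨fun H => isParallel_of_intertwines hθ₁ hθ₂
      ((intertwines_l2_iff h f).1 (h₁'.intertwines h₂' H)),
    fun H => isParallel_of_intertwines h₁' h₂'
      ((intertwines_l2_iff h f).2 (hθ₁.intertwines hθ₂ H))⟩

end Extension

/-! ### Parallel morphisms and transport of connections -/

section Parallel

open HBundle

variable {A : Type u} [CStarAlgebra A] {C : Type (u + 1)} [Category.{u} C] [FiberCat A C]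
  {M : Type w} [TopologicalSpace M] {d : ℕ} [ChartedSpace (EuclideanSpace ℝ (Fin d)) M]
  [IsManifold (𝓡 d) ∞ M] {P : ObjectProperty C} {E E' E'' : HBundle (smoothReg d M) P}

theorem Sec.map_comp (f : E ⟶ E') (g : E' ⟶ E'') (s : E.Sec) :
    s.map (f ≫ g) = (s.map f).map g :=
  Subtype.ext (funext fun _ => FiberCat.ev_comp _ _ _)

theorem IsParallel.comp {D : Connection E} {D' : Connection E'} {D'' : Connection E''}
    {f : E ⟶ E'} {g : E' ⟶ E''} (hf : IsParallel D D' f) (hg : IsParallel D' D'' g) :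
    IsParallel D D'' (f ≫ g) := fun s x v => by
  rw [Sec.map_comp, hg, hf]
  exact (FiberCat.ev_comp _ _ _).symm

theorem ev_at_hom_inv (e : E ≅ E') (x : M) (v : FiberCat.Sp (E.fiber x)) :
    FiberCat.ev _ _ (Hom.at e.inv x) (FiberCat.ev _ _ (Hom.at e.hom x) v) = v := by
  rw [← FiberCat.ev_comp]
  refine (congrArg (fun f : E ⟶ E => FiberCat.ev _ _ (Hom.at f x) v) e.hom_inv_id).trans ?_
  exact FiberCat.ev_id v

theorem IsParallel.inv {D : Connection E} {D' : Connection E'} {e : E ≅ E'}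
    (he : IsParallel D D' e.hom) : IsParallel D' D e.inv := fun s x v => by
  have h := he (s.map e.inv) x v
  rw [← Sec.map_comp, e.inv_hom_id, Sec.map_id] at h
  rw [h, ev_at_hom_inv]

/-- An isomorphism of bundles with connections, from a parallel isomorphism. -/
def ConnBundle.isoMk {E E' : ConnBundle M d P} (e : E.bundle ≅ E'.bundle)
    (he : IsParallel E.conn E'.conn e.hom) : E ≅ E' where
  hom := ⟨e.hom, he⟩
  inv := ⟨e.inv, he.inv⟩
  hom_inv_id := Subtype.ext e.hom_inv_id
  inv_hom_id := Subtype.ext e.inv_hom_id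

variable [LawfulFiberCat A C]

/-- The connection corresponding to `D` under an isomorphism of bundles. -/
def Connection.transport (e : E ≅ E') (D : Connection E') : Connection E where
  cov s x := ((FiberCat.ev _ _ (Hom.at e.inv x)).restrictScalars ℝ) ∘L D.cov (s.map e.hom) x
  smooth s X hX :=
    (Sec.map e.inv ⟨fun x => D.cov (s.map e.hom) x (X x), D.smooth (s.map e.hom) X hX⟩).2
  add s t r hr x := by
    rw [D.add (s.map e.hom) (t.map e.hom) (r.map e.hom) (fun y => by
      change FiberCat.ev _ _ _ (r.1 y) = FiberCat.ev _ _ _ (s.1 y) + FiberCat.ev _ _ _ (t.1 y)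
      rw [hr, map_add]) x, ContinuousLinearMap.comp_add]
  leibniz s t f hf ht x v := by
    have h := D.leibniz (s.map e.hom) (t.map e.hom) f hf (fun y => by
      change FiberCat.ev _ _ _ (t.1 y) = FiberCat.ract (FiberCat.ev _ _ _ (s.1 y)) (f y)
      rw [ht, LawfulFiberCat.ev_ract]) x v
    refine (congrArg (FiberCat.ev _ _ (Hom.at e.inv x)) h).trans ?_
    change FiberCat.ev _ _ (Hom.at e.inv x) (FiberCat.ract ((s.map e.hom).1 x) (mder f x v) +
      FiberCat.ract (D.cov (s.map e.hom) x v) (f x)) = _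
    rw [map_add, LawfulFiberCat.ev_ract, LawfulFiberCat.ev_ract]
    refine congrArg₂ (· + ·) (congrArg (fun w => FiberCat.ract w _) ?_) rfl
    exact ev_at_hom_inv e x (s.1 x)

theorem Connection.isParallel_transport (e : E ≅ E') (D : Connection E') :
    IsParallel (D.transport e) D e.hom := fun s x v =>
  (ev_at_hom_inv e.symm x (D.cov (s.map e.hom) x v)).symm

end Parallel

/-! ### The equivalence for bundles with connection -/

section ConnBundles

open HBundle

variable {A : Type u} [CStarAlgebra A] [PartialOrder A] [StarOrderedRing A] {τ : FTrace A}
  (hK : IsLeftFull τ) {P : ObjectProperty (HilbMod A)} {Q : ObjectProperty (HilbSp A)}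
  (h : ∀ V, P V → Q (l2Obj τ V)) (h' : ∀ X, Q X → P (bounded hK X))
  (hQ : ∀ X, Q X → HasDenseBounded τ X) (hP : ∀ V, P V → IsSelfDual hK V)
  (hPr : ∀ V, P V → IsAutoRegular V) (hQr : ∀ X, Q X → IsAutoRegular X)
  {M : Type w} [TopologicalSpace M] {d : ℕ} [ChartedSpace (EuclideanSpace ℝ (Fin d)) M]
  [IsManifold (𝓡 d) ∞ M] [T2Space M]

/-- The connection on `l²(A(X))` corresponding to a connection on `X`. -/
def counitConnection (X : ConnBundle M d Q) :
    Connection ((l2Bundle τ h).obj (boundedBundleObj hK h' X.bundle)) :=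
  X.conn.transport (counitBundleIso hK h h' hQ X.bundle)

/-- The restriction of a connection on `X` to `A(X)`. -/
def boundedConnection (X : ConnBundle M d Q) : Connection (boundedBundleObj hK h' X.bundle) :=
  (existsUnique_restriction h hK hP hPr hQr (counitConnection hK h h' hQ X)).choose

theorem extends_boundedConnection (X : ConnBundle M d Q) :
    Extends τ h (boundedConnection hK h h' hQ hP hPr hQr X) (counitConnection hK h h' hQ X) :=
  (existsUnique_restriction h hK hP hPr hQr (counitConnection hK h h' hQ X)).choose_spec.1

/-- This is naturality of the counit, solved for l²(A(f)). It exhibits l²(A(f)) as a composite of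
parallel morphisms when f is parallel. -/
theorem l2Bundle_boundedBundle_map {X Y : HBundle (smoothReg d M) Q} (f : X ⟶ Y) :
    (l2Bundle τ h).map ((boundedBundle hK h').map f) =
      (counitBundleIso hK h h' hQ X).hom ≫ f ≫ (counitBundleIso hK h h' hQ Y).inv :=
  ((Iso.eq_comp_inv (counitBundleIso hK h h' hQ Y)).2
    ((counitBundle hK h h' hQ).hom.naturality f)).trans (Category.assoc _ _ _)

/-- The functor `X ↦ A(X)` on bundles with connections. -/
def boundedConn : ConnBundle M d Q ⥤ ConnBundle M d P where
  obj X := ⟨boundedBundleObj hK h' X.bundle, boundedConnection hK h h' hQ hP hPr hQr X⟩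
  map {X Y} f := ⟨(boundedBundle hK h').map f.1,
    (isParallel_l2_iff h hPr hQr (extends_boundedConnection hK h h' hQ hP hPr hQr X)
      (extends_boundedConnection hK h h' hQ hP hPr hQr Y) _).1
      ((congrArg (fun g => IsParallel (counitConnection hK h h' hQ X)
        (counitConnection hK h h' hQ Y) g) (l2Bundle_boundedBundle_map hK h h' hQ f.1)).mpr
        ((X.conn.isParallel_transport _).comp
          (IsParallel.comp f.2 (Y.conn.isParallel_transport _).inv)))⟩
  map_id X := Subtype.ext ((boundedBundle hK h').map_id X.bundle)
  map_comp f g := Subtype.ext ((boundedBundle hK h').map_comp f.1 g.1)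

variable
  (h₁ : ∀ (W : HBundle (smoothReg d M) P) (D : Connection W), ∃! D', Extends τ h D D')
  (h₂ : ∀ (W W' : HBundle (smoothReg d M) P) (D : Connection W) (D' : Connection W')
    (f : W ⟶ W'), IsParallel D D' f →
    IsParallel (h₁ W D).choose (h₁ W' D').choose ((l2Bundle τ h).map f))

/-- The chosen extension to l²(A(X)) and the connection transported from X both extend the
connection of A(X), so they agree by uniqueness. -/
theorem choose_boundedConnection (X : ConnBundle M d Q) :
    (h₁ _ (boundedConnection hK h h' hQ hP hPr hQr X)).choose = counitConnection hK h h' hQ X :=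
  (h₁ _ _).unique (h₁ _ _).choose_spec.1 (extends_boundedConnection hK h h' hQ hP hPr hQr X)

/-- The natural isomorphism `l²(A(X)) ≅ X` of bundles with connections. -/
def counitConn : boundedConn hK h h' hQ hP hPr hQr ⋙ l2Conn τ h h₁ h₂ ≅ 𝟭 (ConnBundle M d Q) :=
  NatIso.ofComponents
    (fun X => ConnBundle.isoMk (counitBundleIso hK h h' hQ X.bundle) (by
      have e := choose_boundedConnection hK h h' hQ hP hPr hQr h₁ X
      change IsParallel (h₁ _ (boundedConnection hK h h' hQ hP hPr hQr X)).choose X.conn _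
      rw [e]
      exact X.conn.isParallel_transport _))
    fun {X Y} f => Subtype.ext ((counitBundle hK h h' hQ).hom.naturality f.1)

theorem l2_unitBundleIso_comp (W : HBundle (smoothReg d M) P) :
    (l2Bundle τ h).map (unitBundleIso hK h h' hP W).hom ≫
      (counitBundleIso hK h h' hQ (l2BundleObj τ h W)).hom = 𝟙 _ :=
  HBundle.Hom.ext (funext fun x => l2Map_unit_counit hK (hP _ (W.fiber_mem x)))

/-- By the triangle identity, l² of the unit is the inverse of the counit, which is parallel by
construction, and l² reflects parallelism. -/
theorem isParallel_unitBundleIso (W : ConnBundle M d P) :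
    IsParallel W.conn (boundedConnection hK h h' hQ hP hPr hQr ((l2Conn τ h h₁ h₂).obj W))
      (unitBundleIso hK h h' hP W.bundle).hom := by
  let X : ConnBundle M d Q := (l2Conn τ h h₁ h₂).obj W
  refine (isParallel_l2_iff h hPr hQr (h₁ _ W.conn).choose_spec.1
    (extends_boundedConnection hK h h' hQ hP hPr hQr X) _).1 ?_
  have e : (l2Bundle τ h).map (unitBundleIso hK h h' hP W.bundle).hom =
      (counitBundleIso hK h h' hQ (l2BundleObj τ h W.bundle)).inv :=
    ((Iso.eq_comp_inv (counitBundleIso hK h h' hQ (l2BundleObj τ h W.bundle))).2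
      (l2_unitBundleIso_comp hK h h' hQ hP W.bundle)).trans (Category.id_comp _)
  exact (congrArg (fun g => IsParallel X.conn (counitConnection hK h h' hQ X) g) e).mpr
    (X.conn.isParallel_transport (counitBundleIso hK h h' hQ X.bundle)).inv

/-- The natural isomorphism `W ≅ A(l²(W))` of bundles with connections. -/
def unitConn : 𝟭 (ConnBundle M d P) ≅ l2Conn τ h h₁ h₂ ⋙ boundedConn hK h h' hQ hP hPr hQr :=
  NatIso.ofComponents (fun W => ConnBundle.isoMk (unitBundleIso hK h h' hP W.bundle)
      (isParallel_unitBundleIso hK h h' hQ hP hPr hQr h₁ h₂ W))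
    fun {W W'} f => Subtype.ext (HBundle.Hom.ext (funext fun x => unit_hom_naturality hK
      (hP _ (W.bundle.fiber_mem x)) (hP _ (W'.bundle.fiber_mem x)) (HBundle.Hom.at f.1 x)))

theorem isQuasiInverse_conn : IsQuasiInverse (l2Conn τ h h₁ h₂)
    (boundedConn hK h h' hQ hP hPr hQr) (counitConn hK h h' hQ hP hPr hQr h₁ h₂) :=
  ⟨unitConn hK h h' hQ hP hPr hQr h₁ h₂,
    fun W => Subtype.ext (l2_unitBundleIso_comp hK h h' hQ hP W.bundle)⟩

end ConnBundles

end

end AHilb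

theorem mainTheorem8 {A : Type u} [CStarAlgebra A] [PartialOrder A] [StarOrderedRing A]
    {𝓗 : Type u} [NormedAddCommGroup 𝓗] [InnerProductSpace ℂ 𝓗] [CompleteSpace 𝓗]
    (N : VonNeumannAlgebra 𝓗) (e : A ≃⋆ₐ[ℂ] N.toStarSubalgebra)
    (τ : FTrace A) (hτ : τ.IsNormal N e) :
    -- finitely generated projective modules and `A`-Hilbert spaces
    (∃ h : ∀ V : HilbMod A, HilbMod.IsFGProjective V → HilbSp.IsFGProjective τ (l2Obj τ V),
      (∃ (𝒜 : (HilbSp.IsFGProjective τ).FullSubcategory ⥤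
            (HilbMod.IsFGProjective (A := A)).FullSubcategory)
          (ε : 𝒜 ⋙ l2Sub τ h ≅ 𝟭 _),
        IsQuasiInverse (l2Sub τ h) 𝒜 ε ∧
        ∀ X, IsFGAOf τ X.obj (𝒜.obj X).obj
          (fun v => HilbSp.Hom.op (ε.hom.app X).hom (toL2 τ (𝒜.obj X).obj v))) ∧
      -- continuous bundles
      (∀ (M : Type w) [TopologicalSpace M] [T2Space M] [LocallyCompactSpace M],
        ∃ (𝒜 : HBundle (contReg M) (HilbSp.IsFGProjective τ) ⥤
            HBundle (contReg M) (HilbMod.IsFGProjective (A := A)))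
          (ε : 𝒜 ⋙ l2Bundle τ h ≅ 𝟭 _),
        IsQuasiInverse (l2Bundle τ h) 𝒜 ε ∧
        ∀ X x, IsFGAOf τ (X.fiber x) ((𝒜.obj X).fiber x)
          (fun v => HilbSp.Hom.op (HBundle.Hom.at (ε.hom.app X) x)
            (toL2 τ ((𝒜.obj X).fiber x) v))) ∧
      -- smooth bundles, without and with connections
      (∀ (d : ℕ) (M : Type w) [TopologicalSpace M] [T2Space M]
          [ChartedSpace (EuclideanSpace ℝ (Fin d)) M] [IsManifold (𝓡 d) ∞ M],
        (∃ (𝒜 : HBundle (smoothReg d M) (HilbSp.IsFGProjective τ) ⥤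
              HBundle (smoothReg d M) (HilbMod.IsFGProjective (A := A)))
            (ε : 𝒜 ⋙ l2Bundle τ h ≅ 𝟭 _),
          IsQuasiInverse (l2Bundle τ h) 𝒜 ε ∧
          ∀ X x, IsFGAOf τ (X.fiber x) ((𝒜.obj X).fiber x)
            (fun v => HilbSp.Hom.op (HBundle.Hom.at (ε.hom.app X) x)
              (toL2 τ ((𝒜.obj X).fiber x) v))) ∧
        (∀ (W : HBundle (smoothReg d M) (HilbMod.IsFGProjective (A := A)))
            (D' : Connection ((l2Bundle τ h).obj W)), ∃! D, Extends τ h D D') ∧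
        (∃ (h₁ : ∀ (W : HBundle (smoothReg d M) (HilbMod.IsFGProjective (A := A)))
              (D : Connection W), ∃! D', Extends τ h D D')
            (h₂ : ∀ (W W' : HBundle (smoothReg d M) (HilbMod.IsFGProjective (A := A)))
              (D : Connection W) (D' : Connection W') (f : W ⟶ W'), IsParallel D D' f →
              IsParallel (h₁ W D).choose (h₁ W' D').choose ((l2Bundle τ h).map f))
            (𝒜 : ConnBundle M d (HilbSp.IsFGProjective τ) ⥤
              ConnBundle M d (HilbMod.IsFGProjective (A := A)))
            (ε : 𝒜 ⋙ l2Conn τ h h₁ h₂ ≅ 𝟭 _),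
          IsQuasiInverse (l2Conn τ h h₁ h₂) 𝒜 ε ∧
          ∀ X x, IsFGAOf τ (X.bundle.fiber x) ((𝒜.obj X).bundle.fiber x)
            (fun v => HilbSp.Hom.op (HBundle.Hom.at (ε.hom.app X).1 x)
              (toL2 τ ((𝒜.obj X).bundle.fiber x) v))))) ∧
    -- projective modules and general `A`-Hilbert spaces
    (∃ h : ∀ V : HilbMod A, HilbMod.IsProjective N e V → HilbSp.IsAHilbert τ (l2Obj τ V),
      ∃ (𝒜 : (HilbSp.IsAHilbert τ).FullSubcategory ⥤ (HilbMod.IsProjective N e).FullSubcategory)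
          (ε : 𝒜 ⋙ l2Sub τ h ≅ 𝟭 _),
        IsQuasiInverse (l2Sub τ h) 𝒜 ε ∧
        ∀ X, IsAOf τ N e X.obj (𝒜.obj X).obj
          (fun v => HilbSp.Hom.op (ε.hom.app X).hom (toL2 τ (𝒜.obj X).obj v))) := by
  have hK := isLeftFull_of_isNormal N e hτ
  let h := isFGProjective_l2Obj hK
  have h' := isFGProjective_bounded hK
  have hQ : ∀ X, HilbSp.IsFGProjective τ X → HasDenseBounded τ X :=
    hasDenseBounded_of_isFGProjective
  have hP := isSelfDual_of_isFGProjective hK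
  have hPr : ∀ V : HilbMod A, HilbMod.IsFGProjective V → IsAutoRegular V :=
    isAutoRegular_of_isFGProjective
  have hQr := isAutoRegular_of_isFGProjective_hilbSp hK
  refine ⟨⟨h, ⟨boundedSub hK h', counitSub hK h h' hQ, isQuasiInverse_sub hK h h' hQ hP,
      fun X => isFGAOf_counit hK X.obj⟩, ?_, ?_⟩, ?_⟩
  · intro M _ _ _
    exact ⟨boundedBundle hK h', counitBundle hK h h' hQ, isQuasiInverse_bundle hK h h' hQ hP,
      fun X x => isFGAOf_counit hK (X.fiber x)⟩
  · intro d M _ _ _ _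
    let h₁ : ∀ (W : HBundle (smoothReg d M) (HilbMod.IsFGProjective (A := A)))
        (D : Connection W), ∃! D', Extends τ h D D' :=
      fun W D => existsUnique_extension h hPr hQr D
    refine ⟨⟨boundedBundle hK h', counitBundle hK h h' hQ, isQuasiInverse_bundle hK h h' hQ hP,
        fun X x => isFGAOf_counit hK (X.fiber x)⟩,
      fun W D' => existsUnique_restriction h hK hP hPr hQr D',
      h₁, fun W W' D D' f hf => (isParallel_l2_iff h hPr hQr (h₁ W D).choose_spec.1
        (h₁ W' D').choose_spec.1 f).2 hf,
      boundedConn hK h h' hQ hP hPr hQr, counitConn hK h h' hQ hP hPr hQr h₁ _,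
      isQuasiInverse_conn hK h h' hQ hP hPr hQr h₁ _,
      fun X x => isFGAOf_counit hK (X.bundle.fiber x)⟩
  · have g := isAHilbert_l2Obj hK N e hτ
    have g' := isProjective_bounded hK N e hτ
    have gQ : ∀ X, HilbSp.IsAHilbert τ X → HasDenseBounded τ X := hasDenseBounded_of_isAHilbert
    exact ⟨g, boundedSub hK g', counitSub hK g g' gQ,
      isQuasiInverse_sub hK g g' gQ (isSelfDual_of_isProjective hK N e hτ),
      fun X => isAOf_counit hK N e hτ X.obj⟩
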